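/- Let $n\in\mathbb{N}$ and let $\eta=(\eta_{jk})_{j,k=1}^n$ be a matrix of finite signed Borel measures on $\mathbb{R}$ concentrated on $[0,\infty)$ with second moment, i.e. $\int u^2\,|\eta_{jk}|(du)<\infty$ for all $j,k$. For $\operatorname{Re}(z)\le 0$ set $$h(z)=-zI_n-\mathcal{L}[\eta](z),\qquad \mathcal{L}[\eta]_{jk}(z)=\int_{[0,\infty)}e^{zu}\,\eta_{jk}(du),$$ and assume $\det h(iy)\neq 0$ for all $y\in\mathbb{R}$. Let $(Z_t)_{t\in\mathbb{R}}$ be an $\mathbb{R}^n$-valued (jointly) measurable process on a probability space $(\Omega,\mathcal{F},\mathbb{P})$ with $\mathbb{E}|Z_t|<\infty$ for all $t$ and with stationary increments. A stationary solution of $$dX_t=\eta\ast X(t)\,dt+dZ_t \tag{1}$$ is a (strictly) stationary, measurable, $\mathbb{R}^n$-valued process $(X_t)_{t\in\mathbb{R}}$ on $(\Omega,\mathcal{F},\mathbb{P})$ such that for all $s<t$, almost surely, for $j=1,\dots,n$, the integrals below converge absolutely and $$X^j_t-X^j_s=\sum_{k=1}^n\int_s^t\int_{[0,\infty)}X^k_{u-v}\,\eta_{jk}(dv)\,du+Z^j_t-Z^j_s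 .$$ Then there is a function $g:\mathbb{R}\to\mathbb{R}^{n\times n}$ with entries in $L^2$, unique up to Lebesgue null sets, such that $\mathcal{F}[g](y)=h(iy)^{-1}$ for almost every $y$, where $\mathcal{F}$ is the $L^2$-extension of $f\mapsto\int_{\mathbb{R}}e^{iyu}f(u)\,du$. With $(g\ast\eta)_{jk}(t)=\sum_l\int g_{jl}(t-v)\,\eta_{lk}(dv)$, which converges absolutely for almost every $t$, the process $$X_t=Z_t+\int_{\mathbb{R}}g\ast\eta(t-u)\,Z_u\,du,\qquad t\in\mathbb{R},\tag{2}$$ is well defined, in the sense that for each $t$ the integrals $\int (g\ast\eta)_{jk}(t-u)Z^k_u\,du$ converge absolutely almost surely (on the exceptional null set a non-convergent integral is given the value $0$), and it is the unique stationary integrable solution of (1) up to modification: it is a stationary solution with $\mathbb{E}|X_t|<\infty$ for all $t$, and any other such solution $(\tilde X_t)$ satisfies $\tilde X_t=X_t$ almost surely for each $t$. If in addition $\det h(z)\neq0$ for all $z\in\mathbb{C}$ with $\operatorname{Re}(z)\le0$, then the solution (2) is causal: for each $t$, $X_t$ is measurable with respect to $\sigma(Z_t-Z_s: s<t)$ augmented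 by the $\mathbb{P}$-null sets, i.e. $X_t$ is almost surely equal to a $\sigma(Z_t-Z_s:s<t)$-measurable random variable. -/

import Mathlib

open MeasureTheory ProbabilityTheory

namespace MSDDE

noncomputable section

/-- An `n × n` matrix of finite signed Borel measures on `ℝ`. -/
abbrev MatrixMeasure (n : ℕ) : Type := Matrix (Fin n) (Fin n) (SignedMeasure ℝ)

/-- Integral `∫ f dμ = ∫ f dμ⁺ - ∫ f dμ⁻` against a signed measure with Jordan decomposition
`μ = μ⁺ - μ⁻`; meaningful when `f` is integrable for `|μ| = μ⁺ + μ⁻` (`μ.totalVariation`). -/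
def sintegral {E : Type*} [NormedAddCommGroup E] [NormedSpace ℝ E]
    (μ : SignedMeasure ℝ) (f : ℝ → E) : E :=
  (∫ u, f u ∂μ.toJordanDecomposition.posPart) - ∫ u, f u ∂μ.toJordanDecomposition.negPart

/-- All entries of `η` are concentrated on `[0, ∞)`. -/
def ConcentratedOnNonneg {n : ℕ} (η : MatrixMeasure n) : Prop :=
  ∀ j k, (η j k).totalVariation (Set.Iio 0) = 0

/-- `η` has a moment of order `p`: `∫ |u| ^ p |η_jk|(du) < ∞` for all `j, k`. -/
def HasMoment {n : ℕ} (η : MatrixMeasure n) (p : ℕ) : Prop :=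
  ∀ j k, Integrable (fun u : ℝ => |u| ^ p) (η j k).totalVariation

/-- Entrywise Laplace transform `L[η]_jk(z) = ∫ exp(z u) η_jk(du)`. For finite `η` concentrated on
`[0, ∞)` the integrals converge absolutely whenever `Re z ≤ 0`, the only values of `z` used. -/
def laplace {n : ℕ} (η : MatrixMeasure n) (z : ℂ) : Matrix (Fin n) (Fin n) ℂ :=
  fun j k => sintegral (η j k) (fun u : ℝ => Complex.exp (z * (u : ℂ)))

/-- `h(z) = -z I_n - L[η](z)`. -/
def charFn {n : ℕ} (η : MatrixMeasure n) (z : ℂ) : Matrix (Fin n) (Fin n) ℂ :=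
  -(z • (1 : Matrix (Fin n) (Fin n) ℂ)) - laplace η z

/-- The Fourier transform on `L²` with the normalization `F[f](y) = ∫ exp(i y u) f(u) du`
(for `f ∈ L¹ ∩ L²`), obtained from Mathlib's `L²` transform, which extends
`w ↦ ∫ exp(-2 π i w u) f(u) du`, by taking `w = -y / (2 π)`. Defined up to null sets. -/
def fourierL2 (f : Lp ℂ 2 (volume : Measure ℝ)) (y : ℝ) : ℂ :=
  (FourierTransform.fourier f : Lp ℂ 2 (volume : Measure ℝ)) (-y / (2 * Real.pi))

/-- `g : ℝ → ℝ^{n × n}` belongs (entrywise) to `L²` and `F[g](y) = h(iy)⁻¹`, as an identity between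
`L²` functions of `y`. -/
def IsKernel {n : ℕ} (η : MatrixMeasure n) (g : ℝ → Matrix (Fin n) (Fin n) ℝ) : Prop :=
  ∃ hg : ∀ j k, MemLp (fun t : ℝ => ((g t j k : ℝ) : ℂ)) 2 (volume : Measure ℝ),
    ∀ᵐ y : ℝ, ∀ j k,
      fourierL2 ((hg j k).toLp) y = (charFn η (Complex.I * (y : ℂ)))⁻¹ j k

/-- `g ∗ η (t) = ∫ g(t - v) η(dv)` (matrix product, `g` on the left). -/
def conv {n : ℕ} (g : ℝ → Matrix (Fin n) (Fin n) ℝ) (η : MatrixMeasure n) (t : ℝ) :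
    Matrix (Fin n) (Fin n) ℝ :=
  fun j k => ∑ l, sintegral (η l k) (fun v => g (t - v) j l)

/-- The integrals defining `g ∗ η (t)` converge absolutely. -/
def ConvDefinedAt {n : ℕ} (g : ℝ → Matrix (Fin n) (Fin n) ℝ) (η : MatrixMeasure n) (t : ℝ) :
    Prop :=
  ∀ j l k, Integrable (fun v => g (t - v) j l) (η l k).totalVariation

variable {n : ℕ} {Ω : Type*}

/-- `g ∗ Z (t) = Z_t + ∫ g ∗ η (t - u) Z_u du`. -/
def convProcess (η : MatrixMeasure n) (g : ℝ → Matrix (Fin n) (Fin n) ℝ)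
    (Z : ℝ → Ω → Fin n → ℝ) (t : ℝ) (ω : Ω) : Fin n → ℝ :=
  fun j => Z t ω j + ∑ k, ∫ u : ℝ, conv g η (t - u) j k * Z u ω k

variable [MeasurableSpace Ω]

/-- A measurable process: `(t, ω) ↦ X_t(ω)` is jointly measurable. -/
def IsMeasurableProcess (X : ℝ → Ω → Fin n → ℝ) : Prop :=
  Measurable (Function.uncurry X)

/-- An integrable process: `E|X_t| < ∞` for every `t`. -/
def IsIntegrableProcess (X : ℝ → Ω → Fin n → ℝ) (P : Measure Ω) : Prop :=
  ∀ t, Integrable (X t) P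

/-- (Strict) stationarity: the finite-dimensional distributions are shift invariant. -/
def IsStationary (X : ℝ → Ω → Fin n → ℝ) (P : Measure Ω) : Prop :=
  ∀ (r : ℝ) (m : ℕ) (τ : Fin m → ℝ),
    IdentDistrib (fun ω (i : Fin m) => X (τ i + r) ω) (fun ω (i : Fin m) => X (τ i) ω) P P

/-- Stationary increments: for every `r`, the processes `(Z_{t+r} - Z_r)_t` and `(Z_t - Z_0)_t`
have the same finite-dimensional distributions. -/
def HasStationaryIncrements (Z : ℝ → Ω → Fin n → ℝ) (P : Measure Ω) : Prop :=
  ∀ (r : ℝ) (m : ℕ) (τ : Fin m → ℝ),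
    IdentDistrib (fun ω (i : Fin m) => Z (τ i + r) ω - Z r ω)
      (fun ω (i : Fin m) => Z (τ i) ω - Z 0 ω) P P

/-- `X` satisfies `dX_t = η ∗ X(t) dt + dZ_t`: for all `s < t`, almost surely the integrals
`∫_s^t ∫ X^k_{u-v} η_jk(dv) du` converge absolutely and
`X^j_t - X^j_s = ∑_k ∫_s^t ∫ X^k_{u-v} η_jk(dv) du + Z^j_t - Z^j_s`. -/
def SatisfiesMSDDE (η : MatrixMeasure n) (Z X : ℝ → Ω → Fin n → ℝ) (P : Measure Ω) : Prop :=
  ∀ s t : ℝ, s < t → ∀ᵐ ω ∂P, ∀ j,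
    (∀ k, Integrable (fun p : ℝ × ℝ => X (p.1 - p.2) ω k)
      ((volume.restrict (Set.Ioc s t)).prod (η j k).totalVariation)) ∧
    X t ω j - X s ω j =
      (∑ k, ∫ u in Set.Ioc s t, sintegral (η j k) (fun v => X (u - v) ω k))
        + (Z t ω j - Z s ω j)

/-- A stationary and integrable solution of `dX_t = η ∗ X(t) dt + dZ_t`. -/
structure IsStationarySolution (η : MatrixMeasure n) (Z X : ℝ → Ω → Fin n → ℝ)
    (P : Measure Ω) : Prop where
  measurable : IsMeasurableProcess X
  integrable : IsIntegrableProcess X P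
  stationary : IsStationary X P
  equation : SatisfiesMSDDE η Z X P

/-- The σ-algebra `σ(Z_t - Z_s : s < t)`. -/
abbrev incrementSigma (Z : ℝ → Ω → Fin n → ℝ) (t : ℝ) : MeasurableSpace Ω :=
  ⨆ s : Set.Iio t, MeasurableSpace.comap (fun ω => Z t ω - Z s ω) inferInstance

/-- Causality: every `X_t` is almost surely equal to a random variable that is measurable with
respect to `σ(Z_t - Z_s : s < t)`, that is, `X` is adapted to the filtration obtained from these
σ-algebras by adding the `P`-null sets. -/
def IsCausal (Z X : ℝ → Ω → Fin n → ℝ) (P : Measure Ω) : Prop :=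
  ∀ t, ∃ Y : Ω → Fin n → ℝ, Measurable[incrementSigma Z t] Y ∧ X t =ᵐ[P] Y

end

end MSDDE

open scoped FourierTransform SchwartzMap ENNReal

namespace MSDDE

/-! ### Fourier analysis on the line -/

/-! Write h for the characteristic function and L for the Laplace transform of η. On the imaginary
axis h(z)⁻¹ decays like 1/|z|, because the term -z dominates the bounded matrix L(z). Subtracting (1
- z)⁻¹ I, the transform of exp(-t) on the positive half line, leaves a remainder that is O(1/(1 +
|z|²)). The second moment of η gives two derivatives, and since the derivative of an inverse is
quadratic in the inverse, these are O(1/(1 + |z|²)) as well. By Plancherel the inverse transform q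
of the remainder satisfies q, t² q ∈ L², so (1 + |t|) q ∈ L¹ by Cauchy–Schwarz. Hence the kernel g
and A = g ∗ η have finite first moments (`fourierInv_decay`, `exists_deriv_regularizedInverse`,
`hasFirstMoment_kernel`).

The process Z matches this: t ↦ E|Z_t - Z_0| is measurable, even and subadditive, so it grows at
most linearly (`exists_linear_bound_of_subadditive`). All integrals of Z against A, also after a
further convolution with η, therefore converge absolutely almost surely by Tonelli.

The transform of A is h⁻¹L = Lh⁻¹ = -(1 + z h⁻¹). Comparing transforms gives the integrated
equations dg = A dt + δ₀ I (`kernel_sub_ae_eq`) and dA = η ∗ A dt + η(dt) (`kernelConv_sub_ae_eq`).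
Pairing the second with a path of Z shows that X = Z + A ∗ Z solves the equation.

For uniqueness, the difference D of two solutions satisfies dD = η ∗ D dt. Evaluating the increment
of g ∗ D over (s, t] once with the equation of g and once with that of D gives ∫_s^t D + ∫_s^t A ∗ D
= ∫_s^t A ∗ D. So D integrates to zero over every interval; the equation then makes D constant in
time, and the constant is zero (`SatisfiesHomogeneous.ae_eq_zero`).

For stationarity and causality, the transform of A at 0 is -I, so X_t = ∫ A(x)(Z_{t-x} - Z_t) dx
involves only increments. Paths are merely measurable, so the integral is approximated by Monte
Carlo sums. By the strong law and Fubini there is a deterministic sequence of nodes along which the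
sums converge almost surely (`ae_tendsto_average`). Each sum is a fixed function of finitely many
increments, and its law is shift invariant. If h is invertible on the closed left half plane,
shifting the contour shows that g, hence A, vanishes on the negative half line, so only past
increments occur. -/

theorem integral_fourier_mul_flip {f g : ℝ → ℂ} (hf : Integrable f) (hg : Integrable g) :
    ∫ w, 𝓕 f w * g w = ∫ x, f x * 𝓕 g x := by
  have := VectorFourier.integral_fourierIntegral_smul_eq_flip (μ := volume) (ν := volume)
    (e := Real.fourierChar) (L := innerₗ ℝ) (f := f) (g := g) Real.continuous_fourierChar
    (by exact continuous_inner) hf hg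
  rw [flip_innerₗ] at this
  simpa only [smul_eq_mul] using! this

theorem continuous_fourier_of_integrable {f : ℝ → ℂ} (hf : Integrable f) : Continuous (𝓕 f) :=
  VectorFourier.fourierIntegral_continuous Real.continuous_fourierChar
    (by exact continuous_inner) hf

/-- On `L¹ ∩ L²` the `L²` Fourier transform is given by the Fourier integral. -/
theorem fourier_toLp_ae_eq {f : ℝ → ℂ} (h1 : Integrable f) (h2 : MemLp f 2) :
    (𝓕 (h2.toLp f) : Lp ℂ 2 (volume : Measure ℝ)) =ᵐ[volume] 𝓕 f := by
  -- Both sides are locally integrable, so testing against compactly supported smooth functions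
  -- suffices. On those the L² transform is the distributional one, and the Fourier integral can be
  -- moved between the factors.
  refine ae_eq_of_integral_contDiff_smul_eq
    ((Lp.memLp _).locallyIntegrable (by norm_num))
    (continuous_fourier_of_integrable h1).locallyIntegrable fun g g_smooth g_cpt => ?_
  have hg₁ : HasCompactSupport (Complex.ofRealCLM ∘ g) := g_cpt.comp_left rfl
  have hg₂ : ContDiff ℝ (⊤ : ℕ∞) (Complex.ofRealCLM ∘ g) := by fun_prop
  let S : 𝓢(ℝ, ℂ) := hg₁.toSchwartzMap hg₂
  have e1 : ∫ x, g x • (𝓕 (h2.toLp f) : Lp ℂ 2 (volume : Measure ℝ)) x =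
      (Lp.toTemperedDistribution (𝓕 (h2.toLp f) : Lp ℂ 2 (volume : Measure ℝ))) S := by
    rw [Lp.toTemperedDistribution_apply]
    rfl
  rw [e1, ← Lp.fourier_toTemperedDistribution_eq, TemperedDistribution.fourier_apply,
    Lp.toTemperedDistribution_apply]
  have e2 : ∫ x, (𝓕 S) x • (h2.toLp f) x = ∫ x, 𝓕 (⇑S) x * f x := by
    refine integral_congr_ae ?_
    filter_upwards [h2.coeFn_toLp] with x hx
    rw [hx, smul_eq_mul, SchwartzMap.fourier_coe]
  rw [e2, integral_fourier_mul_flip S.integrable h1]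
  rfl

/-- Every test function is the Fourier transform of a Schwartz function, so its pairing with f
equals a pairing with the vanishing transform of f. -/
theorem ae_eq_zero_of_fourier_eq_zero {f : ℝ → ℂ} (hf : Integrable f) (h : ∀ w, 𝓕 f w = 0) :
    f =ᵐ[volume] 0 := by
  refine ae_eq_zero_of_integral_contDiff_smul_eq_zero hf.locallyIntegrable
    fun g g_smooth g_cpt => ?_
  have hg₁ : HasCompactSupport (Complex.ofRealCLM ∘ g) := g_cpt.comp_left rfl
  have hg₂ : ContDiff ℝ (⊤ : ℕ∞) (Complex.ofRealCLM ∘ g) := by fun_prop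
  let S : 𝓢(ℝ, ℂ) := hg₁.toSchwartzMap hg₂
  let T : 𝓢(ℝ, ℂ) := 𝓕⁻ S
  have hT : 𝓕 T = S := FourierTransform.fourier_fourierInv_eq S
  have hS : 𝓕 (⇑T) = ⇑S := by
    rw [← SchwartzMap.fourier_coe, hT]
  calc ∫ x, g x • f x = ∫ x, f x * S x := by
        refine integral_congr_ae (ae_of_all _ fun x => ?_)
        change ((g x : ℝ) : ℂ) * f x = f x * ((g x : ℝ) : ℂ)
        ring
    _ = ∫ x, f x * 𝓕 (⇑T) x := by rw [hS]
    _ = 0 := by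
        rw [← integral_fourier_mul_flip hf T.integrable]
        simp [h]

theorem ae_eq_of_fourier_eq {f g : ℝ → ℂ} (hf : Integrable f) (hg : Integrable g)
    (h : ∀ w, 𝓕 f w = 𝓕 g w) : f =ᵐ[volume] g := by
  have : f - g =ᵐ[volume] 0 := by
    refine ae_eq_zero_of_fourier_eq_zero (hf.sub hg) fun w => ?_
    have := h w
    rw [Real.fourier_eq, Real.fourier_eq] at this
    rw [Real.fourier_eq]
    simp only [Pi.sub_apply, smul_sub]
    rw [integral_sub, this, sub_self]
    · exact (Real.fourierIntegral_convergent_iff w).2 hf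
    · exact (Real.fourierIntegral_convergent_iff w).2 hg
  filter_upwards [this] with x hx
  simpa [sub_eq_zero] using hx

/-- Two real integrable functions with the same Fourier transform agree almost everywhere. -/
theorem ae_eq_of_fourier_ofReal_eq {f g : ℝ → ℝ} (hf : Integrable f) (hg : Integrable g)
    (h : ∀ w, 𝓕 (fun x => (f x : ℂ)) w = 𝓕 (fun x => (g x : ℂ)) w) : f =ᵐ[volume] g := by
  filter_upwards [ae_eq_of_fourier_eq hf.ofReal hg.ofReal h] with x hx
  exact_mod_cast hx

theorem memLp_fourierInv {f : ℝ → ℂ} (h1 : Integrable f) (h2 : MemLp f 2) :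
    MemLp (𝓕⁻ f) 2 := by
  have h : MemLp (𝓕 f) 2 := (memLp_congr_ae (fourier_toLp_ae_eq h1 h2)).1 (Lp.memLp _)
  have e : 𝓕⁻ f = (𝓕 f) ∘ Neg.neg := by
    ext x
    exact Real.fourierInv_eq_fourier_neg f x
  rw [e]
  exact h.comp_measurePreserving (Measure.measurePreserving_neg volume)

theorem integrable_of_le_one_add_sq {f : ℝ → ℂ} (hf : Continuous f ∨ Measurable f) {C : ℝ}
    (h : ∀ w, ‖f w‖ ≤ C / (1 + w ^ 2)) : Integrable f := by
  refine (integrable_inv_one_add_sq.const_mul C).mono' ?_ (ae_of_all _ fun w => ?_)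
  · rcases hf with hf | hf
    · exact hf.aestronglyMeasurable
    · exact hf.aestronglyMeasurable
  · simpa [div_eq_mul_inv] using h w

theorem memLp_two_of_le_one_add_sq {f : ℝ → ℂ} (hf : Measurable f) {C : ℝ}
    (h : ∀ w, ‖f w‖ ≤ C / (1 + w ^ 2)) : MemLp f 2 := by
  rw [memLp_two_iff_integrable_sq_norm hf.aestronglyMeasurable]
  refine (integrable_inv_one_add_sq.const_mul (C ^ 2)).mono'
    (hf.norm.pow_const 2).aestronglyMeasurable (ae_of_all _ fun w => ?_)
  have h1 : 0 ≤ C / (1 + w ^ 2) := (norm_nonneg _).trans (h w)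
  have h2 : (1 : ℝ) ≤ 1 + w ^ 2 := by nlinarith [sq_nonneg w]
  rw [Real.norm_of_nonneg (by positivity)]
  calc ‖f w‖ ^ 2 ≤ (C / (1 + w ^ 2)) ^ 2 := pow_le_pow_left₀ (norm_nonneg _) (h w) 2
    _ = C ^ 2 * ((1 + w ^ 2)⁻¹ * (1 + w ^ 2)⁻¹) := by field_simp
    _ ≤ C ^ 2 * ((1 + w ^ 2)⁻¹ * 1) := by
        gcongr
        exact inv_le_one_of_one_le₀ h2
    _ = _ := by ring

/-- Cauchy–Schwarz: (1 + |t|)|q| is the product of (1 + |t|)/(1 + t²) and |q + t² q|, both square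
integrable. -/
theorem integrable_one_add_abs_mul_of_memLp {q : ℝ → ℂ} (h0 : MemLp q 2)
    (h2 : MemLp (fun t : ℝ => (t : ℂ) ^ 2 * q t) 2) :
    Integrable (fun t : ℝ => (1 + |t|) * ‖q t‖) := by
  have hw : MemLp (fun t : ℝ => (1 + |t|) / (1 + t ^ 2)) 2 := by
    have hc : Continuous fun t : ℝ => (1 + |t|) / (1 + t ^ 2) :=
      Continuous.div (by fun_prop) (by fun_prop) fun t => by positivity
    rw [memLp_two_iff_integrable_sq hc.aestronglyMeasurable]
    refine (integrable_inv_one_add_sq.const_mul 2).mono'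
      (hc.pow 2).aestronglyMeasurable (ae_of_all _ fun w => ?_)
    rw [Real.norm_of_nonneg (by positivity), div_pow, div_le_iff₀ (by positivity)]
    have : 2 * (1 + w ^ 2)⁻¹ * (1 + w ^ 2) ^ 2 = 2 * (1 + w ^ 2) := by field_simp
    rw [this]
    nlinarith [sq_nonneg (1 - |w|), sq_abs w]
  have hs : MemLp (fun t : ℝ => ‖q t + (t : ℂ) ^ 2 * q t‖) 2 := (h0.add h2).norm
  have := hw.integrable_mul hs
  refine this.congr (ae_of_all _ fun t => ?_)
  have e : q t + (t : ℂ) ^ 2 * q t = ((1 + t ^ 2 : ℝ) : ℂ) * q t := by push_cast; ring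
  have hp : (0 : ℝ) < 1 + t ^ 2 := by positivity
  simp only [Pi.mul_apply]
  rw [e, norm_mul, Complex.norm_real, Real.norm_of_nonneg hp.le]
  field_simp

/-- Decay of the inverse Fourier transform of a twice differentiable function. -/
theorem fourierInv_decay {ψ ψ₁ ψ₂ : ℝ → ℂ} {C : ℝ} (hd : ∀ w, HasDerivAt ψ (ψ₁ w) w)
    (hd₁ : ∀ w, HasDerivAt ψ₁ (ψ₂ w) w) (hb : ∀ w, ‖ψ w‖ ≤ C / (1 + w ^ 2))
    (hb₁ : ∀ w, ‖ψ₁ w‖ ≤ C / (1 + w ^ 2)) (hb₂ : ∀ w, ‖ψ₂ w‖ ≤ C / (1 + w ^ 2)) :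
    MemLp (𝓕⁻ ψ) 2 ∧ Integrable (fun t : ℝ => (1 + |t|) * ‖𝓕⁻ ψ t‖) ∧ 𝓕 (𝓕⁻ ψ) = ψ := by
  have hc : Continuous ψ := continuous_iff_continuousAt.2 fun w => (hd w).continuousAt
  have hc₁ : Continuous ψ₁ := continuous_iff_continuousAt.2 fun w => (hd₁ w).continuousAt
  have e₁ : deriv ψ = ψ₁ := funext fun w => (hd w).deriv
  have e₂ : deriv ψ₁ = ψ₂ := funext fun w => (hd₁ w).deriv
  have hm₂ : Measurable ψ₂ := e₂ ▸ measurable_deriv ψ₁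
  have hi := integrable_of_le_one_add_sq (Or.inl hc) hb
  have hi₁ := integrable_of_le_one_add_sq (Or.inl hc₁) hb₁
  have hi₂ := integrable_of_le_one_add_sq (Or.inr hm₂) hb₂
  have h0 := memLp_fourierInv hi (memLp_two_of_le_one_add_sq hc.measurable hb)
  have h2 := memLp_fourierInv hi₂ (memLp_two_of_le_one_add_sq hm₂ hb₂)
  have f₁ := Real.fourier_deriv hi (fun w => (hd w).differentiableAt) (e₁ ▸ hi₁)
  have f₂ := Real.fourier_deriv hi₁ (fun w => (hd₁ w).differentiableAt) (e₂ ▸ hi₂)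
  rw [e₁] at f₁
  rw [e₂] at f₂
  have h2' : MemLp (fun t : ℝ => (t : ℂ) ^ 2 * 𝓕⁻ ψ t) 2 := by
    -- Two derivatives multiply the transform by the square of 2πi times the frequency, which here
    -- is -4π²t²; this is the origin of the constant.
    refine (memLp_congr_ae (ae_of_all _ fun t => ?_)).1
      (h2.const_mul (-(1 / (4 * (Real.pi : ℂ) ^ 2))))
    have hpi : (Real.pi : ℂ) ≠ 0 := by exact_mod_cast Real.pi_ne_zero
    rw [Real.fourierInv_eq_fourier_neg, Real.fourierInv_eq_fourier_neg, f₂, f₁]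
    simp only [smul_eq_mul]
    push_cast
    field_simp
    ring_nf
    rw [Complex.I_sq]
    ring
  have hint := integrable_one_add_abs_mul_of_memLp h0 h2'
  refine ⟨h0, hint, ?_⟩
  have hiq : Integrable (𝓕⁻ ψ) := by
    refine hint.mono' h0.aestronglyMeasurable (ae_of_all _ fun t => ?_)
    nlinarith [abs_nonneg t, norm_nonneg (𝓕⁻ ψ t), mul_nonneg (abs_nonneg t) (norm_nonneg (𝓕⁻ ψ t))]
  refine hc.fourier_fourierInv_eq hi ?_
  have e : 𝓕 ψ = (𝓕⁻ ψ) ∘ Neg.neg := by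
    ext x
    simp [Real.fourierInv_eq_fourier_neg]
  rw [e]
  exact hiq.comp_neg

end MSDDE
open scoped FourierTransform ENNReal

namespace MSDDE

/-! ### Integration against signed measures -/

section Sintegral

variable {E : Type*} [NormedAddCommGroup E] {μ : SignedMeasure ℝ}

theorem integrable_totalVariation_iff {f : ℝ → E} :
    Integrable f μ.totalVariation ↔ Integrable f μ.toJordanDecomposition.posPart ∧
      Integrable f μ.toJordanDecomposition.negPart :=
  integrable_add_measure

theorem integrable_prod_totalVariation_iff {α : Type*} [MeasurableSpace α]
    {κ : Measure α} [SFinite κ] {F : α × ℝ → E} :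
    Integrable F (κ.prod μ.totalVariation) ↔
      Integrable F (κ.prod μ.toJordanDecomposition.posPart) ∧
      Integrable F (κ.prod μ.toJordanDecomposition.negPart) := by
  rw [SignedMeasure.totalVariation, Measure.prod_add, integrable_add_measure]

variable [NormedSpace ℝ E]

theorem sintegral_congr_ae {f g : ℝ → E} (h : f =ᵐ[μ.totalVariation] g) :
    sintegral μ f = sintegral μ g := by
  have h' := ae_add_measure_iff.1 h
  rw [sintegral, sintegral, integral_congr_ae h'.1, integral_congr_ae h'.2]

theorem sintegral_add {f g : ℝ → E} (hf : Integrable f μ.totalVariation)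
    (hg : Integrable g μ.totalVariation) :
    sintegral μ (fun v => f v + g v) = sintegral μ f + sintegral μ g := by
  rw [integrable_totalVariation_iff] at hf hg
  rw [sintegral, integral_add hf.1 hg.1, integral_add hf.2 hg.2, sintegral, sintegral]
  abel

theorem sintegral_sub {f g : ℝ → E} (hf : Integrable f μ.totalVariation)
    (hg : Integrable g μ.totalVariation) :
    sintegral μ (fun v => f v - g v) = sintegral μ f - sintegral μ g := by
  rw [integrable_totalVariation_iff] at hf hg
  rw [sintegral, integral_sub hf.1 hg.1, integral_sub hf.2 hg.2, sintegral, sintegral]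
  abel

theorem sintegral_zero : sintegral μ (fun _ => (0 : E)) = 0 := by
  simp [sintegral]

theorem sintegral_finset_sum {ι : Type*} (s : Finset ι) {f : ι → ℝ → E}
    (hf : ∀ i ∈ s, Integrable (f i) μ.totalVariation) :
    sintegral μ (fun v => ∑ i ∈ s, f i v) = ∑ i ∈ s, sintegral μ (f i) := by
  rw [sintegral, integral_finsetSum _ fun i hi => (integrable_totalVariation_iff.1 (hf i hi)).1,
    integral_finsetSum _ fun i hi => (integrable_totalVariation_iff.1 (hf i hi)).2,
    ← Finset.sum_sub_distrib]
  rfl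

theorem sintegral_const_mul {𝕜 : Type*} [RCLike 𝕜] (c : 𝕜) (f : ℝ → 𝕜) :
    sintegral μ (fun v => c * f v) = c * sintegral μ f := by
  rw [sintegral, integral_const_mul, integral_const_mul, sintegral, mul_sub]

theorem sintegral_ofReal (f : ℝ → ℝ) :
    ((sintegral μ f : ℝ) : ℂ) = sintegral μ (fun v => (f v : ℂ)) := by
  rw [sintegral, sintegral, Complex.ofReal_sub, integral_complex_ofReal, integral_complex_ofReal]

theorem norm_sintegral_le {f : ℝ → E} (hf : Integrable f μ.totalVariation) :
    ‖sintegral μ f‖ ≤ ∫ v, ‖f v‖ ∂μ.totalVariation := by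
  have hf' := integrable_totalVariation_iff.1 hf.norm
  rw [SignedMeasure.totalVariation, integral_add_measure hf'.1 hf'.2]
  exact (norm_sub_le _ _).trans
    (add_le_add (norm_integral_le_integral_norm _) (norm_integral_le_integral_norm _))

variable {α : Type*} [MeasurableSpace α] {κ : Measure α} [SFinite κ]

theorem integrable_sintegral {F : α → ℝ → E}
    (hF : Integrable (Function.uncurry F) (κ.prod μ.totalVariation)) :
    Integrable (fun a => sintegral μ (F a)) κ := by
  have h := integrable_prod_totalVariation_iff.1 hF
  exact h.1.integral_prod_left.sub h.2.integral_prod_left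

theorem integral_sintegral_swap {F : α → ℝ → E}
    (hF : Integrable (Function.uncurry F) (κ.prod μ.totalVariation)) :
    ∫ a, sintegral μ (F a) ∂κ = sintegral μ (fun v => ∫ a, F a v ∂κ) := by
  have h := integrable_prod_totalVariation_iff.1 hF
  rw [sintegral, ← integral_integral_swap h.1, ← integral_integral_swap h.2]
  exact integral_sub h.1.integral_prod_left h.2.integral_prod_left

theorem stronglyMeasurable_sintegral {F : α → ℝ → E}
    (hF : StronglyMeasurable (Function.uncurry F)) :
    StronglyMeasurable fun a => sintegral μ (F a) :=
  hF.integral_prod_right.sub hF.integral_prod_right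

end Sintegral

/-! ### Convolution of functions with signed measures -/

/-- The convolution `∫ f(x - v) μ(dv)`. -/
noncomputable def sconv {E : Type*} [NormedAddCommGroup E] [NormedSpace ℝ E]
    (μ : SignedMeasure ℝ) (f : ℝ → E) (x : ℝ) : E :=
  sintegral μ fun v => f (x - v)

/-- For fixed v the first coordinate is only translated. The skew product has its base in the first
coordinate, hence the two swaps. Absolute convergence of convolutions with measures rests on this.
-/
theorem measurePreserving_shear (m : Measure ℝ) [SFinite m] :
    MeasurePreserving (fun p : ℝ × ℝ => (p.1 - p.2, p.2)) (volume.prod m) (volume.prod m) := by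
  have h : MeasurePreserving (fun p : ℝ × ℝ => (p.1, p.2 - p.1)) (m.prod volume)
      (m.prod volume) :=
    (MeasurePreserving.id m).skew_product (g := fun v x => x - v) (by fun_prop)
      (ae_of_all _ fun v => (measurePreserving_sub_right volume v).map_eq)
  exact (Measure.measurePreserving_swap.comp h).comp Measure.measurePreserving_swap

theorem integrable_comp_sub_prod {E : Type*} [NormedAddCommGroup E] {f : ℝ → E}
    (hf : Integrable f) (m : Measure ℝ) [IsFiniteMeasure m] :
    Integrable (fun p : ℝ × ℝ => f (p.1 - p.2)) (volume.prod m) :=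
  (measurePreserving_shear m).integrable_comp_of_integrable (hf.comp_fst m)

theorem integrable_sconv {E : Type*} [NormedAddCommGroup E] [NormedSpace ℝ E]
    {f : ℝ → E} (hf : Integrable f) (μ : SignedMeasure ℝ) : Integrable (sconv μ f) :=
  integrable_sintegral (F := fun x v => f (x - v)) (integrable_comp_sub_prod hf _)

theorem measurable_sconv {f : ℝ → ℝ} (hf : Measurable f) (μ : SignedMeasure ℝ) :
    Measurable (sconv μ f) :=
  (stronglyMeasurable_sintegral (F := fun x v => f (x - v))
    (hf.comp (measurable_fst.sub measurable_snd)).stronglyMeasurable).measurable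

theorem sconv_ofReal (μ : SignedMeasure ℝ) (f : ℝ → ℝ) (x : ℝ) :
    ((sconv μ f x : ℝ) : ℂ) = sconv μ (fun y => (f y : ℂ)) x :=
  sintegral_ofReal _

theorem ae_integrable_comp_sub {f : ℝ → ℝ} (hf : Integrable f) (m : Measure ℝ)
    [IsFiniteMeasure m] : ∀ᵐ x : ℝ, Integrable (fun v => f (x - v)) m :=
  (integrable_comp_sub_prod hf m).prod_right_ae

/-- For a single x the translated exceptional set may carry μ-mass, as μ can be singular. The shear
invariance shows that this happens only for a null set of x. -/
theorem sconv_congr_ae {f g : ℝ → ℝ} (h : f =ᵐ[volume] g) (μ : SignedMeasure ℝ) :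
    sconv μ f =ᵐ[volume] sconv μ g := by
  have h1 : ∀ᵐ p : ℝ × ℝ ∂(volume.prod μ.totalVariation), f (p.1 - p.2) = g (p.1 - p.2) :=
    (Measure.quasiMeasurePreserving_fst.comp
      (measurePreserving_shear μ.totalVariation).quasiMeasurePreserving).ae h
  filter_upwards [Measure.ae_ae_of_ae_prod h1] with x hx
  exact sintegral_congr_ae hx

/-- Measurable functions that are integrable together with their first moment. -/
structure HasFirstMoment (f : ℝ → ℝ) : Prop where
  measurable : Measurable f
  integrable_weight : Integrable fun x => (1 + |x|) * f x

theorem HasFirstMoment.integrable {f : ℝ → ℝ} (hf : HasFirstMoment f) : Integrable f := by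
  refine hf.integrable_weight.mono hf.measurable.aestronglyMeasurable (ae_of_all _ fun x => ?_)
  rw [norm_mul]
  refine le_mul_of_one_le_left (norm_nonneg _) ?_
  rw [Real.norm_of_nonneg (by positivity)]
  linarith [abs_nonneg x]

/-- Submultiplicativity of the weight 1 + |x| is the reason why finite first moments and linear
growth survive convolution. -/
theorem one_add_abs_le_mul (x y : ℝ) : 1 + |x + y| ≤ (1 + |x|) * (1 + |y|) := by
  nlinarith [abs_add_le x y, abs_nonneg x, abs_nonneg y, mul_nonneg (abs_nonneg x) (abs_nonneg y)]

theorem HasFirstMoment.integrable_prod {f : ℝ → ℝ} (hf : HasFirstMoment f) {m : Measure ℝ}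
    [IsFiniteMeasure m] (hm : Integrable (fun v => |v|) m) :
    Integrable (fun p : ℝ × ℝ => (1 + |p.1|) * f (p.1 - p.2)) (volume.prod m) := by
  have hm' : Integrable (fun v => 1 + |v|) m := (integrable_const 1).add hm
  have h := (measurePreserving_shear m).integrable_comp_of_integrable
    (hf.integrable_weight.mul_prod hm')
  have hmf := hf.measurable
  refine h.mono (by fun_prop) (ae_of_all _ fun p => ?_)
  have := one_add_abs_le_mul (p.1 - p.2) p.2
  rw [sub_add_cancel] at this
  simp only [Function.comp_apply, norm_mul]
  rw [Real.norm_of_nonneg (by positivity : 0 ≤ 1 + |p.1|),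
    Real.norm_of_nonneg (by positivity : 0 ≤ 1 + |p.1 - p.2|),
    Real.norm_of_nonneg (by positivity : 0 ≤ 1 + |p.2|)]
  calc _ ≤ (1 + |p.1 - p.2|) * (1 + |p.2|) * ‖f (p.1 - p.2)‖ := by gcongr
    _ = _ := by ring

theorem HasFirstMoment.sconv {f : ℝ → ℝ} (hf : HasFirstMoment f) {μ : SignedMeasure ℝ}
    (hμ : Integrable (fun v => |v|) μ.totalVariation) : HasFirstMoment (sconv μ f) := by
  refine ⟨measurable_sconv hf.measurable μ, ?_⟩
  have := integrable_sintegral (F := fun x v => (1 + |x|) * f (x - v)) (hf.integrable_prod hμ)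
  simpa only [sintegral_const_mul] using! this

theorem HasFirstMoment.zero : HasFirstMoment fun _ => 0 :=
  ⟨measurable_const, by simp⟩

theorem HasFirstMoment.add {f g : ℝ → ℝ} (hf : HasFirstMoment f) (hg : HasFirstMoment g) :
    HasFirstMoment fun x => f x + g x :=
  ⟨hf.measurable.add hg.measurable, by
    simpa only [mul_add] using! hf.integrable_weight.add hg.integrable_weight⟩

theorem HasFirstMoment.finset_sum {ι : Type*} {s : Finset ι} {f : ι → ℝ → ℝ}
    (hf : ∀ i ∈ s, HasFirstMoment (f i)) : HasFirstMoment fun x => ∑ i ∈ s, f i x := by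
  classical
  induction s using Finset.induction_on with
  | empty => simpa using HasFirstMoment.zero
  | insert a s ha ih =>
    simp only [Finset.sum_insert ha]
    exact (hf a (by simp)).add (ih fun i hi => hf i (by simp [hi]))

/-! ### Fourier transforms of convolutions -/

/-- Puts the transform into the form of a Laplace integral at z = -2πiw, the point of the imaginary
axis at which h is evaluated throughout. -/
theorem fourier_eq_integral_cexp (f : ℝ → ℂ) (w : ℝ) :
    𝓕 f w = ∫ x : ℝ, Complex.exp (Complex.I * ((-2 * Real.pi * w : ℝ) : ℂ) * x) * f x := by
  rw [Real.fourier_real_eq_integral_exp_smul]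
  refine integral_congr_ae (ae_of_all _ fun x => ?_)
  simp only [smul_eq_mul]
  push_cast
  ring_nf

theorem norm_cexp_I_mul (a x : ℝ) : ‖Complex.exp (Complex.I * (a : ℂ) * x)‖ = 1 := by
  rw [show Complex.I * (a : ℂ) * x = ((a * x : ℝ) : ℂ) * Complex.I by push_cast; ring]
  exact Complex.norm_exp_ofReal_mul_I _

theorem integrable_cexp_mul {f : ℝ → ℂ} (hf : Integrable f) (a : ℝ) :
    Integrable fun x : ℝ => Complex.exp (Complex.I * (a : ℂ) * x) * f x := by
  refine hf.bdd_mul (c := 1) (by fun_prop) (ae_of_all _ fun x => ?_)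
  rw [norm_cexp_I_mul]

theorem fourier_comp_add (f : ℝ → ℂ) (s w : ℝ) :
    𝓕 (fun x => f (s + x)) w =
      Complex.exp (-(Complex.I * ((-2 * Real.pi * w : ℝ) : ℂ) * s)) * 𝓕 f w := by
  rw [fourier_eq_integral_cexp, fourier_eq_integral_cexp, ← integral_const_mul,
    ← integral_add_left_eq_self (fun x : ℝ => _ * (_ * f x)) s]
  refine integral_congr_ae (ae_of_all _ fun x => ?_)
  simp only
  rw [← mul_assoc, ← Complex.exp_add]
  congr 2
  push_cast
  ring

theorem fourier_comp_sub (f : ℝ → ℂ) (v w : ℝ) :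
    𝓕 (fun x => f (x - v)) w =
      Complex.exp (Complex.I * ((-2 * Real.pi * w : ℝ) : ℂ) * v) * 𝓕 f w := by
  have := fourier_comp_add f (-v) w
  simp only [neg_add_eq_sub] at this
  rw [this]
  congr 2
  push_cast
  ring

theorem fourier_sconv {f : ℝ → ℂ} (hf : Integrable f) (μ : SignedMeasure ℝ) (w : ℝ) :
    𝓕 (sconv μ f) w = 𝓕 f w *
      sintegral μ fun v => Complex.exp (Complex.I * ((-2 * Real.pi * w : ℝ) : ℂ) * v) := by
  set a : ℝ := -2 * Real.pi * w with ha
  have hi : Integrable (Function.uncurry fun x v : ℝ =>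
      Complex.exp (Complex.I * (a : ℂ) * x) * f (x - v)) (volume.prod μ.totalVariation) := by
    refine (integrable_comp_sub_prod hf μ.totalVariation).bdd_mul (c := 1)
      (f := fun p : ℝ × ℝ => Complex.exp (Complex.I * (a : ℂ) * p.1)) (by fun_prop)
      (ae_of_all _ fun p => ?_)
    rw [norm_cexp_I_mul]
  rw [fourier_eq_integral_cexp]
  simp only [sconv, ← sintegral_const_mul]
  rw [← ha, integral_sintegral_swap hi]
  congr 1
  ext v
  have := fourier_comp_sub f v w
  rw [fourier_eq_integral_cexp, ← ha] at this
  rw [this, mul_comm]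

theorem integrable_setIntegral_comp_add {f : ℝ → ℂ} (hf : Integrable f) (s t : ℝ) :
    Integrable (Function.uncurry fun x u : ℝ => f (u + x))
      (volume.prod (volume.restrict (Set.Ioc s t))) := by
  have h : MeasurePreserving (fun p : ℝ × ℝ => (p.1, p.1 + p.2))
      ((volume.restrict (Set.Ioc s t)).prod volume)
      ((volume.restrict (Set.Ioc s t)).prod volume) :=
    (MeasurePreserving.id _).skew_product (g := fun v x => v + x) (by fun_prop)
      (ae_of_all _ fun v => (measurePreserving_add_left volume v).map_eq)
  exact ((h.comp Measure.measurePreserving_swap).integrable_comp_of_integrable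
    (hf.comp_snd (volume.restrict (Set.Ioc s t))))

theorem fourier_setIntegral_comp_add {f : ℝ → ℂ} (hf : Integrable f) (s t w : ℝ) :
    𝓕 (fun x => ∫ u in Set.Ioc s t, f (u + x)) w =
      (∫ u in Set.Ioc s t, Complex.exp (-(Complex.I * ((-2 * Real.pi * w : ℝ) : ℂ) * u))) *
        𝓕 f w := by
  set a : ℝ := -2 * Real.pi * w with ha
  have hi : Integrable (Function.uncurry fun x u : ℝ =>
      Complex.exp (Complex.I * (a : ℂ) * x) * f (u + x))
      (volume.prod (volume.restrict (Set.Ioc s t))) := by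
    refine (integrable_setIntegral_comp_add hf s t).bdd_mul (c := 1)
      (f := fun p : ℝ × ℝ => Complex.exp (Complex.I * (a : ℂ) * p.1)) (by fun_prop)
      (ae_of_all _ fun p => ?_)
    rw [norm_cexp_I_mul]
  rw [fourier_eq_integral_cexp]
  simp only [← integral_const_mul, ← integral_mul_const]
  rw [← ha, integral_integral_swap hi]
  congr 1
  ext u
  have := fourier_comp_add f u w
  rw [fourier_eq_integral_cexp, ← ha] at this
  rw [this]

theorem fourier_indicator_neg (s t w : ℝ) :
    𝓕 (fun x => (((Set.Ioc s t).indicator (fun _ => (1 : ℝ)) (-x) : ℝ) : ℂ)) w =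
      ∫ u in Set.Ioc s t, Complex.exp (-(Complex.I * ((-2 * Real.pi * w : ℝ) : ℂ) * u)) := by
  rw [fourier_eq_integral_cexp, ← integral_neg_eq_self, ← integral_indicator measurableSet_Ioc]
  refine integral_congr_ae (ae_of_all _ fun x => ?_)
  by_cases hx : x ∈ Set.Ioc s t <;> simp [hx]

/-- The fundamental theorem of calculus on the transform side: for c = z, the right side is the
multiplier of f ↦ f(s + ·) - f(t + ·), and the integral is the multiplier of integration over shifts
in (s, t]. -/
theorem mul_setIntegral_cexp {s t : ℝ} (hst : s ≤ t) (c : ℂ) :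
    c * ∫ u in Set.Ioc s t, Complex.exp (-(c * u)) =
      Complex.exp (-(c * s)) - Complex.exp (-(c * t)) := by
  rw [← intervalIntegral.integral_of_le hst]
  have h : ∀ x ∈ Set.uIcc s t,
      HasDerivAt (fun u : ℝ => Complex.exp (-(c * u))) (-c * Complex.exp (-(c * x))) x := by
    intro x _
    have h1 : HasDerivAt (fun u : ℝ => -(c * (u : ℂ))) (-c) x := by
      simpa using! ((Complex.ofRealCLM.hasDerivAt (x := x)).const_mul c).neg
    simpa [mul_comm] using h1.cexp
  have := intervalIntegral.integral_eq_sub_of_hasDerivAt h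
    (Continuous.intervalIntegrable (by fun_prop) _ _)
  rw [intervalIntegral.integral_const_mul] at this
  linear_combination -this

end MSDDE
open scoped FourierTransform ENNReal

namespace MSDDE

/-! ### Two derivatives of the inverse of a differentiable curve -/

/-- If the inverse of a curve with two bounded derivatives is `O(1 / (1 + |w|))`, then the first two
derivatives of the inverse are `O(1 / (1 + w ^ 2))`. -/
theorem exists_deriv_of_inverse {R : Type*} [NormedRing R] [NormedAlgebra ℝ R] [CompleteSpace R]
    {H H₁ H₂ G : ℝ → R} {C K : ℝ} (hHG : ∀ w, H w * G w = 1) (hGH : ∀ w, G w * H w = 1)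
    (hH : ∀ w, HasDerivAt H (H₁ w) w) (hH₁ : ∀ w, HasDerivAt H₁ (H₂ w) w)
    (hG : ∀ w, ‖G w‖ ≤ C / (1 + |w|)) (hK₁ : ∀ w, ‖H₁ w‖ ≤ K) (hK₂ : ∀ w, ‖H₂ w‖ ≤ K) :
    ∃ (G₁ G₂ : ℝ → R) (C' : ℝ), (∀ w, HasDerivAt G (G₁ w) w) ∧ (∀ w, HasDerivAt G₁ (G₂ w) w) ∧
      (∀ w, ‖G₁ w‖ ≤ C' / (1 + w ^ 2)) ∧ ∀ w, ‖G₂ w‖ ≤ C' / (1 + w ^ 2) := by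
  -- Packaging H w as a unit makes G w the value of `Ring.inverse`, whose derivative is known: G' =
  -- -G H₁ G.
  let u : ℝ → Rˣ := fun w => ⟨H w, G w, hHG w, hGH w⟩
  have hinv : ∀ w, Ring.inverse (H w) = G w := fun w => Ring.inverse_unit (u w)
  have hC : 0 ≤ C := by simpa using (norm_nonneg _).trans (hG 0)
  have hK : 0 ≤ K := (norm_nonneg _).trans (hK₁ 0)
  have hd : ∀ w, HasDerivAt G (-(G w * H₁ w * G w)) w := by
    intro w
    have h := (hasFDerivAt_ringInverse (𝕜 := ℝ) (u w)).comp_hasDerivAt w (hH w)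
    refine (h.congr_deriv ?_).congr_of_eventuallyEq (Filter.Eventually.of_forall fun w => ?_)
    · simp [u]
    · exact (hinv w).symm
  have hd₁ : ∀ w, HasDerivAt (fun w => -(G w * H₁ w * G w))
      (-((-(G w * H₁ w * G w) * H₁ w + G w * H₂ w) * G w + G w * H₁ w * -(G w * H₁ w * G w))) w :=
    fun w => (((hd w).mul (hH₁ w)).mul (hd w)).neg
  have hsq : ∀ w, ‖G w‖ * ‖G w‖ ≤ C ^ 2 / (1 + w ^ 2) := by
    intro w
    calc ‖G w‖ * ‖G w‖ ≤ (C / (1 + |w|)) * (C / (1 + |w|)) :=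
          mul_le_mul (hG w) (hG w) (norm_nonneg _) (by positivity)
      _ = C ^ 2 / (1 + |w|) ^ 2 := by field_simp
      _ ≤ C ^ 2 / (1 + w ^ 2) := by
          gcongr
          nlinarith [abs_nonneg w, sq_abs w]
  have hle : ∀ w, ‖G w‖ ≤ C := fun w =>
    (hG w).trans (div_le_self hC (by linarith [abs_nonneg w]))
  have hb₁ : ∀ w, ‖G w * H₁ w * G w‖ ≤ K * (C ^ 2 / (1 + w ^ 2)) := by
    intro w
    calc ‖G w * H₁ w * G w‖ ≤ ‖G w‖ * ‖H₁ w‖ * ‖G w‖ := norm_mul₃_le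
      _ = ‖H₁ w‖ * (‖G w‖ * ‖G w‖) := by ring
      _ ≤ _ := mul_le_mul (hK₁ w) (hsq w) (by positivity) hK
  -- The second derivative consists of G H₂ G and two copies of G H₁ G H₁ G. Two factors G supply
  -- C²/(1 + w²), and a third one is bounded by C.
  refine ⟨_, _, K * C ^ 2 + 2 * (K ^ 2 * C ^ 3), hd, hd₁, fun w => ?_, fun w => ?_⟩
  · rw [norm_neg]
    refine (hb₁ w).trans ?_
    rw [← mul_div_assoc]
    gcongr
    linarith [(by positivity : 0 ≤ K ^ 2 * C ^ 3)]
  · rw [norm_neg]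
    have h1 : ‖-(G w * H₁ w * G w) * H₁ w * G w‖ ≤ K * (C ^ 2 / (1 + w ^ 2)) * K * C := by
      refine norm_mul₃_le.trans ?_
      rw [norm_neg]
      have := hb₁ w
      have := hK₁ w
      have := hle w
      gcongr
    have h2 : ‖G w * H₁ w * -(G w * H₁ w * G w)‖ ≤ C * K * (K * (C ^ 2 / (1 + w ^ 2))) := by
      refine norm_mul₃_le.trans ?_
      rw [norm_neg]
      have := hb₁ w
      have := hK₁ w
      have := hle w
      gcongr
    have h3 : ‖G w * H₂ w * G w‖ ≤ K * (C ^ 2 / (1 + w ^ 2)) := by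
      calc ‖G w * H₂ w * G w‖ ≤ ‖G w‖ * ‖H₂ w‖ * ‖G w‖ := norm_mul₃_le
        _ = ‖H₂ w‖ * (‖G w‖ * ‖G w‖) := by ring
        _ ≤ _ := mul_le_mul (hK₂ w) (hsq w) (by positivity) hK
    rw [add_mul]
    calc _ ≤ _ := (norm_add_le _ _).trans (add_le_add_left (norm_add_le _ _) _)
      _ ≤ K * (C ^ 2 / (1 + w ^ 2)) * K * C + K * (C ^ 2 / (1 + w ^ 2)) +
          C * K * (K * (C ^ 2 / (1 + w ^ 2))) := add_le_add (add_le_add h1 h3) h2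
      _ = _ := by ring

/-! ### Regularity of Fourier–Stieltjes transforms -/

/-- As c is purely imaginary, the exponential has modulus one and the differentiated integrand is
dominated by ‖c‖^(k+1) |v|^(k+1), uniformly in w. -/
theorem hasDerivAt_integral_pow_mul_cexp {m : Measure ℝ} [IsFiniteMeasure m] (c : ℂ)
    (hc : c.re = 0) (k : ℕ) (hk : Integrable (fun v => |v| ^ k) m)
    (hk' : Integrable (fun v => |v| ^ (k + 1)) m) (w : ℝ) :
    HasDerivAt (fun w : ℝ => ∫ v : ℝ, (c * v) ^ k * Complex.exp (c * w * v) ∂m)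
      (∫ v : ℝ, (c * v) ^ (k + 1) * Complex.exp (c * w * v) ∂m) w := by
  have hn : ∀ w v : ℝ, ‖Complex.exp (c * w * v)‖ = 1 := by
    intro w v
    rw [Complex.norm_exp]
    simp [hc]
  refine (hasDerivAt_integral_of_dominated_loc_of_deriv_le (s := Set.univ)
    (F := fun (w : ℝ) (v : ℝ) => (c * v) ^ k * Complex.exp (c * w * v))
    (F' := fun (w : ℝ) (v : ℝ) => (c * v) ^ (k + 1) * Complex.exp (c * w * v))
    (bound := fun v => ‖c‖ ^ (k + 1) * |v| ^ (k + 1)) Filter.univ_mem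
    (Filter.Eventually.of_forall fun w => Continuous.aestronglyMeasurable (by fun_prop)) ?_
    (Continuous.aestronglyMeasurable (by fun_prop)) (ae_of_all _ fun v w _ => ?_)
    (hk'.const_mul _) (ae_of_all _ fun v w _ => ?_)).2
  · refine (hk.const_mul (‖c‖ ^ k)).mono (Continuous.aestronglyMeasurable (by fun_prop))
      (ae_of_all _ fun v => ?_)
    rw [norm_mul, hn]
    simp [mul_pow]
  · rw [norm_mul, hn]
    simp [mul_pow]
  · have h1 : HasDerivAt (fun w : ℝ => c * (w : ℂ) * (v : ℂ)) (c * v) w := by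
      simpa using! ((Complex.ofRealCLM.hasDerivAt (x := w)).const_mul c).mul_const (v : ℂ)
    convert! h1.cexp.const_mul ((c * v) ^ k) using 1
    ring

theorem hasDerivAt_sintegral_pow_mul_cexp {μ : SignedMeasure ℝ} (c : ℂ)
    (hc : c.re = 0) (k : ℕ) (hk : Integrable (fun v => |v| ^ k) μ.totalVariation)
    (hk' : Integrable (fun v => |v| ^ (k + 1)) μ.totalVariation) (w : ℝ) :
    HasDerivAt (fun w : ℝ => sintegral μ fun v : ℝ => (c * v) ^ k * Complex.exp (c * w * v))
      (sintegral μ fun v : ℝ => (c * v) ^ (k + 1) * Complex.exp (c * w * v)) w := by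
  rw [integrable_totalVariation_iff] at hk hk'
  exact (hasDerivAt_integral_pow_mul_cexp c hc k hk.1 hk'.1 w).sub
    (hasDerivAt_integral_pow_mul_cexp c hc k hk.2 hk'.2 w)

theorem norm_sintegral_pow_mul_cexp_le {μ : SignedMeasure ℝ} (c : ℂ)
    (hc : c.re = 0) (k : ℕ) (hk : Integrable (fun v => |v| ^ k) μ.totalVariation) (w : ℝ) :
    ‖sintegral μ fun v : ℝ => (c * v) ^ k * Complex.exp (c * w * v)‖ ≤
      ∫ v, ‖c‖ ^ k * |v| ^ k ∂μ.totalVariation := by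
  have hn : ∀ v : ℝ, ‖(c * v) ^ k * Complex.exp (c * w * v)‖ = ‖c‖ ^ k * |v| ^ k := by
    intro v
    rw [norm_mul, Complex.norm_exp]
    simp [hc, mul_pow]
  refine (norm_sintegral_le ?_).trans (le_of_eq (by simp only [hn]))
  refine (hk.const_mul (‖c‖ ^ k)).mono (Continuous.aestronglyMeasurable (by fun_prop))
    (ae_of_all _ fun v => ?_)
  rw [hn]
  exact le_abs_self _

theorem HasMoment.of_two {n : ℕ} {η : MatrixMeasure n} (h : HasMoment η 2) {p : ℕ} (hp : p ≤ 2) :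
    HasMoment η p := by
  intro j k
  refine ((integrable_const 1).add (h j k)).mono
    (Continuous.aestronglyMeasurable (by fun_prop)) (ae_of_all _ fun v => ?_)
  simp only [Pi.add_apply]
  rw [Real.norm_of_nonneg (by positivity), Real.norm_of_nonneg (by positivity)]
  interval_cases p
  · simpa using sq_nonneg v
  · nlinarith [abs_nonneg v, sq_nonneg (|v| - 1)]
  · linarith

theorem HasMoment.integrable_abs {n : ℕ} {η : MatrixMeasure n} (h : HasMoment η 2) (j k : Fin n) :
    Integrable (fun v => |v|) (η j k).totalVariation := by
  simpa using h.of_two (p := 1) (by norm_num) j k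

/-! ### The characteristic function -/

section CharFn

attribute [local instance] Matrix.linftyOpNormedAddCommGroup Matrix.linftyOpNormedSpace
  Matrix.linftyOpNormedRing Matrix.linftyOpNormedAlgebra

variable {n : ℕ} {η : MatrixMeasure n}

theorem norm_entry_le (A : Matrix (Fin n) (Fin n) ℂ) (j k : Fin n) : ‖A j k‖ ≤ ‖A‖ := by
  have h1 : ‖A j k‖₊ ≤ ∑ l, ‖A j l‖₊ :=
    Finset.single_le_sum (f := fun l => ‖A j l‖₊) (fun _ _ => zero_le) (Finset.mem_univ k)
  have h2 : ∑ l, ‖A j l‖₊ ≤ Finset.univ.sup fun i => ∑ l, ‖A i l‖₊ :=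
    Finset.le_sup (f := fun i => ∑ l, ‖A i l‖₊) (Finset.mem_univ j)
  rw [Matrix.linfty_opNorm_def]
  exact_mod_cast h1.trans h2

theorem norm_le_of_entry_le {A : Matrix (Fin n) (Fin n) ℂ} {c : ℝ} (hc : 0 ≤ c)
    (h : ∀ j k, ‖A j k‖ ≤ c) : ‖A‖ ≤ n * c := by
  lift c to NNReal using hc
  rw [Matrix.linfty_opNorm_def]
  have : (Finset.univ.sup fun i => ∑ l, ‖A i l‖₊) ≤ n * c := by
    refine Finset.sup_le fun i _ => ?_
    calc ∑ l, ‖A i l‖₊ ≤ ∑ _l : Fin n, c := Finset.sum_le_sum fun l _ => by exact_mod_cast h i l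
      _ = n * c := by simp
  exact_mod_cast this

theorem ConcentratedOnNonneg.ae_nonneg (hη : ConcentratedOnNonneg η) (j k : Fin n) :
    ∀ᵐ v ∂(η j k).totalVariation, 0 ≤ v := by
  rw [ae_iff]
  convert! hη j k using 2
  ext v
  simp

theorem norm_cexp_mul_le {z : ℂ} (hz : z.re ≤ 0) {v : ℝ} (hv : 0 ≤ v) :
    ‖Complex.exp (z * v)‖ ≤ 1 := by
  rw [Complex.norm_exp, Real.exp_le_one_iff]
  simpa using mul_nonpos_of_nonpos_of_nonneg hz hv

theorem ConcentratedOnNonneg.exists_norm_laplace_le (hη : ConcentratedOnNonneg η) :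
    ∃ M : ℝ, 0 ≤ M ∧ ∀ z : ℂ, z.re ≤ 0 → ‖laplace η z‖ ≤ M := by
  let c : ℝ := ∑ j, ∑ k, (η j k).totalVariation.real Set.univ
  have hc : 0 ≤ c := by positivity
  refine ⟨n * c, by positivity, fun z hz => norm_le_of_entry_le hc fun j k => ?_⟩
  have hb : ∀ᵐ v : ℝ ∂(η j k).totalVariation, ‖Complex.exp (z * v)‖ ≤ 1 := by
    filter_upwards [hη.ae_nonneg j k] with v hv
    exact norm_cexp_mul_le hz hv
  have hi : Integrable (fun v : ℝ => Complex.exp (z * v)) (η j k).totalVariation :=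
    (integrable_const (1 : ℝ)).mono' (Continuous.aestronglyMeasurable (by fun_prop)) hb
  calc ‖laplace η z j k‖ ≤ ∫ v : ℝ, ‖Complex.exp (z * v)‖ ∂(η j k).totalVariation :=
        norm_sintegral_le hi
    _ ≤ ∫ _v : ℝ, 1 ∂(η j k).totalVariation :=
        integral_mono_ae hi.norm (integrable_const _) hb
    _ = (η j k).totalVariation.real Set.univ := by simp
    _ ≤ ∑ k, (η j k).totalVariation.real Set.univ :=
        Finset.single_le_sum (f := fun k => (η j k).totalVariation.real Set.univ)
          (fun _ _ => by positivity) (Finset.mem_univ k)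
    _ ≤ c := Finset.single_le_sum
          (f := fun j => ∑ k, (η j k).totalVariation.real Set.univ)
          (fun _ _ => by positivity) (Finset.mem_univ j)

theorem ConcentratedOnNonneg.continuousOn_laplace (hη : ConcentratedOnNonneg η) :
    ContinuousOn (laplace η) {z | z.re ≤ 0} := by
  refine continuousOn_pi.2 fun j => continuousOn_pi.2 fun k => ?_
  have h := ae_add_measure_iff.1 (hη.ae_nonneg j k)
  refine ContinuousOn.sub ?_ ?_
  · refine continuousOn_of_dominated (bound := fun _ => 1)
      (fun z _ => Continuous.aestronglyMeasurable (by fun_prop)) (fun z hz => ?_)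
      (integrable_const _) (ae_of_all _ fun v => Continuous.continuousOn (by fun_prop))
    filter_upwards [h.1] with v hv using norm_cexp_mul_le hz hv
  · refine continuousOn_of_dominated (bound := fun _ => 1)
      (fun z _ => Continuous.aestronglyMeasurable (by fun_prop)) (fun z hz => ?_)
      (integrable_const _) (ae_of_all _ fun v => Continuous.continuousOn (by fun_prop))
    filter_upwards [h.2] with v hv using norm_cexp_mul_le hz hv

theorem ConcentratedOnNonneg.continuousOn_charFn (hη : ConcentratedOnNonneg η) :
    ContinuousOn (charFn η) {z | z.re ≤ 0} :=
  ContinuousOn.sub (Continuous.continuousOn (by fun_prop)) hη.continuousOn_laplace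

theorem continuousOn_charFn_inv (hη : ConcentratedOnNonneg η) {S : Set ℂ}
    (hS : ∀ z ∈ S, z.re ≤ 0) (hdet : ∀ z ∈ S, (charFn η z).det ≠ 0) :
    ContinuousOn (fun z => (charFn η z)⁻¹) S := by
  have hc := hη.continuousOn_charFn.mono hS
  have hd : ContinuousOn (fun z => (charFn η z).det) S :=
    (Continuous.matrix_det continuous_id).comp_continuousOn hc
  have ha : ContinuousOn (fun z => (charFn η z).adjugate) S :=
    (Continuous.matrix_adjugate continuous_id).comp_continuousOn hc
  simp only [Matrix.inv_def, Ring.inverse_eq_inv']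
  exact (hd.inv₀ hdet).smul ha

/-- On a closed subset of the left half plane where `h` is invertible, `h⁻¹ = O(1 / (1 + |z|))`. -/
theorem exists_norm_charFn_inv_le (hη : ConcentratedOnNonneg η) {S : Set ℂ} (hSc : IsClosed S)
    (hS : ∀ z ∈ S, z.re ≤ 0) (hdet : ∀ z ∈ S, (charFn η z).det ≠ 0) :
    ∃ C : ℝ, ∀ z ∈ S, ‖(charFn η z)⁻¹‖ ≤ C / (1 + ‖z‖) := by
  obtain ⟨M, hM0, hM⟩ := hη.exists_norm_laplace_le
  -- Inside the ball of radius 2M + 1 compactness gives the bound. Outside it 1 + ‖z‖ ≤ 2(‖z‖ - M),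
  -- while h B = 1 gives (‖z‖ - M)‖B‖ ≤ ‖1‖; this explains both the radius and the constant c₀.
  obtain ⟨C₁, hC₁⟩ := ((isCompact_closedBall (0 : ℂ) (2 * M + 1)).inter_right
    hSc).exists_bound_of_continuousOn
    ((continuousOn_charFn_inv hη hS hdet).mono Set.inter_subset_right)
  let c₀ : ℝ := 2 * ‖(1 : Matrix (Fin n) (Fin n) ℂ)‖
  refine ⟨max (C₁ * (2 * M + 2)) c₀, fun z hz => ?_⟩
  have hp : 0 < 1 + ‖z‖ := by positivity
  rw [le_div_iff₀ hp]
  by_cases hzM : ‖z‖ ≤ 2 * M + 1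
  · have h1 := hC₁ z ⟨by simpa using hzM, hz⟩
    refine le_trans ?_ (le_max_left _ _)
    exact mul_le_mul h1 (by linarith) hp.le ((norm_nonneg _).trans h1)
  · refine le_trans ?_ (le_max_right _ _)
    set B := (charFn η z)⁻¹ with hB
    have h1 : charFn η z * B = 1 :=
      Matrix.mul_nonsing_inv _ (isUnit_iff_ne_zero.2 (hdet z hz))
    have h2 : z • B = -(1 + laplace η z * B) := by
      rw [charFn, sub_mul, neg_mul, smul_mul_assoc, one_mul] at h1
      rw [← h1]
      abel
    have h3 : ‖z‖ * ‖B‖ ≤ ‖(1 : Matrix (Fin n) (Fin n) ℂ)‖ + M * ‖B‖ := by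
      rw [← norm_smul, h2, norm_neg]
      refine (norm_add_le _ _).trans (add_le_add le_rfl ((norm_mul_le _ _).trans ?_))
      exact mul_le_mul_of_nonneg_right (hM z (hS z hz)) (norm_nonneg _)
    push Not at hzM
    have h4 : (1 + ‖z‖) * ‖B‖ ≤ 2 * (‖z‖ - M) * ‖B‖ :=
      mul_le_mul_of_nonneg_right (by linarith) (norm_nonneg _)
    simp only [c₀]
    linarith

end CharFn

end MSDDE
open scoped FourierTransform ENNReal ComplexConjugate

namespace MSDDE

/-! ### Shifting the contour in the left half plane -/

/-- An integrand that is holomorphic and `O(1 / (1 + |z| ^ 2))` on the left half plane has an inverse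
Fourier transform that vanishes on the negative half line. -/
theorem integral_exp_mul_eq_zero {F : ℂ → ℂ} {C : ℝ} (hc : ContinuousOn F {z | z.re ≤ 0})
    (hd : DifferentiableOn ℂ F {z | z.re < 0})
    (hb : ∀ z : ℂ, z.re ≤ 0 → ‖F z‖ ≤ C / (1 + ‖z‖ ^ 2)) {t : ℝ} (ht : t < 0) :
    ∫ y : ℝ, Complex.exp (-(t * (y * Complex.I))) * F (y * Complex.I) = 0 := by
  let G : ℂ → ℂ := fun z => Complex.exp (-(t * z)) * F z
  have hC : 0 ≤ C := by simpa using (norm_nonneg _).trans (hb 0 (by simp))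
  have hGb : ∀ z : ℂ, z.re ≤ 0 → ‖G z‖ ≤ Real.exp (-(t * z.re)) * (C / (1 + ‖z‖ ^ 2)) := by
    intro z hz
    simp only [G, norm_mul, Complex.norm_exp]
    have h1 : (-((t : ℂ) * z)).re = -(t * z.re) := by simp
    rw [h1]
    exact mul_le_mul_of_nonneg_left (hb z hz) (Real.exp_pos _).le
  have hGc : ContinuousOn G {z | z.re ≤ 0} :=
    (Continuous.continuousOn (by fun_prop)).mul hc
  have hGd : DifferentiableOn ℂ G {z | z.re < 0} :=
    (Differentiable.differentiableOn (by fun_prop)).mul hd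
  have hre : ∀ R y : ℝ, ((-R : ℝ) + y * Complex.I : ℂ).re = -R := by intro R y; simp
  have him : ∀ x y : ℝ, y ^ 2 ≤ ‖(x + y * Complex.I : ℂ)‖ ^ 2 := by
    intro x y
    rw [Complex.sq_norm, Complex.normSq_apply]
    simp
    nlinarith [sq_nonneg x]
  have hGR : ∀ R : ℝ, 0 ≤ R → ∀ y : ℝ, ‖G ((-R : ℝ) + y * Complex.I)‖ ≤
      Real.exp (t * R) * C * (1 + y ^ 2)⁻¹ := by
    intro R hR y
    refine (hGb _ (by rw [hre]; linarith)).trans ?_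
    rw [hre, mul_assoc, ← div_eq_mul_inv]
    have := him (-R) y
    have h2 : -(t * -R) = t * R := by ring
    rw [h2]
    gcongr
  have hcont : ∀ R : ℝ, 0 ≤ R → Continuous fun y : ℝ => G ((-R : ℝ) + y * Complex.I) := by
    intro R hR
    refine hGc.comp_continuous (by fun_prop) fun y => ?_
    simp only [Set.mem_ofPred_eq, hre]
    linarith
  have hint : ∀ R : ℝ, 0 ≤ R → Integrable fun y : ℝ => G ((-R : ℝ) + y * Complex.I) :=
    fun R hR => (integrable_inv_one_add_sq.const_mul _).mono' (hcont R hR).aestronglyMeasurable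
      (ae_of_all _ (hGR R hR))
  -- The integral over the vertical line Re z = -R. Cauchy's theorem makes it independent of R ≥ 0,
  -- and since t < 0 it is at most a constant times exp(tR), hence tends to zero.
  let J : ℝ → ℂ := fun R => ∫ y : ℝ, G ((-R : ℝ) + y * Complex.I)
  have hJ : ∀ R : ℝ, 0 ≤ R → J R = J 0 := by
    intro R hR
    have hrect : ∀ T : ℝ, 0 ≤ T →
        (((∫ x : ℝ in (-R)..0, G (x + ((-T : ℝ) : ℂ) * Complex.I)) -
          ∫ x : ℝ in (-R)..0, G (x + (T : ℂ) * Complex.I)) +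
          Complex.I • ∫ y : ℝ in (-T)..T, G (((-(0 : ℝ) : ℝ) : ℂ) + y * Complex.I)) -
          Complex.I • ∫ y : ℝ in (-T)..T, G (((-R : ℝ) : ℂ) + y * Complex.I) = 0 := by
      intro T hT
      have := Complex.integral_boundary_rect_eq_zero_of_continuousOn_of_differentiableOn G
        ⟨-R, -T⟩ ⟨0, T⟩ (hGc.mono fun z hz => ?_) (hGd.mono fun z hz => ?_)
      · simpa using! this
      · have := hz.1
        simp only [Set.mem_preimage, Set.uIcc_of_le (by linarith : -R ≤ 0)] at this
        exact this.2
      · have := hz.1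
        simp only [Set.mem_preimage, max_eq_right (by linarith : -R ≤ 0)] at this
        exact this.2
    -- The height enters the estimate only through its square, so one argument covers the top edge s
    -- T = T and the bottom edge s T = -T.
    have hhor : ∀ s : ℝ → ℝ, (∀ T, s T ^ 2 = T ^ 2) → Filter.Tendsto
        (fun T : ℝ => ∫ x : ℝ in (-R)..0, G (x + (s T : ℂ) * Complex.I)) Filter.atTop (nhds 0) := by
      intro s hs
      have hlim : Filter.Tendsto (fun T : ℝ => C / (1 + T ^ 2) * |0 - -R|) Filter.atTop
          (nhds 0) := by
        have h1 : Filter.Tendsto (fun T : ℝ => 1 + T ^ 2) Filter.atTop Filter.atTop :=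
          Filter.tendsto_atTop_add_const_left _ _ (Filter.tendsto_pow_atTop two_ne_zero)
        simpa using! (h1.const_div_atTop C).mul_const |0 - -R|
      refine squeeze_zero_norm (fun T => ?_) hlim
      refine intervalIntegral.norm_integral_le_of_norm_le_const fun x hx => ?_
      rw [Set.uIoc_of_le (by linarith)] at hx
      have hxr : ((x : ℂ) + (s T : ℂ) * Complex.I).re = x := by simp
      refine (hGb _ (by rw [hxr]; exact hx.2)).trans ?_
      rw [hxr]
      have h1 : Real.exp (-(t * x)) ≤ 1 := by
        rw [Real.exp_le_one_iff]
        nlinarith [mul_nonneg_of_nonpos_of_nonpos ht.le hx.2]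
      have h2 := him x (s T)
      rw [hs] at h2
      calc _ ≤ 1 * (C / (1 + ‖(x : ℂ) + (s T : ℂ) * Complex.I‖ ^ 2)) := by gcongr
        _ ≤ _ := by
          rw [one_mul]
          gcongr
    have hver : ∀ R : ℝ, 0 ≤ R → Filter.Tendsto
        (fun T : ℝ => ∫ y : ℝ in (-T)..T, G (((-R : ℝ) : ℂ) + y * Complex.I))
        Filter.atTop (nhds (J R)) := fun R hR =>
      intervalIntegral_tendsto_integral (hint R hR) Filter.tendsto_neg_atTop_atBot
        Filter.tendsto_id
    have hlim := ((((hhor (fun T => -T) (fun T => by ring)).sub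
      (hhor (fun T => T) fun T => rfl)).add
      ((hver 0 le_rfl).const_smul Complex.I)).sub ((hver R hR).const_smul Complex.I))
    have h0 : Filter.Tendsto (fun _ : ℝ => (0 : ℂ)) Filter.atTop
        (nhds (0 - 0 + Complex.I • J 0 - Complex.I • J R)) := by
      refine hlim.congr' ?_
      filter_upwards [Filter.eventually_ge_atTop 0] with T hT
      exact hrect T hT
    have h1 := tendsto_nhds_unique h0 tendsto_const_nhds
    have h2 : Complex.I * (J 0 - J R) = 0 := by
      simp only [smul_eq_mul] at h1
      linear_combination h1
    have h3 := (mul_eq_zero.1 h2).resolve_left Complex.I_ne_zero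
    exact (sub_eq_zero.1 h3).symm
  have hJlim : Filter.Tendsto J Filter.atTop (nhds 0) := by
    have hlim : Filter.Tendsto (fun R : ℝ => Real.exp (t * R) * (C * Real.pi)) Filter.atTop
        (nhds 0) := by
      have h1 : Filter.Tendsto (fun R : ℝ => t * R) Filter.atTop Filter.atBot :=
        Filter.tendsto_id.const_mul_atTop_of_neg ht
      simpa using! (Real.tendsto_exp_atBot.comp h1).mul_const (C * Real.pi)
    refine squeeze_zero_norm' ?_ hlim
    filter_upwards [Filter.eventually_ge_atTop 0] with R hR
    refine (norm_integral_le_of_norm_le (integrable_inv_one_add_sq.const_mul _)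
      (ae_of_all _ (hGR R hR))).trans (le_of_eq ?_)
    rw [integral_const_mul, integral_univ_inv_one_add_sq]
    ring
  have hJ0 : J 0 = 0 := by
    refine tendsto_nhds_unique (tendsto_const_nhds.congr' ?_) hJlim
    filter_upwards [Filter.eventually_ge_atTop 0] with R hR using (hJ R hR).symm
  simpa [J, G] using! hJ0

/-! ### The exponential kernel -/

/-- The function `exp(-t)` on the positive half line. -/
noncomputable def expKernel (t : ℝ) : ℝ := (Set.Ioi (0 : ℝ)).indicator (fun t => Real.exp (-t)) t

theorem measurable_expKernel : Measurable expKernel :=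
  (by fun_prop : Measurable fun t : ℝ => Real.exp (-t)).indicator measurableSet_Ioi

theorem expKernel_of_neg {t : ℝ} (ht : t < 0) : expKernel t = 0 :=
  Set.indicator_of_notMem (by simpa using ht.le) _

theorem hasFirstMoment_expKernel : HasFirstMoment expKernel := by
  refine ⟨measurable_expKernel, ?_⟩
  -- The majorant comes from 1 + t ≤ 2 exp(t/2), so that (1 + t) exp(-t) ≤ 2 exp(-t/2).
  have h1 : IntegrableOn (fun t : ℝ => 2 * Real.exp (-(1 / 2) * t)) (Set.Ioi 0) :=
    (exp_neg_integrableOn_Ioi 0 (by norm_num : (0 : ℝ) < 1 / 2)).const_mul 2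
  refine ((integrable_indicator_iff measurableSet_Ioi).2 h1).mono'
    ((by fun_prop : Measurable fun t : ℝ => 1 + |t|).mul
      measurable_expKernel).aestronglyMeasurable (ae_of_all _ fun t => ?_)
  by_cases ht : t ∈ Set.Ioi (0 : ℝ)
  · have ht0 : 0 < t := ht
    rw [expKernel, Set.indicator_of_mem ht, Set.indicator_of_mem ht, abs_of_pos ht0,
      Real.norm_of_nonneg (by positivity)]
    have h2 : Real.exp (-t) = Real.exp (-(1 / 2) * t) * Real.exp (-(t / 2)) := by
      rw [← Real.exp_add]
      ring_nf
    have h3 : t / 2 + 1 ≤ Real.exp (t / 2) := Real.add_one_le_exp _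
    have h4 : Real.exp (t / 2) * Real.exp (-(t / 2)) = 1 := by
      rw [← Real.exp_add]
      simp
    have h5 : (1 + t) * Real.exp (-(t / 2)) ≤ 2 := by
      have := mul_le_mul_of_nonneg_right (by linarith : 1 + t ≤ 2 * Real.exp (t / 2))
        (Real.exp_pos (-(t / 2))).le
      linarith
    rw [h2]
    have := mul_le_mul_of_nonneg_left h5 (Real.exp_pos (-(1 / 2) * t)).le
    linarith
  · simp [expKernel, Set.indicator_of_notMem ht]

theorem memLp_expKernel : MemLp (fun t => (expKernel t : ℂ)) 2 := by
  have hm : Measurable fun t => (expKernel t : ℂ) :=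
    Complex.measurable_ofReal.comp measurable_expKernel
  rw [memLp_two_iff_integrable_sq_norm hm.aestronglyMeasurable]
  refine hasFirstMoment_expKernel.integrable.mono
    (hm.norm.pow_const 2).aestronglyMeasurable
    (ae_of_all _ fun t => ?_)
  have h0 : 0 ≤ expKernel t := Set.indicator_nonneg (fun _ _ => (Real.exp_pos _).le) _
  have h1 : expKernel t ≤ 1 := Set.indicator_le' (fun t ht => by
    simpa using (Set.mem_Ioi.1 ht).le) (fun _ _ => zero_le_one) t
  simp only [Complex.norm_real, norm_pow, norm_norm]
  rw [Real.norm_of_nonneg h0]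
  nlinarith

theorem fourier_expKernel (w : ℝ) :
    𝓕 (fun t => (expKernel t : ℂ)) w =
      (1 - Complex.I * ((-2 * Real.pi * w : ℝ) : ℂ))⁻¹ := by
  set z : ℂ := Complex.I * ((-2 * Real.pi * w : ℝ) : ℂ) with hz
  have hzre : (z - 1).re < 0 := by simp [hz]
  rw [fourier_eq_integral_cexp, ← hz]
  have e : ∀ t : ℝ, Complex.exp (z * t) * (expKernel t : ℂ) =
      (Set.Ioi (0 : ℝ)).indicator (fun t : ℝ => Complex.exp ((z - 1) * t)) t := by
    intro t
    by_cases ht : t ∈ Set.Ioi (0 : ℝ)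
    · rw [expKernel, Set.indicator_of_mem ht, Set.indicator_of_mem ht, Complex.ofReal_exp,
        ← Complex.exp_add]
      congr 1
      push_cast
      ring
    · rw [expKernel, Set.indicator_of_notMem ht, Set.indicator_of_notMem ht]
      simp
  simp only [e]
  rw [integral_indicator measurableSet_Ioi, integral_exp_mul_complex_Ioi hzre]
  have h1 : z - 1 ≠ 0 := fun h => by simp [h] at hzre
  have h2 : 1 - z ≠ 0 := fun h => h1 (by linear_combination -h)
  simp only [Complex.ofReal_zero, mul_zero, Complex.exp_zero]
  field_simp
  ring

end MSDDE
open scoped FourierTransform ENNReal ComplexConjugate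

namespace MSDDE

/-! ### Decay, symmetry and smoothness of the regularized inverse on the imaginary axis -/

section Kernel

attribute [local instance] Matrix.linftyOpNormedAddCommGroup Matrix.linftyOpNormedSpace
  Matrix.linftyOpNormedRing Matrix.linftyOpNormedAlgebra

variable {n : ℕ} {η : MatrixMeasure n}

/-- The function `h(z)⁻¹ - (1 - z)⁻¹ I`, which decays quadratically. -/
noncomputable def regularizedInverse (η : MatrixMeasure n) (z : ℂ) :
    Matrix (Fin n) (Fin n) ℂ :=
  (charFn η z)⁻¹ - (1 - z)⁻¹ • (1 : Matrix (Fin n) (Fin n) ℂ)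

/-- For Re z ≤ 0 one has |1 - z|² = 1 - 2 Re z + |z|² ≥ 1 + |z|² ≥ (1 + |z|)²/2. -/
theorem one_add_norm_le_two_mul {z : ℂ} (hz : z.re ≤ 0) : 1 + ‖z‖ ≤ 2 * ‖1 - z‖ := by
  have h1 : ‖z‖ ^ 2 = z.re ^ 2 + z.im ^ 2 := by
    rw [Complex.sq_norm, Complex.normSq_apply]
    ring
  have h2 : ‖1 - z‖ ^ 2 = (1 - z.re) ^ 2 + z.im ^ 2 := by
    rw [Complex.sq_norm, Complex.normSq_apply]
    simp
    ring
  nlinarith [norm_nonneg z, norm_nonneg (1 - z), sq_nonneg (1 - ‖z‖)]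

theorem norm_inv_one_sub_le {z : ℂ} (hz : z.re ≤ 0) : ‖(1 - z)⁻¹‖ ≤ 2 / (1 + ‖z‖) := by
  have h := one_add_norm_le_two_mul hz
  have h0 : 0 < 1 + ‖z‖ := by positivity
  have h1 : 0 < ‖1 - z‖ := by linarith
  rw [norm_inv, inv_eq_one_div, div_le_div_iff₀ h1 h0]
  linarith

theorem one_sub_ne_zero_of_re_nonpos {z : ℂ} (hz : z.re ≤ 0) : 1 - z ≠ 0 := by
  intro h
  have := one_add_norm_le_two_mul hz
  rw [h, norm_zero] at this
  linarith [norm_nonneg z]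

/-- The difference equals (1 - z)⁻¹ (1 + L(z)) h(z)⁻¹: the leading terms cancel and two factors of
order 1/(1 + |z|) remain. -/
theorem exists_norm_regularizedInverse_le (hη : ConcentratedOnNonneg η) {S : Set ℂ}
    (hSc : IsClosed S) (hS : ∀ z ∈ S, z.re ≤ 0) (hdet : ∀ z ∈ S, (charFn η z).det ≠ 0) :
    ∃ C : ℝ, ∀ z ∈ S, ‖regularizedInverse η z‖ ≤ C / (1 + ‖z‖ ^ 2) := by
  obtain ⟨M, hM0, hM⟩ := hη.exists_norm_laplace_le
  obtain ⟨C, hC⟩ := exists_norm_charFn_inv_le hη hSc hS hdet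
  let c₀ : ℝ := ‖(1 : Matrix (Fin n) (Fin n) ℂ)‖ + M
  refine ⟨2 * c₀ * C, fun z hz => ?_⟩
  set B := (charFn η z)⁻¹ with hB
  have h1 : charFn η z * B = 1 := Matrix.mul_nonsing_inv _ (isUnit_iff_ne_zero.2 (hdet z hz))
  have h2 : regularizedInverse η z = (1 - z)⁻¹ • ((1 + laplace η z) * B) := by
    have h3 : (1 + laplace η z) * B = (1 - z) • B - 1 := by
      rw [add_mul, one_mul, sub_smul, one_smul, ← h1, charFn, sub_mul, neg_mul, smul_mul_assoc,
        one_mul]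
      abel
    rw [h3, smul_sub, smul_smul, inv_mul_cancel₀ (one_sub_ne_zero_of_re_nonpos (hS z hz)),
      one_smul]
    rfl
  have hB0 := hC z hz
  have hC0 : 0 ≤ C / (1 + ‖z‖) := (norm_nonneg _).trans hB0
  have hCnn : 0 ≤ C := by
    by_contra h
    push Not at h
    exact absurd hC0 (not_le.2 (div_neg_of_neg_of_pos h (by positivity)))
  have h4 : ‖1 + laplace η z‖ ≤ c₀ :=
    (norm_add_le _ _).trans (add_le_add le_rfl (hM z (hS z hz)))
  have hc₀ : 0 ≤ c₀ := (norm_nonneg _).trans h4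
  rw [h2, norm_smul]
  calc ‖(1 - z)⁻¹‖ * ‖(1 + laplace η z) * B‖
      ≤ (2 / (1 + ‖z‖)) * (c₀ * (C / (1 + ‖z‖))) := by
        refine mul_le_mul (norm_inv_one_sub_le (hS z hz)) ((norm_mul_le _ _).trans ?_)
          (norm_nonneg _) (by positivity)
        exact mul_le_mul h4 hB0 (norm_nonneg _) hc₀
    _ = 2 * c₀ * C / (1 + ‖z‖) ^ 2 := by field_simp
    _ ≤ _ := by
        gcongr
        nlinarith [norm_nonneg z]

theorem conj_sintegral_cexp (μ : SignedMeasure ℝ) (z : ℂ) :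
    conj (sintegral μ fun u : ℝ => Complex.exp (z * u)) =
      sintegral μ fun u : ℝ => Complex.exp (conj z * u) := by
  rw [sintegral, sintegral, map_sub, ← integral_conj, ← integral_conj]
  simp [← Complex.exp_conj]

/-- The measures are real. This symmetry is what makes the kernel real-valued. -/
theorem charFn_conj (η : MatrixMeasure n) (z : ℂ) :
    charFn η (conj z) = (charFn η z).map conj := by
  ext j k
  have h : laplace η (conj z) j k = conj (laplace η z j k) := (conj_sintegral_cexp _ _).symm
  by_cases hjk : j = k
  · subst hjk
    simp [charFn, h]
  · simp [charFn, h, hjk]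

theorem charFn_inv_conj {z : ℂ} (hdet : (charFn η z).det ≠ 0) :
    (charFn η (conj z))⁻¹ = ((charFn η z)⁻¹).map conj := by
  refine Matrix.inv_eq_right_inv ?_
  rw [charFn_conj, ← Matrix.map_mul, Matrix.mul_nonsing_inv _ (isUnit_iff_ne_zero.2 hdet)]
  simp

theorem regularizedInverse_conj {z : ℂ} (hdet : (charFn η z).det ≠ 0) (j k : Fin n) :
    regularizedInverse η (conj z) j k = conj (regularizedInverse η z j k) := by
  by_cases hjk : j = k
  · subst hjk
    simp [regularizedInverse, charFn_inv_conj hdet]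
  · simp [regularizedInverse, charFn_inv_conj hdet, hjk]

theorem freq_re (w : ℝ) : (Complex.I * ((-2 * Real.pi * w : ℝ) : ℂ)).re = 0 := by
  simp

theorem freq_neg (w : ℝ) : Complex.I * ((-2 * Real.pi * -w : ℝ) : ℂ) =
    conj (Complex.I * ((-2 * Real.pi * w : ℝ) : ℂ)) := by
  rw [map_mul, Complex.conj_I, Complex.conj_ofReal]
  push_cast
  ring

theorem freq_eq (w : ℝ) : Complex.I * ((-2 * Real.pi * w : ℝ) : ℂ) =
    Complex.I * ((-2 * Real.pi : ℝ) : ℂ) * w := by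
  push_cast
  ring

theorem le_norm_freq (w : ℝ) : |w| ≤ ‖Complex.I * ((-2 * Real.pi * w : ℝ) : ℂ)‖ := by
  rw [norm_mul, Complex.norm_I, one_mul, Complex.norm_real, norm_mul, norm_mul, Real.norm_eq_abs w]
  have : 1 ≤ ‖(-2 : ℝ)‖ * ‖Real.pi‖ := by
    rw [Real.norm_of_nonneg Real.pi_pos.le]
    norm_num
    linarith [Real.pi_gt_three]
  exact le_mul_of_one_le_left (abs_nonneg w) this

/-- The data of two bounded derivatives of `w ↦ h(-2 π i w)`. -/
theorem exists_deriv_charFn (hmom : HasMoment η 2) :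
    ∃ (H₁ H₂ : ℝ → Matrix (Fin n) (Fin n) ℂ) (K : ℝ),
      (∀ w, HasDerivAt (fun w : ℝ => charFn η (Complex.I * ((-2 * Real.pi * w : ℝ) : ℂ)))
        (H₁ w) w) ∧ (∀ w, HasDerivAt H₁ (H₂ w) w) ∧ (∀ w, ‖H₁ w‖ ≤ K) ∧ ∀ w, ‖H₂ w‖ ≤ K := by
  set c : ℂ := Complex.I * ((-2 * Real.pi : ℝ) : ℂ) with hc
  have hcre : c.re = 0 := by simp [hc]
  -- `L p` is the p-th derivative of the transform along w ↦ c w and is bounded by moments of order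
  -- p. The linear part of h adds a constant to the first derivative and nothing to the second.
  let L : ℕ → ℝ → Matrix (Fin n) (Fin n) ℂ := fun p w j k =>
    sintegral (η j k) fun v : ℝ => (c * v) ^ p * Complex.exp (c * w * v)
  let b : ℕ → ℝ := fun p => ∑ j, ∑ k, ∫ v, ‖c‖ ^ p * |v| ^ p ∂(η j k).totalVariation
  have hb : ∀ p ≤ 2, ∀ w, ‖L p w‖ ≤ n * b p := by
    intro p hp w
    refine norm_le_of_entry_le (by positivity) fun j k => ?_
    refine (norm_sintegral_pow_mul_cexp_le c hcre p (hmom.of_two hp j k) w).trans ?_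
    refine (Finset.single_le_sum
      (f := fun k => ∫ v, ‖c‖ ^ p * |v| ^ p ∂(η j k).totalVariation)
      (fun _ _ => by positivity) (Finset.mem_univ k)).trans ?_
    exact Finset.single_le_sum
      (f := fun j => ∑ k, ∫ v, ‖c‖ ^ p * |v| ^ p ∂(η j k).totalVariation)
      (fun _ _ => by positivity) (Finset.mem_univ j)
  have hL : ∀ p < 2, ∀ w, HasDerivAt (L p) (L (p + 1) w) w := fun p hp w =>
    hasDerivAt_pi.2 fun j => hasDerivAt_pi.2 fun k =>
      hasDerivAt_sintegral_pow_mul_cexp c hcre p (hmom.of_two (by omega) j k)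
        (hmom.of_two (by omega) j k) w
  have hH : ∀ w : ℝ, charFn η (Complex.I * ((-2 * Real.pi * w : ℝ) : ℂ)) =
      -((w : ℂ) • c • (1 : Matrix (Fin n) (Fin n) ℂ)) - L 0 w := by
    intro w
    rw [charFn, freq_eq, smul_smul, mul_comm (w : ℂ)]
    congr 1
    ext j k
    simp [L, laplace, hc]
  have hlin : ∀ w : ℝ, HasDerivAt (fun w : ℝ => (w : ℂ) • c • (1 : Matrix (Fin n) (Fin n) ℂ))
      (c • (1 : Matrix (Fin n) (Fin n) ℂ)) w := by
    intro w
    simpa using! (Complex.ofRealCLM.hasDerivAt (x := w)).smul_const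
      (c • (1 : Matrix (Fin n) (Fin n) ℂ))
  refine ⟨fun w => -(c • (1 : Matrix (Fin n) (Fin n) ℂ)) - L 1 w, fun w => -L 2 w,
    ‖c • (1 : Matrix (Fin n) (Fin n) ℂ)‖ + n * b 1 + n * b 2, fun w => ?_, fun w => ?_,
    fun w => ?_, fun w => ?_⟩
  · simp only [hH]
    exact (hlin w).neg.sub (hL 0 (by norm_num) w)
  · exact (hL 1 (by norm_num) w).const_sub _
  · refine (norm_sub_le _ _).trans ?_
    rw [norm_neg]
    have := hb 1 (by norm_num) w
    have h2 : 0 ≤ n * b 2 := by positivity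
    linarith
  · rw [norm_neg]
    have := hb 2 le_rfl w
    have h1 : 0 ≤ n * b 1 := by positivity
    linarith [norm_nonneg (c • (1 : Matrix (Fin n) (Fin n) ℂ))]

theorem exists_deriv_inv_one_sub_freq :
    ∃ (G₁ G₂ : ℝ → ℂ) (C : ℝ),
      (∀ w : ℝ, HasDerivAt (fun w : ℝ => (1 - Complex.I * ((-2 * Real.pi * w : ℝ) : ℂ))⁻¹)
        (G₁ w) w) ∧ (∀ w, HasDerivAt G₁ (G₂ w) w) ∧
      (∀ w, ‖G₁ w‖ ≤ C / (1 + w ^ 2)) ∧ ∀ w, ‖G₂ w‖ ≤ C / (1 + w ^ 2) := by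
  set c : ℂ := Complex.I * ((-2 * Real.pi : ℝ) : ℂ) with hc
  have hne : ∀ w : ℝ, 1 - Complex.I * ((-2 * Real.pi * w : ℝ) : ℂ) ≠ 0 := fun w =>
    one_sub_ne_zero_of_re_nonpos (freq_re w).le
  refine exists_deriv_of_inverse (H := fun w : ℝ => 1 - Complex.I * ((-2 * Real.pi * w : ℝ) : ℂ))
    (H₁ := fun _ => -c) (H₂ := fun _ => 0) (C := 2) (K := ‖c‖)
    (fun w => mul_inv_cancel₀ (hne w)) (fun w => inv_mul_cancel₀ (hne w)) (fun w => ?_)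
    (fun w => hasDerivAt_const _ _) (fun w => ?_) (fun w => by simp) (fun w => by simp)
  · simp only [freq_eq, ← hc]
    simpa using! ((Complex.ofRealCLM.hasDerivAt (x := w)).const_mul c).const_sub 1
  · refine (norm_inv_one_sub_le (freq_re w).le).trans ?_
    have := le_norm_freq w
    gcongr

/-- Only the function itself needs the cancellation between its two terms. The derivatives of each
term separately decay quadratically, being at least quadratic in an inverse that decays linearly. -/
theorem exists_deriv_regularizedInverse (hη : ConcentratedOnNonneg η) (hmom : HasMoment η 2)
    (hdet : ∀ y : ℝ, (charFn η (Complex.I * (y : ℂ))).det ≠ 0) (j k : Fin n) :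
    ∃ (ψ₁ ψ₂ : ℝ → ℂ) (C : ℝ),
      (∀ w : ℝ, HasDerivAt
        (fun w : ℝ => regularizedInverse η (Complex.I * ((-2 * Real.pi * w : ℝ) : ℂ)) j k)
        (ψ₁ w) w) ∧ (∀ w, HasDerivAt ψ₁ (ψ₂ w) w) ∧
      (∀ w : ℝ, ‖regularizedInverse η (Complex.I * ((-2 * Real.pi * w : ℝ) : ℂ)) j k‖ ≤
        C / (1 + w ^ 2)) ∧
      (∀ w, ‖ψ₁ w‖ ≤ C / (1 + w ^ 2)) ∧ ∀ w, ‖ψ₂ w‖ ≤ C / (1 + w ^ 2) := by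
  have hSc : IsClosed {z : ℂ | z.re = 0} := isClosed_eq Complex.continuous_re continuous_const
  have hSre : ∀ z ∈ {z : ℂ | z.re = 0}, z.re ≤ 0 := fun z hz => le_of_eq hz
  have hSdet : ∀ z ∈ {z : ℂ | z.re = 0}, (charFn η z).det ≠ 0 := by
    intro z hz
    have : z = Complex.I * (z.im : ℂ) := by
      apply Complex.ext
      · simpa using hz
      · simp
    rw [this]
    exact hdet _
  obtain ⟨C, hC⟩ := exists_norm_charFn_inv_le hη hSc hSre hSdet
  obtain ⟨C₀, hC₀⟩ := exists_norm_regularizedInverse_le hη hSc hSre hSdet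
  obtain ⟨H₁, H₂, K, hH, hH₁, hK₁, hK₂⟩ := exists_deriv_charFn hmom
  have hCnn : 0 ≤ C := by simpa using (norm_nonneg _).trans (hC 0 rfl)
  have hC₀nn : 0 ≤ C₀ := by simpa using (norm_nonneg _).trans (hC₀ 0 rfl)
  have hu : ∀ w : ℝ, IsUnit (charFn η (Complex.I * ((-2 * Real.pi * w : ℝ) : ℂ))).det :=
    fun w => isUnit_iff_ne_zero.2 (hdet _)
  obtain ⟨G₁, G₂, C₁, hG, hG₁, hB₁, hB₂⟩ := exists_deriv_of_inverse
    (G := fun w : ℝ => (charFn η (Complex.I * ((-2 * Real.pi * w : ℝ) : ℂ)))⁻¹) (C := C)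
    (fun w => Matrix.mul_nonsing_inv _ (hu w)) (fun w => Matrix.nonsing_inv_mul _ (hu w)) hH hH₁
    (fun w => (hC _ (freq_re w)).trans (by
      have := le_norm_freq w
      gcongr)) hK₁ hK₂
  obtain ⟨e₁, e₂, C₂, he, he₁, hE₁, hE₂⟩ := exists_deriv_inv_one_sub_freq
  have hC₁nn : 0 ≤ C₁ := by simpa using (norm_nonneg _).trans (hB₁ 0)
  have hC₂nn : 0 ≤ C₂ := by simpa using (norm_nonneg _).trans (hE₁ 0)
  let d : ℂ := (1 : Matrix (Fin n) (Fin n) ℂ) j k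
  have hd : ‖d‖ ≤ 1 := by
    by_cases hjk : j = k
    · subst hjk
      simp [d]
    · simp [d, hjk]
  have hcomb : ∀ (a b : ℂ) (w : ℝ), ‖a‖ ≤ C₁ / (1 + w ^ 2) → ‖b‖ ≤ C₂ / (1 + w ^ 2) →
      ‖a - b * d‖ ≤ (C₀ + C₁ + C₂) / (1 + w ^ 2) := by
    intro a b w ha hb
    calc ‖a - b * d‖ ≤ ‖a‖ + ‖b * d‖ := norm_sub_le _ _
      _ ≤ ‖a‖ + ‖b‖ := by
          rw [norm_mul]
          linarith [mul_le_of_le_one_right (norm_nonneg b) hd]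
      _ ≤ 0 / (1 + w ^ 2) + C₁ / (1 + w ^ 2) + C₂ / (1 + w ^ 2) := by
          rw [zero_div]
          linarith
      _ = (0 + C₁ + C₂) / (1 + w ^ 2) := by rw [add_div, add_div]
      _ ≤ _ := by gcongr
  refine ⟨fun w => G₁ w j k - e₁ w * d, fun w => G₂ w j k - e₂ w * d, C₀ + C₁ + C₂,
    fun w => ?_, fun w => ?_, fun w => ?_, fun w => ?_, fun w => ?_⟩
  · exact (hasDerivAt_pi.1 (hasDerivAt_pi.1 (hG w) j) k).sub ((he w).mul_const d)
  · exact (hasDerivAt_pi.1 (hasDerivAt_pi.1 (hG₁ w) j) k).sub ((he₁ w).mul_const d)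
  · refine (norm_entry_le _ _ _).trans ((hC₀ _ (freq_re w)).trans ?_)
    have := pow_le_pow_left₀ (abs_nonneg w) (le_norm_freq w) 2
    rw [sq_abs] at this
    calc _ ≤ C₀ / (1 + w ^ 2) := by gcongr
      _ ≤ _ := by
        gcongr
        linarith
  · exact hcomb _ _ _ ((norm_entry_le _ _ _).trans (hB₁ w)) (hE₁ w)
  · exact hcomb _ _ _ ((norm_entry_le _ _ _).trans (hB₂ w)) (hE₂ w)

end Kernel

end MSDDE
open scoped FourierTransform ENNReal ComplexConjugate

namespace MSDDE

variable {n : ℕ} {η : MatrixMeasure n}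

/-! ### Holomorphy in the left half plane -/

/-- The integral is the complex moment generating function of the identity under m. Real exponents
in (-∞, 0] are admissible because m lives on [0, ∞), and the interior of this set gives the open
half plane. -/
theorem differentiableOn_integral_cexp {m : Measure ℝ} [IsFiniteMeasure m]
    (hm : ∀ᵐ v ∂m, 0 ≤ v) :
    DifferentiableOn ℂ (fun z : ℂ => ∫ v : ℝ, Complex.exp (z * v) ∂m) {z | z.re < 0} := by
  have h : Set.Iic (0 : ℝ) ⊆ integrableExpSet (fun v : ℝ => v) m := by
    intro t ht
    refine (integrable_const (1 : ℝ)).mono' (Continuous.aestronglyMeasurable (by fun_prop)) ?_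
    filter_upwards [hm] with v hv
    rw [Real.norm_of_nonneg (Real.exp_pos _).le, Real.exp_le_one_iff]
    exact mul_nonpos_of_nonpos_of_nonneg ht hv
  have h' := interior_mono h
  rw [interior_Iic] at h'
  exact (differentiableOn_complexMGF (X := fun v : ℝ => v) (μ := m)).mono fun z hz => h' hz

theorem ConcentratedOnNonneg.differentiableOn_laplace (hη : ConcentratedOnNonneg η)
    (j k : Fin n) : DifferentiableOn ℂ (fun z => laplace η z j k) {z | z.re < 0} := by
  have h := ae_add_measure_iff.1 (hη.ae_nonneg j k)
  exact (differentiableOn_integral_cexp h.1).sub (differentiableOn_integral_cexp h.2)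

theorem ConcentratedOnNonneg.differentiableOn_charFn (hη : ConcentratedOnNonneg η)
    (j k : Fin n) : DifferentiableOn ℂ (fun z => charFn η z j k) {z | z.re < 0} := by
  have h := hη.differentiableOn_laplace j k
  have h1 : DifferentiableOn ℂ (fun z : ℂ => -(z * (1 : Matrix (Fin n) (Fin n) ℂ) j k))
      {z | z.re < 0} := Differentiable.differentiableOn (by fun_prop)
  exact h1.sub h

theorem differentiableOn_det {ι : Type*} [Fintype ι] [DecidableEq ι] {S : Set ℂ}
    {A : ℂ → Matrix ι ι ℂ}
    (hA : ∀ j k, DifferentiableOn ℂ (fun z => A z j k) S) :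
    DifferentiableOn ℂ (fun z => (A z).det) S := by
  simp only [Matrix.det_apply]
  refine DifferentiableOn.fun_sum fun σ _ => ?_
  refine DifferentiableOn.const_smul ?_ _
  exact DifferentiableOn.fun_finsetProd fun i _ => hA _ _

/-- Cramer's rule: the entries are quotients of determinants of matrices with holomorphic entries.
-/
theorem differentiableOn_charFn_inv (hη : ConcentratedOnNonneg η)
    (hdet : ∀ z : ℂ, z.re < 0 → (charFn η z).det ≠ 0) (j k : Fin n) :
    DifferentiableOn ℂ (fun z => (charFn η z)⁻¹ j k) {z | z.re < 0} := by
  have h1 : DifferentiableOn ℂ (fun z => (charFn η z).det) {z | z.re < 0} :=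
    differentiableOn_det hη.differentiableOn_charFn
  have h2 : DifferentiableOn ℂ (fun z => (charFn η z).adjugate j k) {z | z.re < 0} := by
    simp only [Matrix.adjugate_apply]
    refine differentiableOn_det fun a b => ?_
    by_cases ha : a = k
    · subst ha
      simp only [Matrix.updateRow_self]
      exact differentiableOn_const _
    · simp only [Matrix.updateRow_ne ha]
      exact hη.differentiableOn_charFn a b
  simp only [Matrix.inv_def, Ring.inverse_eq_inv', Matrix.smul_apply, smul_eq_mul]
  exact (h1.inv fun z hz => hdet z hz).mul h2

theorem continuousOn_regularizedInverse (hη : ConcentratedOnNonneg η)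
    (hdet : ∀ z : ℂ, z.re ≤ 0 → (charFn η z).det ≠ 0) (j k : Fin n) :
    ContinuousOn (fun z => regularizedInverse η z j k) {z | z.re ≤ 0} := by
  have h1 := continuousOn_pi.1 (continuousOn_pi.1
    (continuousOn_charFn_inv hη (S := {z | z.re ≤ 0}) (fun _ hz => hz) hdet) j) k
  have h2 : ContinuousOn (fun z : ℂ => (1 - z)⁻¹ * (1 : Matrix (Fin n) (Fin n) ℂ) j k)
      {z | z.re ≤ 0} :=
    (ContinuousOn.inv₀ (Continuous.continuousOn (by fun_prop))
      fun z hz => one_sub_ne_zero_of_re_nonpos hz).mul continuousOn_const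
  exact h1.sub h2

theorem differentiableOn_regularizedInverse (hη : ConcentratedOnNonneg η)
    (hdet : ∀ z : ℂ, z.re ≤ 0 → (charFn η z).det ≠ 0) (j k : Fin n) :
    DifferentiableOn ℂ (fun z => regularizedInverse η z j k) {z | z.re < 0} := by
  have h2 : DifferentiableOn ℂ (fun z : ℂ => (1 - z)⁻¹ * (1 : Matrix (Fin n) (Fin n) ℂ) j k)
      {z | z.re < 0} :=
    (DifferentiableOn.inv (Differentiable.differentiableOn (by fun_prop))
      fun z hz => one_sub_ne_zero_of_re_nonpos (le_of_lt hz)).mul (differentiableOn_const _)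
  exact (differentiableOn_charFn_inv hη (fun z hz => hdet z hz.le) j k).sub h2

/-! ### Existence of the kernel -/

theorem fourierInv_eq_integral_cexp (f : ℝ → ℂ) (t : ℝ) :
    𝓕⁻ f t = ∫ w : ℝ, Complex.exp (-(Complex.I * ((-2 * Real.pi * w : ℝ) : ℂ) * t)) * f w := by
  rw [Real.fourierInv_eq_fourier_neg, fourier_eq_integral_cexp]
  refine integral_congr_ae (ae_of_all _ fun w => ?_)
  simp only
  congr 2
  push_cast
  ring

theorem conj_fourierInv {f : ℝ → ℂ} (hf : ∀ w, f (-w) = conj (f w)) (t : ℝ) :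
    conj (𝓕⁻ f t) = 𝓕⁻ f t := by
  rw [fourierInv_eq_integral_cexp, ← integral_conj, ← integral_neg_eq_self]
  refine integral_congr_ae (ae_of_all _ fun w => ?_)
  simp only [map_mul, hf, Complex.conj_conj, ← Complex.exp_conj, map_neg, Complex.conj_I,
    Complex.conj_ofReal]
  congr 2
  push_cast
  ring

theorem ae_comp_mul_left {p : ℝ → Prop} (h : ∀ᵐ w : ℝ, p w) {a : ℝ} (ha : a ≠ 0) :
    ∀ᵐ y : ℝ, p (a * y) := by
  rw [ae_iff] at h ⊢
  have := Real.volume_preimage_mul_left ha {w | ¬ p w}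
  rw [h, mul_zero] at this
  exact this

/-- A kernel of `η`, built from the inverse Fourier transform of the regularized inverse. -/
noncomputable def kernel (η : MatrixMeasure n) (t : ℝ) : Matrix (Fin n) (Fin n) ℝ := fun j k =>
  (𝓕⁻ (fun w : ℝ => regularizedInverse η (Complex.I * ((-2 * Real.pi * w : ℝ) : ℂ)) j k) t).re +
    expKernel t * (1 : Matrix (Fin n) (Fin n) ℝ) j k

theorem fourierInv_regularizedInverse (hη : ConcentratedOnNonneg η) (hmom : HasMoment η 2)
    (hdet : ∀ y : ℝ, (charFn η (Complex.I * (y : ℂ))).det ≠ 0)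
    (j k : Fin n) :
    let q := 𝓕⁻ fun w : ℝ => regularizedInverse η (Complex.I * ((-2 * Real.pi * w : ℝ) : ℂ)) j k
    MemLp q 2 ∧ Integrable (fun t : ℝ => (1 + |t|) * ‖q t‖) ∧ Continuous q ∧ Integrable q ∧
      𝓕 q = fun w : ℝ => regularizedInverse η (Complex.I * ((-2 * Real.pi * w : ℝ) : ℂ)) j k := by
  obtain ⟨ψ₁, ψ₂, C, hd, hd₁, hb, hb₁, hb₂⟩ := exists_deriv_regularizedInverse hη hmom hdet j k
  obtain ⟨h1, h2, h3⟩ := fourierInv_decay hd hd₁ hb hb₁ hb₂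
  have hc := continuous_iff_continuousAt.2 fun w => (hd w).continuousAt
  have hqc : Continuous (𝓕⁻ fun w : ℝ =>
      regularizedInverse η (Complex.I * ((-2 * Real.pi * w : ℝ) : ℂ)) j k) := by
    rw [funext (Real.fourierInv_eq_fourier_neg _)]
    exact (continuous_fourier_of_integrable
      (integrable_of_le_one_add_sq (Or.inl hc) hb)).comp continuous_neg
  refine ⟨h1, h2, hqc, ?_, h3⟩
  refine h2.mono' h1.aestronglyMeasurable (ae_of_all _ fun t => ?_)
  exact le_mul_of_one_le_left (norm_nonneg _) (by linarith [abs_nonneg t])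

/-- By conjugate symmetry the inverse transform is already real, so the real part taken in `kernel`
discards nothing. -/
theorem ofReal_kernel (hdet : ∀ y : ℝ, (charFn η (Complex.I * (y : ℂ))).det ≠ 0)
    (j k : Fin n) (t : ℝ) :
    ((kernel η t j k : ℝ) : ℂ) =
      𝓕⁻ (fun w : ℝ => regularizedInverse η (Complex.I * ((-2 * Real.pi * w : ℝ) : ℂ)) j k) t +
        (expKernel t : ℂ) * (1 : Matrix (Fin n) (Fin n) ℂ) j k := by
  have h := conj_fourierInv (f := fun w : ℝ =>
    regularizedInverse η (Complex.I * ((-2 * Real.pi * w : ℝ) : ℂ)) j k) (fun w => by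
      rw [freq_neg]
      exact regularizedInverse_conj (hdet _) j k) t
  have h1 : (((1 : Matrix (Fin n) (Fin n) ℝ) j k : ℝ) : ℂ) = (1 : Matrix (Fin n) (Fin n) ℂ) j k := by
    by_cases hjk : j = k
    · subst hjk
      simp
    · simp [hjk]
  rw [kernel, Complex.ofReal_add, Complex.conj_eq_iff_re.1 h, Complex.ofReal_mul, h1]

theorem hasFirstMoment_kernel (hη : ConcentratedOnNonneg η) (hmom : HasMoment η 2)
    (hdet : ∀ y : ℝ, (charFn η (Complex.I * (y : ℂ))).det ≠ 0)
    (j k : Fin n) : HasFirstMoment fun t => kernel η t j k := by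
  obtain ⟨h1, h2, h3, h4, h5⟩ := fourierInv_regularizedInverse hη hmom hdet j k
  refine HasFirstMoment.add ⟨(Complex.continuous_re.comp h3).measurable, ?_⟩
    ⟨measurable_expKernel.mul_const _, ?_⟩
  · refine h2.mono' (((by fun_prop : Continuous fun t : ℝ => 1 + |t|).mul
      (Complex.continuous_re.comp h3)).aestronglyMeasurable) (ae_of_all _ fun t => ?_)
    rw [norm_mul, Real.norm_of_nonneg (by positivity : 0 ≤ 1 + |t|)]
    exact mul_le_mul_of_nonneg_left (Complex.abs_re_le_norm _) (by positivity)
  · simpa only [mul_assoc] using!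
      hasFirstMoment_expKernel.integrable_weight.mul_const ((1 : Matrix (Fin n) (Fin n) ℝ) j k)

theorem memLp_kernel (hη : ConcentratedOnNonneg η) (hmom : HasMoment η 2)
    (hdet : ∀ y : ℝ, (charFn η (Complex.I * (y : ℂ))).det ≠ 0)
    (j k : Fin n) : MemLp (fun t => ((kernel η t j k : ℝ) : ℂ)) 2 := by
  obtain ⟨h1, -⟩ := fourierInv_regularizedInverse hη hmom hdet j k
  rw [funext (ofReal_kernel hdet j k)]
  exact h1.add (memLp_expKernel.mul_const _)

theorem fourier_kernel (hη : ConcentratedOnNonneg η) (hmom : HasMoment η 2)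
    (hdet : ∀ y : ℝ, (charFn η (Complex.I * (y : ℂ))).det ≠ 0)
    (j k : Fin n) (w : ℝ) :
    𝓕 (fun t => ((kernel η t j k : ℝ) : ℂ)) w =
      (charFn η (Complex.I * ((-2 * Real.pi * w : ℝ) : ℂ)))⁻¹ j k := by
  obtain ⟨-, -, -, h4, h5⟩ := fourierInv_regularizedInverse hη hmom hdet j k
  have he : Integrable (fun t => (expKernel t : ℂ)) := hasFirstMoment_expKernel.integrable.ofReal
  rw [funext (ofReal_kernel hdet j k), fourier_eq_integral_cexp]
  simp only [mul_add]
  rw [integral_add (integrable_cexp_mul h4 _) (integrable_cexp_mul (he.mul_const _) _),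
    ← fourier_eq_integral_cexp, h5]
  simp only [← mul_assoc]
  rw [integral_mul_const, ← fourier_eq_integral_cexp, fourier_expKernel]
  simp [regularizedInverse]

theorem isKernel_kernel (hη : ConcentratedOnNonneg η) (hmom : HasMoment η 2)
    (hdet : ∀ y : ℝ, (charFn η (Complex.I * (y : ℂ))).det ≠ 0) :
    IsKernel η (kernel η) := by
  refine ⟨memLp_kernel hη hmom hdet, ?_⟩
  rw [ae_all_iff]
  intro j
  rw [ae_all_iff]
  intro k
  -- The substitution w = -y/(2π) carries null sets to null sets and turns the frequency -2πw into
  -- y.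
  have h := ae_comp_mul_left (fourier_toLp_ae_eq
    (hasFirstMoment_kernel hη hmom hdet j k).integrable.ofReal (memLp_kernel hη hmom hdet j k))
    (a := -(2 * Real.pi)⁻¹) (by simp [Real.pi_ne_zero])
  filter_upwards [h] with y hy
  have h1 := fourier_kernel hη hmom hdet j k (-(2 * Real.pi)⁻¹ * y)
  rw [show -2 * Real.pi * (-(2 * Real.pi)⁻¹ * y) = y by field_simp] at h1
  have h2 := hy.trans h1
  rw [show -(2 * Real.pi)⁻¹ * y = -y / (2 * Real.pi) by ring] at h2
  exact h2

/-- After the substitution y = -2πw the inverse transform is an integral along the imaginary axis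
that can be shifted to Re z = -∞. Invertibility of h on the whole closed left half plane is needed
to have no poles on the way. -/
theorem kernel_eq_zero_of_neg (hη : ConcentratedOnNonneg η)
    (hdet : ∀ z : ℂ, z.re ≤ 0 → (charFn η z).det ≠ 0) {t : ℝ} (ht : t < 0) : kernel η t = 0 := by
  obtain ⟨C, hC⟩ := exists_norm_regularizedInverse_le hη
    (S := {z | z.re ≤ 0}) (isClosed_le Complex.continuous_re continuous_const) (fun _ hz => hz) hdet
  ext j k
  have h := integral_exp_mul_eq_zero (continuousOn_regularizedInverse hη hdet j k)
    (differentiableOn_regularizedInverse hη hdet j k)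
    (fun z hz => (norm_entry_le _ j k).trans (hC z hz)) ht
  have h2 : ∀ w : ℝ, Complex.exp (-(Complex.I * ((-2 * Real.pi * w : ℝ) : ℂ) * t)) *
      regularizedInverse η (Complex.I * ((-2 * Real.pi * w : ℝ) : ℂ)) j k =
      (fun y : ℝ => Complex.exp (-(t * (y * Complex.I))) *
        regularizedInverse η (y * Complex.I) j k) (-2 * Real.pi * w) := by
    intro w
    simp only
    rw [mul_comm Complex.I]
    congr 2
    ring
  rw [kernel, expKernel_of_neg ht, fourierInv_eq_integral_cexp]
  simp only [h2]
  rw [Measure.integral_comp_mul_left (fun y : ℝ => Complex.exp (-(t * (y * Complex.I))) *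
        regularizedInverse η (y * Complex.I) j k), h]
  simp

/-- The L² Fourier transform is injective; rescaling the variable returns from y to the frequency w.
-/
theorem IsKernel.ae_eq {g g' : ℝ → Matrix (Fin n) (Fin n) ℝ} (h : IsKernel η g)
    (h' : IsKernel η g') : g =ᵐ[volume] g' := by
  obtain ⟨hg, hF⟩ := h
  obtain ⟨hg', hF'⟩ := h'
  have key : ∀ j k, (fun t => g t j k) =ᵐ[volume] fun t => g' t j k := by
    intro j k
    have h1 : ∀ᵐ y : ℝ, (𝓕 ((hg j k).toLp) : Lp ℂ 2 (volume : Measure ℝ)) (-y / (2 * Real.pi)) =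
        (𝓕 ((hg' j k).toLp) : Lp ℂ 2 (volume : Measure ℝ)) (-y / (2 * Real.pi)) := by
      filter_upwards [hF, hF'] with y hy hy'
      exact (hy j k).trans (hy' j k).symm
    have h2 : ∀ᵐ w : ℝ, (𝓕 ((hg j k).toLp) : Lp ℂ 2 (volume : Measure ℝ)) w =
        (𝓕 ((hg' j k).toLp) : Lp ℂ 2 (volume : Measure ℝ)) w := by
      have h := ae_comp_mul_left h1 (a := -(2 * Real.pi)) (by simp [Real.pi_ne_zero])
      filter_upwards [h] with w hw
      rwa [show -(-(2 * Real.pi) * w) / (2 * Real.pi) = w by field_simp] at hw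
    have h3 := (Lp.fourierTransformₗᵢ ℝ ℂ).injective (Lp.ext h2)
    have h4 := (MemLp.toLp_eq_toLp_iff _ _).1 h3
    filter_upwards [h4] with t ht
    exact_mod_cast ht
  have : ∀ᵐ t, ∀ j k, g t j k = g' t j k := by
    rw [ae_all_iff]
    intro j
    rw [ae_all_iff]
    exact key j
  filter_upwards [this] with t ht
  ext j k
  exact ht j k

end MSDDE
open scoped FourierTransform ENNReal ComplexConjugate

namespace MSDDE

/-! ### The Fourier transform of real functions -/

/-- The Fourier transform of a real function. -/
noncomputable def fourierReal (f : ℝ → ℝ) (w : ℝ) : ℂ := 𝓕 (fun x => (f x : ℂ)) w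

theorem fourierReal_add {f g : ℝ → ℝ} (hf : Integrable f) (hg : Integrable g) (w : ℝ) :
    fourierReal (fun x => f x + g x) w = fourierReal f w + fourierReal g w := by
  simp only [fourierReal, fourier_eq_integral_cexp, Complex.ofReal_add, mul_add]
  exact integral_add (integrable_cexp_mul hf.ofReal _) (integrable_cexp_mul hg.ofReal _)

theorem fourierReal_sub {f g : ℝ → ℝ} (hf : Integrable f) (hg : Integrable g) (w : ℝ) :
    fourierReal (fun x => f x - g x) w = fourierReal f w - fourierReal g w := by
  simp only [fourierReal, fourier_eq_integral_cexp, Complex.ofReal_sub, mul_sub]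
  exact integral_sub (integrable_cexp_mul hf.ofReal _) (integrable_cexp_mul hg.ofReal _)

theorem fourierReal_finset_sum {ι : Type*} (s : Finset ι) {f : ι → ℝ → ℝ}
    (hf : ∀ i ∈ s, Integrable (f i)) (w : ℝ) :
    fourierReal (fun x => ∑ i ∈ s, f i x) w = ∑ i ∈ s, fourierReal (f i) w := by
  simp only [fourierReal, fourier_eq_integral_cexp, Complex.ofReal_sum, Finset.mul_sum]
  exact integral_finsetSum _ fun i hi => integrable_cexp_mul (hf i hi).ofReal _

theorem fourierReal_mul_const (f : ℝ → ℝ) (c w : ℝ) :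
    fourierReal (fun x => f x * c) w = fourierReal f w * c := by
  simp only [fourierReal, fourier_eq_integral_cexp, Complex.ofReal_mul, ← mul_assoc]
  exact integral_mul_const _ _

theorem fourierReal_comp_add (f : ℝ → ℝ) (s w : ℝ) :
    fourierReal (fun x => f (s + x)) w =
      Complex.exp (-(Complex.I * ((-2 * Real.pi * w : ℝ) : ℂ) * s)) * fourierReal f w :=
  fourier_comp_add (fun x => (f x : ℂ)) s w

theorem fourierReal_sconv {f : ℝ → ℝ} (hf : Integrable f) (μ : SignedMeasure ℝ) (w : ℝ) :
    fourierReal (sconv μ f) w = fourierReal f w *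
      sintegral μ fun v => Complex.exp (Complex.I * ((-2 * Real.pi * w : ℝ) : ℂ) * v) := by
  rw [fourierReal, funext (sconv_ofReal μ f)]
  exact fourier_sconv hf.ofReal μ w

theorem fourierReal_setIntegral_comp_add {f : ℝ → ℝ} (hf : Integrable f) (s t w : ℝ) :
    fourierReal (fun x => ∫ u in Set.Ioc s t, f (u + x)) w =
      (∫ u in Set.Ioc s t, Complex.exp (-(Complex.I * ((-2 * Real.pi * w : ℝ) : ℂ) * u))) *
        fourierReal f w := by
  simp only [fourierReal, ← integral_complex_ofReal]
  exact fourier_setIntegral_comp_add hf.ofReal s t w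

theorem integrable_setIntegral_comp_add_real {f : ℝ → ℝ} (hf : Integrable f) (s t : ℝ) :
    Integrable fun x => ∫ u in Set.Ioc s t, f (u + x) := by
  have := (integrable_setIntegral_comp_add hf.ofReal s t).integral_prod_left.re
  refine this.congr (ae_of_all _ fun x => ?_)
  change (∫ u in Set.Ioc s t, ((f (u + x) : ℝ) : ℂ)).re = _
  rw [integral_complex_ofReal, Complex.ofReal_re]

theorem fourierReal_zero_eq (f : ℝ → ℝ) : fourierReal f 0 = ((∫ x, f x : ℝ) : ℂ) := by
  rw [fourierReal, fourier_eq_integral_cexp, ← integral_complex_ofReal]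
  simp

/-- The indicator function of `{x | -x ∈ (s, t]}`. -/
noncomputable def negIndicator (s t x : ℝ) : ℝ := (Set.Ioc s t).indicator (fun _ => (1 : ℝ)) (-x)

theorem hasFirstMoment_negIndicator (s t : ℝ) : HasFirstMoment (negIndicator s t) := by
  have hm : Measurable (negIndicator s t) :=
    (measurable_const.indicator measurableSet_Ioc).comp measurable_neg
  refine ⟨hm, ?_⟩
  have h1 : IntegrableOn (fun x : ℝ => 1 + |x|) (Set.Icc s t) :=
    (Continuous.continuousOn (by fun_prop)).integrableOn_compact isCompact_Icc
  have h2 := ((integrable_indicator_iff measurableSet_Ioc).2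
    (h1.mono_set Set.Ioc_subset_Icc_self)).comp_neg
  refine h2.congr (ae_of_all _ fun x => ?_)
  by_cases hx : -x ∈ Set.Ioc s t
  · simp only [negIndicator, Set.indicator_of_mem hx, abs_neg, mul_one]
  · simp only [negIndicator, Set.indicator_of_notMem hx, mul_zero]

theorem fourierReal_negIndicator (s t w : ℝ) :
    fourierReal (negIndicator s t) w =
      ∫ u in Set.Ioc s t, Complex.exp (-(Complex.I * ((-2 * Real.pi * w : ℝ) : ℂ) * u)) :=
  fourier_indicator_neg s t w

/-! ### The convolution of the kernel with the delay measure -/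

variable {n : ℕ} {η : MatrixMeasure n}

theorem conv_eq_sum_sconv (g : ℝ → Matrix (Fin n) (Fin n) ℝ) (η : MatrixMeasure n) (t : ℝ)
    (j k : Fin n) : conv g η t j k = ∑ l, sconv (η l k) (fun x => g x j l) t := rfl

theorem convDefinedAt_ae {g : ℝ → Matrix (Fin n) (Fin n) ℝ}
    (hg : ∀ j k, Integrable fun t => g t j k) (η : MatrixMeasure n) :
    ∀ᵐ t : ℝ, ConvDefinedAt g η t := by
  simp only [ConvDefinedAt, ae_all_iff]
  exact fun j l k => ae_integrable_comp_sub (hg j l) _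

theorem conv_congr_ae {g g' : ℝ → Matrix (Fin n) (Fin n) ℝ} (h : g =ᵐ[volume] g')
    (η : MatrixMeasure n) : conv g η =ᵐ[volume] conv g' η := by
  have h1 : ∀ᵐ t : ℝ, ∀ j l k, sconv (η l k) (fun x => g x j l) t =
      sconv (η l k) (fun x => g' x j l) t := by
    simp only [ae_all_iff]
    intro j l k
    refine sconv_congr_ae ?_ _
    filter_upwards [h] with x hx
    rw [hx]
  filter_upwards [h1] with t ht
  ext j k
  simp only [conv_eq_sum_sconv, ht]

/-- The convolution `kernel η ∗ η`. -/
noncomputable def kernelConv (η : MatrixMeasure n) : ℝ → Matrix (Fin n) (Fin n) ℝ :=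
  conv (kernel η) η

theorem hasFirstMoment_kernelConv (hη : ConcentratedOnNonneg η) (hmom : HasMoment η 2)
    (hdet : ∀ y : ℝ, (charFn η (Complex.I * (y : ℂ))).det ≠ 0) (j k : Fin n) :
    HasFirstMoment fun t => kernelConv η t j k :=
  HasFirstMoment.finset_sum (s := Finset.univ)
    (f := fun l => sconv (η l k) fun x => kernel η x j l) fun l _ =>
    (hasFirstMoment_kernel hη hmom hdet j l).sconv (hmom.integrable_abs l k)

theorem charFn_inv_mul_laplace {z : ℂ} (hdet : (charFn η z).det ≠ 0) :
    (charFn η z)⁻¹ * laplace η z = -(1 + z • (charFn η z)⁻¹) := by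
  have h := Matrix.nonsing_inv_mul (charFn η z) (isUnit_iff_ne_zero.2 hdet)
  nth_rewrite 2 [charFn] at h
  rw [mul_sub, mul_neg, mul_smul_comm, mul_one] at h
  rw [← h]
  abel

/-- Together with `charFn_inv_mul_laplace` this shows that L and h⁻¹ commute. Hence g ∗ η, formed
with η on the right, also satisfies an equation with η acting from the left. -/
theorem laplace_mul_charFn_inv {z : ℂ} (hdet : (charFn η z).det ≠ 0) :
    laplace η z * (charFn η z)⁻¹ = -(1 + z • (charFn η z)⁻¹) := by
  have h := Matrix.mul_nonsing_inv (charFn η z) (isUnit_iff_ne_zero.2 hdet)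
  nth_rewrite 1 [charFn] at h
  rw [sub_mul, neg_mul, smul_mul_assoc, one_mul] at h
  rw [← h]
  abel

theorem fourierReal_kernelConv (hη : ConcentratedOnNonneg η) (hmom : HasMoment η 2)
    (hdet : ∀ y : ℝ, (charFn η (Complex.I * (y : ℂ))).det ≠ 0) (j k : Fin n) (w : ℝ) :
    fourierReal (fun t => kernelConv η t j k) w =
      ((charFn η (Complex.I * ((-2 * Real.pi * w : ℝ) : ℂ)))⁻¹ *
        laplace η (Complex.I * ((-2 * Real.pi * w : ℝ) : ℂ))) j k := by
  have hi : ∀ l, Integrable fun t => kernel η t j l := fun l =>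
    (hasFirstMoment_kernel hη hmom hdet j l).integrable
  simp only [kernelConv, conv_eq_sum_sconv]
  rw [fourierReal_finset_sum _ fun l _ => integrable_sconv (hi l) _, Matrix.mul_apply]
  refine Finset.sum_congr rfl fun l _ => ?_
  rw [fourierReal_sconv (hi l), fourierReal, fourier_kernel hη hmom hdet]
  rfl

/-- The integral is the transform at z = 0, where -(1 + z h⁻¹) equals -1. Consequently Z + A ∗ Z can
be rewritten in terms of increments of Z alone. -/
theorem integral_kernelConv (hη : ConcentratedOnNonneg η) (hmom : HasMoment η 2)
    (hdet : ∀ y : ℝ, (charFn η (Complex.I * (y : ℂ))).det ≠ 0) (j k : Fin n) :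
    ∫ t, kernelConv η t j k = -(1 : Matrix (Fin n) (Fin n) ℝ) j k := by
  have h := fourierReal_kernelConv hη hmom hdet j k 0
  rw [fourierReal_zero_eq, charFn_inv_mul_laplace (hdet _)] at h
  have h1 : ((∫ t, kernelConv η t j k : ℝ) : ℂ) =
      ((-(1 : Matrix (Fin n) (Fin n) ℝ) j k : ℝ) : ℂ) := by
    rw [h]
    by_cases hjk : j = k
    · subst hjk
      simp
    · simp [hjk]
  exact_mod_cast h1

/-- The kernel solves `dg = g ∗ η dt + δ₀ I`. -/
theorem kernel_sub_ae_eq (hη : ConcentratedOnNonneg η) (hmom : HasMoment η 2)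
    (hdet : ∀ y : ℝ, (charFn η (Complex.I * (y : ℂ))).det ≠ 0) {s t : ℝ} (hst : s ≤ t)
    (j k : Fin n) :
    (fun x => kernel η (t + x) j k - kernel η (s + x) j k) =ᵐ[volume] fun x =>
      negIndicator s t x * (1 : Matrix (Fin n) (Fin n) ℝ) j k +
        ∫ u in Set.Ioc s t, kernelConv η (u + x) j k := by
  have hK := (hasFirstMoment_kernel hη hmom hdet j k).integrable
  have hA := (hasFirstMoment_kernelConv hη hmom hdet j k).integrable
  have hI := (hasFirstMoment_negIndicator s t).integrable
  refine ae_eq_of_fourier_ofReal_eq ((hK.comp_add_left t).sub (hK.comp_add_left s))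
    ((hI.mul_const _).add (integrable_setIntegral_comp_add_real hA s t)) fun w => ?_
  change fourierReal _ w = fourierReal _ w
  rw [fourierReal_sub (hK.comp_add_left t) (hK.comp_add_left s),
    fourierReal_add (hI.mul_const _) (integrable_setIntegral_comp_add_real hA s t),
    fourierReal_comp_add (fun x => kernel η x j k), fourierReal_comp_add (fun x => kernel η x j k),
    fourierReal_mul_const, fourierReal_negIndicator,
    fourierReal_setIntegral_comp_add hA, fourierReal_kernelConv hη hmom hdet,
    charFn_inv_mul_laplace (hdet _), fourierReal, fourier_kernel hη hmom hdet]
  set z := Complex.I * ((-2 * Real.pi * w : ℝ) : ℂ)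
  have h1 : (((1 : Matrix (Fin n) (Fin n) ℝ) j k : ℝ) : ℂ) =
      (1 : Matrix (Fin n) (Fin n) ℂ) j k := by
    by_cases hjk : j = k
    · subst hjk
      simp
    · simp [hjk]
  have h2 := mul_setIntegral_cexp hst z
  simp only [Matrix.neg_apply, Matrix.add_apply, Matrix.smul_apply, smul_eq_mul, h1]
  -- On the transform side the claim reads (e^{-zt} - e^{-zs}) h⁻¹ = κ (1 - (1 + z h⁻¹)), with κ the
  -- transform of the reflected interval, and zκ = e^{-zs} - e^{-zt}.
  linear_combination (charFn η z)⁻¹ j k * h2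

/-- The convolution `A` of the kernel with `η` solves `dA = η ∗ A dt + η(dt)`. -/
theorem kernelConv_sub_ae_eq (hη : ConcentratedOnNonneg η) (hmom : HasMoment η 2)
    (hdet : ∀ y : ℝ, (charFn η (Complex.I * (y : ℂ))).det ≠ 0) {s t : ℝ} (hst : s ≤ t)
    (j k : Fin n) :
    (fun x => kernelConv η (t + x) j k - kernelConv η (s + x) j k) =ᵐ[volume] fun x =>
      sconv (η j k) (negIndicator s t) x +
        ∑ l, ∫ u in Set.Ioc s t, sconv (η j l) (fun y => kernelConv η y l k) (u + x) := by
  have hA : ∀ j k, Integrable fun t => kernelConv η t j k := fun j k =>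
    (hasFirstMoment_kernelConv hη hmom hdet j k).integrable
  have hI := (hasFirstMoment_negIndicator s t).integrable
  have hB : ∀ l, Integrable (sconv (η j l) fun y => kernelConv η y l k) := fun l =>
    integrable_sconv (hA l k) _
  have hB' : ∀ l, Integrable fun x =>
      ∫ u in Set.Ioc s t, sconv (η j l) (fun y => kernelConv η y l k) (u + x) := fun l =>
    integrable_setIntegral_comp_add_real (hB l) s t
  refine ae_eq_of_fourier_ofReal_eq (((hA j k).comp_add_left t).sub ((hA j k).comp_add_left s))
    ((integrable_sconv hI _).add (integrable_finsetSum _ fun l _ => hB' l)) fun w => ?_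
  change fourierReal _ w = fourierReal _ w
  rw [fourierReal_sub ((hA j k).comp_add_left t) ((hA j k).comp_add_left s),
    fourierReal_add (integrable_sconv hI _) (integrable_finsetSum _ fun l _ => hB' l),
    fourierReal_comp_add (fun x => kernelConv η x j k),
    fourierReal_comp_add (fun x => kernelConv η x j k),
    fourierReal_sconv hI, fourierReal_negIndicator,
    fourierReal_finset_sum _ fun l _ => hB' l, fourierReal_kernelConv hη hmom hdet]
  have h3 : ∀ l, fourierReal (fun x =>
      ∫ u in Set.Ioc s t, sconv (η j l) (fun y => kernelConv η y l k) (u + x)) w =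
      (∫ u in Set.Ioc s t, Complex.exp (-(Complex.I * ((-2 * Real.pi * w : ℝ) : ℂ) * u))) *
      (laplace η (Complex.I * ((-2 * Real.pi * w : ℝ) : ℂ)) j l *
      ((charFn η (Complex.I * ((-2 * Real.pi * w : ℝ) : ℂ)))⁻¹ *
        laplace η (Complex.I * ((-2 * Real.pi * w : ℝ) : ℂ))) l k) := by
    intro l
    rw [fourierReal_setIntegral_comp_add (hB l), fourierReal_sconv (hA l k),
      fourierReal_kernelConv hη hmom hdet]
    congr 1
    exact mul_comm _ _
  simp only [h3]
  set z := Complex.I * ((-2 * Real.pi * w : ℝ) : ℂ)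
  rw [← Finset.mul_sum, ← Matrix.mul_apply]
  -- The jump term L and the delay term L h⁻¹ L combine to -z h⁻¹ L, after which the phase identity
  -- for the interval finishes the comparison.
  have h4 : laplace η z + laplace η z * ((charFn η z)⁻¹ * laplace η z) =
      -(z • ((charFn η z)⁻¹ * laplace η z)) := by
    rw [← mul_assoc, laplace_mul_charFn_inv (hdet _), neg_mul, add_mul, one_mul, smul_mul_assoc]
    abel
  have h5 := congrFun (congrFun h4 j) k
  simp only [Matrix.neg_apply, Matrix.add_apply, Matrix.smul_apply, smul_eq_mul] at h5
  have h2 := mul_setIntegral_cexp hst z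
  change _ = (∫ u in Set.Ioc s t, Complex.exp (-(z * u))) * laplace η z j k + _
  linear_combination ((charFn η z)⁻¹ * laplace η z) j k * h2 -
    (∫ u in Set.Ioc s t, Complex.exp (-(z * u))) * h5

theorem kernelConv_eq_zero_of_neg (hη : ConcentratedOnNonneg η)
    (hdet : ∀ z : ℂ, z.re ≤ 0 → (charFn η z).det ≠ 0) {t : ℝ} (ht : t < 0) (j k : Fin n) :
    kernelConv η t j k = 0 := by
  rw [kernelConv, conv_eq_sum_sconv]
  refine Finset.sum_eq_zero fun l _ => ?_
  rw [sconv, ← sintegral_zero (μ := η l k)]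
  refine sintegral_congr_ae ?_
  filter_upwards [hη.ae_nonneg l k] with v hv
  rw [kernel_eq_zero_of_neg hη hdet (by linarith)]
  rfl

end MSDDE
open scoped ENNReal

namespace MSDDE

/-! ### Linear growth -/

/-- Some sublevel set has positive measure, so by Steinhaus its difference set contains a
neighbourhood of zero; evenness and subadditivity bound f there. A general t is split into about
|t|/ε equal steps of length below ε. -/
theorem exists_linear_bound_of_subadditive {f : ℝ → ℝ} (hm : Measurable f) (h0 : ∀ t, 0 ≤ f t)
    (hsub : ∀ s t, f (s + t) ≤ f s + f t) (heven : ∀ t, f (-t) = f t) :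
    ∃ C, ∀ t, f t ≤ C * (1 + |t|) := by
  obtain ⟨M, hM⟩ : ∃ M : ℕ, 0 < volume {t | f t ≤ M} := by
    by_contra h
    push Not at h
    have hU : (Set.univ : Set ℝ) = ⋃ M : ℕ, {t | f t ≤ M} := by
      ext t
      simpa using exists_nat_ge (f t)
    have h1 : volume (⋃ M : ℕ, {t | f t ≤ M}) = 0 :=
      measure_iUnion_null fun M => le_antisymm (h M) zero_le
    rw [← hU] at h1
    simp at h1
  have hS := Measure.sub_mem_nhds_zero_of_addHaar_pos volume _
    (measurableSet_le hm measurable_const) hM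
  obtain ⟨ε, hε, hball⟩ := Metric.mem_nhds_iff.1 hS
  have hsmall : ∀ t, |t| < ε → f t ≤ 2 * M := by
    intro t ht
    obtain ⟨x, hx, y, hy, rfl⟩ := hball (show t ∈ Metric.ball 0 ε by simpa using ht)
    have h1 := hsub x (-y)
    rw [heven, ← sub_eq_add_neg] at h1
    have hx' : f x ≤ M := hx
    have hy' : f y ≤ M := hy
    linarith
  have hmul : ∀ (N : ℕ) (t : ℝ), f ((N + 1 : ℕ) * t) ≤ (N + 1 : ℕ) * f t := by
    intro N t
    induction N with
    | zero => simp
    | succ N ih =>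
      have h1 := hsub ((N + 1 : ℕ) * t) t
      have e : ((N + 1 + 1 : ℕ) : ℝ) * t = (N + 1 : ℕ) * t + t := by push_cast; ring
      rw [e]
      push_cast at *
      linarith
  refine ⟨(1 + 1 / ε) * (2 * M), fun t => ?_⟩
  -- N + 1 steps, not N, make the step length strictly smaller than ε and avoid division by zero.
  let N : ℕ := ⌊|t| / ε⌋₊
  have hN1 : |t| / ε < N + 1 := Nat.lt_floor_add_one _
  have hN2 : (N : ℝ) ≤ |t| / ε := Nat.floor_le (by positivity)
  have hN0 : (0 : ℝ) < (N + 1 : ℕ) := by positivity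
  have h1 := hmul N (t / (N + 1 : ℕ))
  rw [mul_div_cancel₀ _ hN0.ne'] at h1
  have h2 : |t / (N + 1 : ℕ)| < ε := by
    rw [abs_div, abs_of_pos hN0, div_lt_iff₀ hN0]
    rw [div_lt_iff₀ hε] at hN1
    push_cast
    linarith
  have h3 := hsmall _ h2
  have h4 : ((N + 1 : ℕ) : ℝ) ≤ (1 + 1 / ε) * (1 + |t|) := by
    have e : (1 + 1 / ε) * (1 + |t|) = 1 + |t| / ε + (|t| + 1 / ε) := by ring
    rw [e]
    push_cast
    have : 0 ≤ |t| + 1 / ε := by positivity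
    linarith
  calc f t ≤ (N + 1 : ℕ) * f (t / (N + 1 : ℕ)) := h1
    _ ≤ ((1 + 1 / ε) * (1 + |t|)) * (2 * M) := mul_le_mul h4 h3 (h0 _) (by positivity)
    _ = _ := by ring

variable {Ω : Type*} [MeasurableSpace Ω] {P : Measure Ω}

/-- A real measurable process whose first absolute moment grows at most linearly. -/
structure HasLinearGrowth (Y : ℝ → Ω → ℝ) (P : Measure Ω) : Prop where
  measurable : Measurable (Function.uncurry Y)
  integrable : ∀ t, Integrable (Y t) P
  growth : ∃ C, ∀ t, ∫ ω, |Y t ω| ∂P ≤ C * (1 + |t|)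

variable {n : ℕ}

/-- Stationarity of the increments makes t ↦ E‖Z_t - Z_0‖ subadditive and even; joint measurability
of Z makes it measurable. No path regularity is needed. -/
theorem exists_linear_bound_of_stationaryIncrements [IsProbabilityMeasure P]
    {Z : ℝ → Ω → Fin n → ℝ} (hm : IsMeasurableProcess Z) (hi : IsIntegrableProcess Z P)
    (hs : HasStationaryIncrements Z P) : ∃ C, ∀ t, ∫ ω, ‖Z t ω‖ ∂P ≤ C * (1 + |t|) := by
  let f : ℝ → ℝ := fun t => ∫ ω, ‖Z t ω - Z 0 ω‖ ∂P
  have hinc : ∀ r t, ∫ ω, ‖Z (t + r) ω - Z r ω‖ ∂P = f t := by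
    intro r t
    have h := (hs r 1 fun _ => t).comp (u := fun y : Fin 1 → Fin n → ℝ => ‖y 0‖)
      ((measurable_pi_apply 0).norm)
    exact h.integral_eq
  have hfm : Measurable f := by
    have h1 : Measurable fun p : ℝ × Ω => ‖Z p.1 p.2 - Z 0 p.2‖ :=
      (hm.sub (hm.comp (measurable_const.prodMk measurable_snd))).norm
    exact (h1.stronglyMeasurable.integral_prod_right (f := fun t ω => ‖Z t ω - Z 0 ω‖)).measurable
  have hd : ∀ r t, Integrable (fun ω => ‖Z t ω - Z r ω‖) P := fun r t =>
    ((hi t).sub (hi r)).norm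
  obtain ⟨C, hC⟩ := exists_linear_bound_of_subadditive hfm
    (fun t => integral_nonneg fun ω => norm_nonneg _) (fun s t => by
      rw [← hinc s t, add_comm (f s)]
      have h1 : f (s + t) ≤ ∫ ω, (‖Z (t + s) ω - Z s ω‖ + ‖Z s ω - Z 0 ω‖) ∂P := by
        refine integral_mono (hd _ _) ((hd _ _).add (hd _ _)) fun ω => ?_
        simp only
        rw [add_comm s t]
        calc ‖Z (t + s) ω - Z 0 ω‖ = ‖(Z (t + s) ω - Z s ω) + (Z s ω - Z 0 ω)‖ := by
              congr 1
              abel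
          _ ≤ _ := norm_add_le _ _
      rw [integral_add (hd _ _) (hd _ _)] at h1
      exact h1) (fun t => by
      rw [← hinc t (-t)]
      simp only [neg_add_cancel, f]
      exact integral_congr_ae (ae_of_all _ fun ω => norm_sub_rev _ _))
  refine ⟨C + ∫ ω, ‖Z 0 ω‖ ∂P, fun t => ?_⟩
  have h1 : ∫ ω, ‖Z t ω‖ ∂P ≤ ∫ ω, (‖Z t ω - Z 0 ω‖ + ‖Z 0 ω‖) ∂P := by
    refine integral_mono (hi _).norm ((hd _ _).add (hi _).norm) fun ω => ?_
    simpa using norm_add_le (Z t ω - Z 0 ω) (Z 0 ω)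
  rw [integral_add (hd _ _) (hi _).norm] at h1
  have h2 := hC t
  have h3 : 0 ≤ (∫ ω, ‖Z 0 ω‖ ∂P) * |t| :=
    mul_nonneg (integral_nonneg fun _ => norm_nonneg _) (abs_nonneg t)
  simp only [f] at h2
  nlinarith

theorem hasLinearGrowth_component {Z : ℝ → Ω → Fin n → ℝ} (hm : IsMeasurableProcess Z)
    (hi : IsIntegrableProcess Z P) (hb : ∃ C, ∀ t, ∫ ω, ‖Z t ω‖ ∂P ≤ C * (1 + |t|)) (k : Fin n) :
    HasLinearGrowth (fun t ω => Z t ω k) P := by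
  obtain ⟨C, hC⟩ := hb
  have hk : ∀ t, Integrable (fun ω => Z t ω k) P := fun t => (hi t).eval k
  exact ⟨(measurable_pi_apply k).comp hm, hk, C, fun t =>
    (integral_mono (hk t).abs (hi t).norm fun ω => norm_le_pi_norm (Z t ω) k).trans (hC t)⟩

theorem HasLinearGrowth.add {Y Y' : ℝ → Ω → ℝ} (h : HasLinearGrowth Y P)
    (h' : HasLinearGrowth Y' P) : HasLinearGrowth (fun t ω => Y t ω + Y' t ω) P := by
  obtain ⟨C, hC⟩ := h.growth
  obtain ⟨C', hC'⟩ := h'.growth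
  refine ⟨h.measurable.add h'.measurable, fun t => (h.integrable t).add (h'.integrable t),
    C + C', fun t => ?_⟩
  calc ∫ ω, |Y t ω + Y' t ω| ∂P ≤ ∫ ω, (|Y t ω| + |Y' t ω|) ∂P :=
        integral_mono ((h.integrable t).add (h'.integrable t)).abs
          ((h.integrable t).abs.add (h'.integrable t).abs) fun ω => abs_add_le _ _
    _ = ∫ ω, |Y t ω| ∂P + ∫ ω, |Y' t ω| ∂P :=
        integral_add (h.integrable t).abs (h'.integrable t).abs
    _ ≤ _ := by linarith [hC t, hC' t]

theorem HasLinearGrowth.neg {Y : ℝ → Ω → ℝ} (h : HasLinearGrowth Y P) :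
    HasLinearGrowth (fun t ω => -Y t ω) P :=
  ⟨h.measurable.neg, fun t => (h.integrable t).neg, by simpa using h.growth⟩

theorem HasLinearGrowth.zero : HasLinearGrowth (fun _ _ => 0) P :=
  ⟨measurable_const, fun _ => integrable_zero _ _ _, 0, by simp⟩

theorem HasLinearGrowth.finset_sum {ι : Type*} {s : Finset ι} {Y : ι → ℝ → Ω → ℝ}
    (h : ∀ i ∈ s, HasLinearGrowth (Y i) P) : HasLinearGrowth (fun t ω => ∑ i ∈ s, Y i t ω) P := by
  classical
  induction s using Finset.induction_on with
  | empty => simpa using HasLinearGrowth.zero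
  | insert a s ha ih =>
    simp only [Finset.sum_insert ha]
    exact (h a (by simp)).add (ih fun i hi => h i (by simp [hi]))

section Integrability

variable {α : Type*} [MeasurableSpace α] {κ : Measure α} [SFinite P]
  {Y : ℝ → Ω → ℝ} {f T : α → ℝ}

/-- By Tonelli, joint integrability reduces to a deterministic condition with the weight 1 + |T|.
Almost sure integrability along paths is deduced from this. -/
theorem HasLinearGrowth.integrable_prod (hY : HasLinearGrowth Y P) (hf : Measurable f)
    (hT : Measurable T) (hfT : Integrable (fun a => (1 + |T a|) * f a) κ) :
    Integrable (fun p : α × Ω => f p.1 * Y (T p.1) p.2) (κ.prod P) := by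
  obtain ⟨C, hC⟩ := hY.growth
  have hm : Measurable fun p : α × Ω => f p.1 * Y (T p.1) p.2 :=
    (hf.comp measurable_fst).mul
      (hY.measurable.comp ((hT.comp measurable_fst).prodMk measurable_snd))
  rw [integrable_prod_iff hm.aestronglyMeasurable]
  refine ⟨ae_of_all _ fun a => (hY.integrable (T a)).const_mul (f a), ?_⟩
  refine (hfT.norm.const_mul C).mono'
    (hm.norm.stronglyMeasurable.integral_prod_right
      (f := fun a ω => ‖f a * Y (T a) ω‖)).aestronglyMeasurable (ae_of_all _ fun a => ?_)
  simp only [norm_mul]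
  rw [integral_const_mul, Real.norm_of_nonneg
    (mul_nonneg (norm_nonneg _) (integral_nonneg fun _ => norm_nonneg _))]
  have h1 := mul_le_mul_of_nonneg_left (hC (T a)) (norm_nonneg (f a))
  rw [Real.norm_of_nonneg (by positivity : 0 ≤ 1 + |T a|)]
  calc _ ≤ _ := h1
    _ = _ := by ring

theorem HasLinearGrowth.ae_integrable [SFinite κ] (hY : HasLinearGrowth Y P) (hf : Measurable f)
    (hT : Measurable T) (hfT : Integrable (fun a => (1 + |T a|) * f a) κ) :
    ∀ᵐ ω ∂P, Integrable (fun a => f a * Y (T a) ω) κ :=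
  (hY.integrable_prod hf hT hfT).prod_left_ae

end Integrability

theorem HasFirstMoment.integrable_comp_sub {a : ℝ → ℝ} (ha : HasFirstMoment a) (t : ℝ) :
    Integrable fun x => (1 + |t - x|) * a x := by
  have hm := ha.measurable
  refine (ha.integrable_weight.const_mul (1 + |t|)).mono (by fun_prop) (ae_of_all _ fun x => ?_)
  have h1 := one_add_abs_le_mul t (-x)
  rw [abs_neg, ← sub_eq_add_neg] at h1
  rw [norm_mul, norm_mul, norm_mul, Real.norm_of_nonneg (by positivity : 0 ≤ 1 + |t - x|),
    Real.norm_of_nonneg (by positivity : 0 ≤ 1 + |t|),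
    Real.norm_of_nonneg (by positivity : 0 ≤ 1 + |x|), ← mul_assoc]
  exact mul_le_mul_of_nonneg_right h1 (norm_nonneg _)

theorem HasLinearGrowth.convolution [SFinite P] {Y : ℝ → Ω → ℝ} (hY : HasLinearGrowth Y P)
    {a : ℝ → ℝ} (ha : HasFirstMoment a) :
    HasLinearGrowth (fun t ω => ∫ x, a x * Y (t - x) ω) P := by
  obtain ⟨C, hC⟩ := hY.growth
  have hm := ha.measurable
  have hp : ∀ t, Integrable (fun p : ℝ × Ω => a p.1 * Y (t - p.1) p.2) (volume.prod P) :=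
    fun t => hY.integrable_prod hm (by fun_prop) (ha.integrable_comp_sub t)
  refine ⟨?_, fun t => (hp t).integral_prod_right, C * ∫ x, (1 + |x|) * |a x|, fun t => ?_⟩
  · have h1 : Measurable fun q : (ℝ × Ω) × ℝ => a q.2 * Y (q.1.1 - q.2) q.1.2 :=
      (hm.comp measurable_snd).mul (hY.measurable.comp (by fun_prop : Measurable
        fun q : (ℝ × Ω) × ℝ => (q.1.1 - q.2, q.1.2)))
    exact (h1.stronglyMeasurable.integral_prod_right
      (f := fun (q : ℝ × Ω) (x : ℝ) => a x * Y (q.1 - x) q.2)).measurable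
  · have hw : Integrable fun x => (1 + |x|) * |a x| :=
      ha.integrable_weight.norm.congr (ae_of_all _ fun x => by
        simp only [norm_mul, Real.norm_eq_abs]
        rw [abs_of_nonneg (by positivity : 0 ≤ 1 + |x|)])
    have hn := (hp t).norm
    calc ∫ ω, |∫ x, a x * Y (t - x) ω| ∂P
        ≤ ∫ ω, (∫ x, ‖a x * Y (t - x) ω‖) ∂P :=
          integral_mono (hp t).integral_prod_right.abs hn.integral_prod_right
            fun ω => norm_integral_le_integral_norm fun x => a x * Y (t - x) ω
      _ = ∫ x, ∫ ω, ‖a x * Y (t - x) ω‖ ∂P :=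
          (integral_integral_swap (f := fun x ω => ‖a x * Y (t - x) ω‖) hn).symm
      _ ≤ ∫ x, C * (1 + |t|) * ((1 + |x|) * |a x|) := by
          refine integral_mono hn.integral_prod_left (hw.const_mul _) fun x => ?_
          simp only [norm_mul, Real.norm_eq_abs]
          rw [integral_const_mul]
          have h1 := hC (t - x)
          have h2 := one_add_abs_le_mul t (-x)
          rw [abs_neg, ← sub_eq_add_neg] at h2
          have hCnn : 0 ≤ C := by
            have := (integral_nonneg fun ω => abs_nonneg (Y 0 ω)).trans (hC 0)
            simpa using this
          calc |a x| * ∫ ω, |Y (t - x) ω| ∂P ≤ |a x| * (C * ((1 + |t|) * (1 + |x|))) := by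
                gcongr
                exact h1.trans (mul_le_mul_of_nonneg_left h2 hCnn)
            _ = _ := by ring
      _ = _ := by
          rw [integral_const_mul]
          ring

/-! ### Fubini identities along a path -/

section Path

variable {μ : SignedMeasure ℝ} {a y : ℝ → ℝ}

/-- Associativity, (μ ∗ a) ∗ y = μ ∗ (a ∗ y) at u. The shear converts the hypothesis, adapted to the
right side, into integrability for the left side. -/
theorem integral_sconv_mul_eq_sintegral {u : ℝ}
    (h : Integrable (fun p : ℝ × ℝ => a p.1 * y (u - p.2 - p.1))
      (volume.prod μ.totalVariation)) :
    ∫ x, sconv μ a x * y (u - x) = sintegral μ fun v => ∫ x, a x * y (u - v - x) := by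
  have h1 := (measurePreserving_shear μ.totalVariation).integrable_comp_of_integrable h
  have h2 : Integrable (Function.uncurry fun x v => y (u - x) * a (x - v))
      (volume.prod μ.totalVariation) := by
    refine h1.congr (ae_of_all _ fun p => ?_)
    simp only [Function.comp_apply, Function.uncurry]
    rw [mul_comm]
    congr 2
    ring
  calc ∫ x, sconv μ a x * y (u - x) = ∫ x, sintegral μ fun v => y (u - x) * a (x - v) := by
        refine integral_congr_ae (ae_of_all _ fun x => ?_)
        simp only [sconv, sintegral_const_mul]
        ring
    _ = sintegral μ fun v => ∫ x, y (u - x) * a (x - v) := integral_sintegral_swap h2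
    _ = _ := by
        congr 1
        ext v
        rw [← integral_sub_right_eq_self (fun x => a x * y (u - v - x)) v]
        refine integral_congr_ae (ae_of_all _ fun x => ?_)
        simp only
        rw [mul_comm]
        congr 2
        ring

theorem integral_mul_sintegral_eq_sintegral {u : ℝ}
    (h : Integrable (fun p : ℝ × ℝ => a p.1 * y (u - p.2 - p.1))
      (volume.prod μ.totalVariation)) :
    ∫ x, a x * sintegral μ (fun v => y (u - v - x)) =
      sintegral μ fun v => ∫ x, a x * y (u - v - x) := by
  rw [← integral_sintegral_swap (F := fun x v => a x * y (u - v - x)) h]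
  simp only [sintegral_const_mul]

theorem integrable_prod_convolution {s t : ℝ}
    (h : Integrable (fun p : ℝ × ℝ => a p.2 * y (p.1 - p.2))
      ((volume.restrict (Set.Ioc s t)).prod volume)) :
    Integrable (Function.uncurry fun u r => a (u - r) * y r)
      ((volume.restrict (Set.Ioc s t)).prod volume) := by
  have hmp : MeasurePreserving (fun p : ℝ × ℝ => (p.1, p.1 - p.2))
      ((volume.restrict (Set.Ioc s t)).prod volume)
      ((volume.restrict (Set.Ioc s t)).prod volume) :=
    (MeasurePreserving.id _).skew_product (g := fun v x => v - x) (by fun_prop)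
      (ae_of_all _ fun v => (Measure.measurePreserving_sub_left volume v).map_eq)
  refine (hmp.integrable_comp_of_integrable h).congr (ae_of_all _ fun p => ?_)
  simp [Function.uncurry]

/-- Integrating a ∗ y over (s, t] is the same as pairing y with ∫_s^t a(u - r) du, the shape in
which the integrated equations of the kernels appear. -/
theorem integral_prod_convolution {s t : ℝ}
    (h : Integrable (fun p : ℝ × ℝ => a p.2 * y (p.1 - p.2))
      ((volume.restrict (Set.Ioc s t)).prod volume)) :
    ∫ p, a p.2 * y (p.1 - p.2) ∂((volume.restrict (Set.Ioc s t)).prod volume) =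
      ∫ r, (∫ u in Set.Ioc s t, a (u - r)) * y r := by
  rw [integral_prod _ h]
  simp only [← integral_mul_const]
  rw [← integral_integral_swap (integrable_prod_convolution h)]
  refine integral_congr_ae (ae_of_all _ fun u => ?_)
  simp only
  rw [← integral_sub_left_eq_self (fun x => a x * y (u - x)) volume u]
  simp

theorem integrable_setIntegral_mul {s t : ℝ}
    (h : Integrable (fun p : ℝ × ℝ => a p.2 * y (p.1 - p.2))
      ((volume.restrict (Set.Ioc s t)).prod volume)) :
    Integrable fun r => (∫ u in Set.Ioc s t, a (u - r)) * y r := by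
  simp only [← integral_mul_const]
  exact (integrable_prod_convolution h).integral_prod_right

/-- The jump term η(dt) in the equation of A, paired with a path, becomes the delay term of that
path. -/
theorem integral_sconv_negIndicator_mul {s t : ℝ}
    (h : Integrable (fun p : ℝ × ℝ => y (p.1 - p.2))
      ((volume.restrict (Set.Ioc s t)).prod μ.totalVariation)) :
    ∫ r, sconv μ (negIndicator s t) (-r) * y r =
      ∫ u in Set.Ioc s t, sintegral μ fun v => y (u - v) := by
  have hneg : MeasurePreserving (fun p : ℝ × ℝ => (-p.1, p.2)) (volume.prod μ.totalVariation)
      (volume.prod μ.totalVariation) :=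
    (Measure.measurePreserving_neg volume).prod (MeasurePreserving.id _)
  have h1 : Integrable (fun p : ℝ × ℝ => (Set.Ioc s t).indicator (fun _ => (1 : ℝ)) p.1 *
      y (p.1 - p.2)) (volume.prod μ.totalVariation) := by
    have e : (volume.restrict (Set.Ioc s t)).prod μ.totalVariation =
        (volume.prod μ.totalVariation).restrict (Set.Ioc s t ×ˢ Set.univ) := by
      rw [← Measure.prod_restrict, Measure.restrict_univ]
    rw [e] at h
    refine ((integrable_indicator_iff (measurableSet_Ioc.prod MeasurableSet.univ)).2 h).congr
      (ae_of_all _ fun p => ?_)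
    simp only
    by_cases hp : p.1 ∈ Set.Ioc s t
    · rw [Set.indicator_of_mem (by simpa using hp), Set.indicator_of_mem hp, one_mul]
    · rw [Set.indicator_of_notMem (by simpa using hp), Set.indicator_of_notMem hp, zero_mul]
  have h2 := hneg.integrable_comp_of_integrable h1
  have h3 : Integrable (fun p : ℝ × ℝ => negIndicator s t p.1 * y (0 - p.2 - p.1))
      (volume.prod μ.totalVariation) := by
    refine h2.congr (ae_of_all _ fun p => ?_)
    simp only [Function.comp_apply, negIndicator]
    congr 2
    ring
  rw [← integral_neg_eq_self]
  have h4 := integral_sconv_mul_eq_sintegral h3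
  simp only [neg_neg]
  simp only [zero_sub] at h4
  rw [h4, integral_sintegral_swap (F := fun u v => y (u - v)) h]
  congr 1
  ext v
  rw [← integral_neg_eq_self, ← integral_indicator measurableSet_Ioc]
  refine integral_congr_ae (ae_of_all _ fun u => ?_)
  simp only [negIndicator, neg_neg]
  by_cases hu : u ∈ Set.Ioc s t
  · rw [Set.indicator_of_mem hu, Set.indicator_of_mem hu, one_mul]
    congr 1
    ring
  · rw [Set.indicator_of_notMem hu, Set.indicator_of_notMem hu, zero_mul]

end Path

end MSDDE
open scoped ENNReal

namespace MSDDE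

/-! ### Additivity of the delay term -/

section Linearity

variable {α : Type*} [MeasurableSpace α] {κ : Measure α} [SFinite κ] {μ : SignedMeasure ℝ}

theorem integral_sintegral_add {F G : α → ℝ → ℝ}
    (hF : Integrable (Function.uncurry F) (κ.prod μ.totalVariation))
    (hG : Integrable (Function.uncurry G) (κ.prod μ.totalVariation)) :
    ∫ u, sintegral μ (fun v => F u v + G u v) ∂κ =
      ∫ u, sintegral μ (F u) ∂κ + ∫ u, sintegral μ (G u) ∂κ := by
  rw [← integral_add (integrable_sintegral hF) (integrable_sintegral hG)]
  refine integral_congr_ae ?_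
  filter_upwards [hF.prod_right_ae, hG.prod_right_ae] with u hu hu'
  exact sintegral_add hu hu'

theorem integral_sintegral_sub {F G : α → ℝ → ℝ}
    (hF : Integrable (Function.uncurry F) (κ.prod μ.totalVariation))
    (hG : Integrable (Function.uncurry G) (κ.prod μ.totalVariation)) :
    ∫ u, sintegral μ (fun v => F u v - G u v) ∂κ =
      ∫ u, sintegral μ (F u) ∂κ - ∫ u, sintegral μ (G u) ∂κ := by
  rw [← integral_sub (integrable_sintegral hF) (integrable_sintegral hG)]
  refine integral_congr_ae ?_
  filter_upwards [hF.prod_right_ae, hG.prod_right_ae] with u hu hu'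
  exact sintegral_sub hu hu'

theorem integral_sintegral_finset_sum {ι : Type*} [Fintype ι] {F : ι → α → ℝ → ℝ}
    (hF : ∀ i, Integrable (Function.uncurry (F i)) (κ.prod μ.totalVariation)) :
    ∫ u, sintegral μ (fun v => ∑ i, F i u v) ∂κ = ∑ i, ∫ u, sintegral μ (F i u) ∂κ := by
  rw [← integral_finsetSum _ fun i _ => integrable_sintegral (hF i)]
  refine integral_congr_ae ?_
  have : ∀ᵐ u ∂κ, ∀ i, Integrable (F i u) μ.totalVariation := by
    rw [ae_all_iff]
    exact fun i => (hF i).prod_right_ae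
  filter_upwards [this] with u hu
  exact sintegral_finset_sum _ fun i _ => hu i

end Linearity

/-! ### Interchanging convolution, delay and integration over time -/

section Path

variable {μ : SignedMeasure ℝ} {a y : ℝ → ℝ} {s t : ℝ}

theorem ae_integrable_of_triple
    (h : Integrable (fun q : (ℝ × ℝ) × ℝ => a q.1.2 * y (q.1.1 - q.2 - q.1.2))
      (((volume.restrict (Set.Ioc s t)).prod volume).prod μ.totalVariation)) :
    ∀ᵐ u ∂volume.restrict (Set.Ioc s t),
      Integrable (fun p : ℝ × ℝ => a p.1 * y (u - p.2 - p.1)) (volume.prod μ.totalVariation) := by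
  have h1 : Integrable (fun q : ℝ × ℝ × ℝ => a q.2.1 * y (q.1 - q.2.2 - q.2.1))
      ((volume.restrict (Set.Ioc s t)).prod (volume.prod μ.totalVariation)) :=
    ((measurePreserving_prodAssoc _ _ _).symm _).integrable_comp_of_integrable h
  exact h1.prod_right_ae

theorem integral_prod_sconv_eq_sintegral
    (h : Integrable (fun q : (ℝ × ℝ) × ℝ => a q.1.2 * y (q.1.1 - q.2 - q.1.2))
      (((volume.restrict (Set.Ioc s t)).prod volume).prod μ.totalVariation))
    (h' : Integrable (fun p : ℝ × ℝ => sconv μ a p.2 * y (p.1 - p.2))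
      ((volume.restrict (Set.Ioc s t)).prod volume)) :
    ∫ p, sconv μ a p.2 * y (p.1 - p.2) ∂((volume.restrict (Set.Ioc s t)).prod volume) =
      ∫ u in Set.Ioc s t, sintegral μ fun v => ∫ x, a x * y (u - v - x) := by
  rw [integral_prod _ h']
  refine integral_congr_ae ?_
  filter_upwards [ae_integrable_of_triple h] with u hu
  exact integral_sconv_mul_eq_sintegral hu

theorem integrable_mul_sintegral_of_triple
    (h : Integrable (fun q : (ℝ × ℝ) × ℝ => a q.1.2 * y (q.1.1 - q.2 - q.1.2))
      (((volume.restrict (Set.Ioc s t)).prod volume).prod μ.totalVariation)) :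
    Integrable (Function.uncurry fun u x => a x * sintegral μ (fun v => y (u - v - x)))
      ((volume.restrict (Set.Ioc s t)).prod volume) := by
  have h1 := integrable_sintegral (F := fun (p : ℝ × ℝ) v => a p.2 * y (p.1 - v - p.2)) h
  simpa only [sintegral_const_mul] using! h1

/-- Here the measure ends on y: (μ ∗ a) ∗ y becomes a ∗ (μ ∗ y). This form serves uniqueness, where
the equation for the path is inserted under the convolution; the form with μ ∗ (a ∗ y) serves
existence. -/
theorem integral_prod_sconv_eq_integral_mul
    (h : Integrable (fun q : (ℝ × ℝ) × ℝ => a q.1.2 * y (q.1.1 - q.2 - q.1.2))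
      (((volume.restrict (Set.Ioc s t)).prod volume).prod μ.totalVariation))
    (h' : Integrable (fun p : ℝ × ℝ => sconv μ a p.2 * y (p.1 - p.2))
      ((volume.restrict (Set.Ioc s t)).prod volume)) :
    ∫ p, sconv μ a p.2 * y (p.1 - p.2) ∂((volume.restrict (Set.Ioc s t)).prod volume) =
      ∫ x, a x * ∫ u in Set.Ioc s t, sintegral μ fun v => y (u - v - x) := by
  rw [integral_prod_sconv_eq_sintegral h h']
  simp only [← integral_const_mul]
  rw [← integral_integral_swap (integrable_mul_sintegral_of_triple h)]
  refine integral_congr_ae ?_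
  filter_upwards [ae_integrable_of_triple h] with u hu
  exact (integral_mul_sintegral_eq_sintegral hu).symm

end Path

/-! ### Almost sure integrability of delayed and convolved paths -/

section Random

variable {Ω : Type*} [MeasurableSpace Ω] {P : Measure Ω} [SFinite P] {Y : ℝ → Ω → ℝ}

theorem integrable_one_add_abs_Ioc (s t : ℝ) :
    Integrable (fun u : ℝ => 1 + |u|) (volume.restrict (Set.Ioc s t)) :=
  ((Continuous.continuousOn (by fun_prop)).integrableOn_compact isCompact_Icc).mono_set
    Set.Ioc_subset_Icc_self

theorem HasLinearGrowth.ae_integrable_delay (hY : HasLinearGrowth Y P) {m : Measure ℝ}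
    [IsFiniteMeasure m] (hm : Integrable (fun v => |v|) m) (s t : ℝ) :
    ∀ᵐ ω ∂P, Integrable (fun p : ℝ × ℝ => Y (p.1 - p.2) ω)
      ((volume.restrict (Set.Ioc s t)).prod m) := by
  have hm' : Integrable (fun v => 1 + |v|) m := (integrable_const 1).add hm
  have h := (integrable_one_add_abs_Ioc s t).mul_prod hm'
  have := hY.ae_integrable (κ := (volume.restrict (Set.Ioc s t)).prod m) (f := fun _ => 1)
    (T := fun p : ℝ × ℝ => p.1 - p.2) measurable_const (by fun_prop) ?_
  · simpa only [one_mul] using this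
  · refine h.mono (Continuous.aestronglyMeasurable (by fun_prop)) (ae_of_all _ fun p => ?_)
    have h1 := one_add_abs_le_mul p.1 (-p.2)
    rw [abs_neg, ← sub_eq_add_neg] at h1
    rw [mul_one, Real.norm_of_nonneg (by positivity), Real.norm_of_nonneg (by positivity)]
    exact h1

theorem HasLinearGrowth.ae_integrable_conv (hY : HasLinearGrowth Y P) {b : ℝ → ℝ}
    (hb : HasFirstMoment b) (s t : ℝ) :
    ∀ᵐ ω ∂P, Integrable (fun p : ℝ × ℝ => b p.2 * Y (p.1 - p.2) ω)
      ((volume.restrict (Set.Ioc s t)).prod volume) := by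
  have hbm := hb.measurable
  have h := (integrable_one_add_abs_Ioc s t).mul_prod hb.integrable_weight
  refine hY.ae_integrable (f := fun p : ℝ × ℝ => b p.2)
    (T := fun p : ℝ × ℝ => p.1 - p.2) (by fun_prop) (by fun_prop) ?_
  refine h.mono (by fun_prop) (ae_of_all _ fun p => ?_)
  have h1 := one_add_abs_le_mul p.1 (-p.2)
  rw [abs_neg, ← sub_eq_add_neg] at h1
  simp only [norm_mul]
  rw [Real.norm_of_nonneg (by positivity : 0 ≤ 1 + |p.1 - p.2|),
    Real.norm_of_nonneg (by positivity : 0 ≤ 1 + |p.1|),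
    Real.norm_of_nonneg (by positivity : 0 ≤ 1 + |p.2|), ← mul_assoc]
  exact mul_le_mul_of_nonneg_right h1 (norm_nonneg _)

theorem HasLinearGrowth.ae_integrable_triple (hY : HasLinearGrowth Y P) {a : ℝ → ℝ}
    (ha : HasFirstMoment a) {m : Measure ℝ} [IsFiniteMeasure m]
    (hm : Integrable (fun v => |v|) m) (s t : ℝ) :
    ∀ᵐ ω ∂P, Integrable (fun q : (ℝ × ℝ) × ℝ => a q.1.2 * Y (q.1.1 - q.2 - q.1.2) ω)
      (((volume.restrict (Set.Ioc s t)).prod volume).prod m) := by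
  have ham := ha.measurable
  have hm' : Integrable (fun v => 1 + |v|) m := (integrable_const 1).add hm
  have h := ((integrable_one_add_abs_Ioc s t).mul_prod ha.integrable_weight).mul_prod hm'
  refine hY.ae_integrable (f := fun q : (ℝ × ℝ) × ℝ => a q.1.2)
    (T := fun q : (ℝ × ℝ) × ℝ => q.1.1 - q.2 - q.1.2) (by fun_prop) (by fun_prop) ?_
  refine h.mono (by fun_prop) (ae_of_all _ fun q => ?_)
  have h1 := one_add_abs_le_mul q.1.1 (-q.2)
  have h2 := one_add_abs_le_mul (q.1.1 - q.2) (-q.1.2)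
  rw [abs_neg, ← sub_eq_add_neg] at h1 h2
  simp only [norm_mul]
  rw [Real.norm_of_nonneg (by positivity : 0 ≤ 1 + |q.1.1 - q.2 - q.1.2|),
    Real.norm_of_nonneg (by positivity : 0 ≤ 1 + |q.1.1|),
    Real.norm_of_nonneg (by positivity : 0 ≤ 1 + |q.1.2|),
    Real.norm_of_nonneg (by positivity : 0 ≤ 1 + |q.2|)]
  calc _ ≤ ((1 + |q.1.1|) * (1 + |q.2|) * (1 + |q.1.2|)) * ‖a q.1.2‖ := by
        refine mul_le_mul_of_nonneg_right (h2.trans ?_) (norm_nonneg _)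
        exact mul_le_mul_of_nonneg_right h1 (by positivity)
    _ = _ := by ring

end Random

/-! ### Existence of a solution -/

section Existence

variable {n : ℕ} {η : MatrixMeasure n}

/-- The integrated equation of A, reflected by x = -r and paired with z(r): the left side gives the
increment of A ∗ z, the jump term gives the delay of z, and the remaining terms give the delay of A
∗ z. -/
theorem kernelConv_path_increment (hη : ConcentratedOnNonneg η) (hmom : HasMoment η 2)
    (hdet : ∀ y : ℝ, (charFn η (Complex.I * (y : ℂ))).det ≠ 0) {s t : ℝ} (hst : s ≤ t)
    (j k : Fin n) {z : ℝ → ℝ}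
    (hs : Integrable fun x => kernelConv η x j k * z (s - x))
    (ht : Integrable fun x => kernelConv η x j k * z (t - x))
    (hD : Integrable (fun p : ℝ × ℝ => z (p.1 - p.2))
      ((volume.restrict (Set.Ioc s t)).prod (η j k).totalVariation))
    (hT : ∀ l, Integrable (fun q : (ℝ × ℝ) × ℝ =>
      kernelConv η q.1.2 l k * z (q.1.1 - q.2 - q.1.2))
      (((volume.restrict (Set.Ioc s t)).prod volume).prod (η j l).totalVariation))
    (hB : ∀ l, Integrable (fun p : ℝ × ℝ =>
      sconv (η j l) (fun x => kernelConv η x l k) p.2 * z (p.1 - p.2))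
      ((volume.restrict (Set.Ioc s t)).prod volume)) :
    (∫ x, kernelConv η x j k * z (t - x)) - (∫ x, kernelConv η x j k * z (s - x)) =
      (∫ u in Set.Ioc s t, sintegral (η j k) fun v => z (u - v)) +
        ∑ l, ∫ u in Set.Ioc s t,
          sintegral (η j l) fun v => ∫ x, kernelConv η x l k * z (u - v - x) := by
  have hA := hasFirstMoment_kernelConv hη hmom hdet
  let F : ℝ → ℝ := fun r => (kernelConv η (t - r) j k - kernelConv η (s - r) j k) * z r
  let G : Fin n → ℝ → ℝ := fun l r =>
    (∫ u in Set.Ioc s t, sconv (η j l) (fun x => kernelConv η x l k) (u - r)) * z r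
  have hshift : ∀ t, (Integrable fun x => kernelConv η x j k * z (t - x)) →
      Integrable fun r => kernelConv η (t - r) j k * z r := fun t h =>
    (h.comp_sub_left t).congr (ae_of_all _ fun r => by simp)
  have hF : Integrable F := by
    simpa only [F, sub_mul] using! (hshift t ht).sub (hshift s hs)
  have hG : ∀ l, Integrable (G l) := fun l => integrable_setIntegral_mul (hB l)
  have hae : F =ᵐ[volume] fun r => sconv (η j k) (negIndicator s t) (-r) * z r + ∑ l, G l r := by
    have h1 := (Measure.measurePreserving_neg (volume : Measure ℝ)).quasiMeasurePreserving.ae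
      (kernelConv_sub_ae_eq hη hmom hdet hst j k)
    filter_upwards [h1] with r hr
    simp only [← sub_eq_add_neg] at hr
    simp only [F, G]
    rw [hr, add_mul, Finset.sum_mul]
  -- Integrability of the jump term is read off as a difference of the other terms in the almost
  -- everywhere identity.
  have hE : Integrable fun r => sconv (η j k) (negIndicator s t) (-r) * z r := by
    refine (hF.sub (integrable_finsetSum Finset.univ fun l _ => hG l)).congr ?_
    filter_upwards [hae] with r hr
    simp only [Pi.sub_apply]
    rw [hr]
    ring
  calc (∫ x, kernelConv η x j k * z (t - x)) - (∫ x, kernelConv η x j k * z (s - x)) =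
        ∫ r, F r := by
        simp only [F, sub_mul]
        rw [integral_sub (hshift t ht) (hshift s hs),
          ← integral_sub_left_eq_self (fun x => kernelConv η x j k * z (t - x)) volume t,
          ← integral_sub_left_eq_self (fun x => kernelConv η x j k * z (s - x)) volume s]
        simp only [sub_sub_cancel]
    _ = ∫ r, (sconv (η j k) (negIndicator s t) (-r) * z r + ∑ l, G l r) := integral_congr_ae hae
    _ = _ := by
        rw [integral_add hE (integrable_finsetSum _ fun l _ => hG l),
          integral_finsetSum _ fun l _ => hG l, integral_sconv_negIndicator_mul hD]
        congr 1
        refine Finset.sum_congr rfl fun l _ => ?_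
        rw [← integral_prod_sconv_eq_sintegral (hT l) (hB l), integral_prod_convolution (hB l)]

theorem convProcess_kernel_apply {Ω : Type*} {Z : ℝ → Ω → Fin n → ℝ} (t : ℝ) (ω : Ω) (j : Fin n) :
    convProcess η (kernel η) Z t ω j =
      Z t ω j + ∑ k, ∫ x, kernelConv η x j k * Z (t - x) ω k := by
  rw [convProcess]
  congr 1
  refine Finset.sum_congr rfl fun k _ => ?_
  rw [← integral_sub_left_eq_self (fun x => kernelConv η x j k * Z (t - x) ω k) volume t]
  simp [kernelConv]

variable {Ω : Type*} [MeasurableSpace Ω] {P : Measure Ω} {Z : ℝ → Ω → Fin n → ℝ}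

theorem hasLinearGrowth_convProcess [SFinite P] (hη : ConcentratedOnNonneg η)
    (hmom : HasMoment η 2) (hdet : ∀ y : ℝ, (charFn η (Complex.I * (y : ℂ))).det ≠ 0)
    (hZ : ∀ k, HasLinearGrowth (fun t ω => Z t ω k) P) (j : Fin n) :
    HasLinearGrowth (fun t ω => convProcess η (kernel η) Z t ω j) P := by
  simp only [convProcess_kernel_apply]
  exact (hZ j).add (HasLinearGrowth.finset_sum (s := Finset.univ)
    (Y := fun k t ω => ∫ x, kernelConv η x j k * Z (t - x) ω k)
    fun k _ => (hZ k).convolution (hasFirstMoment_kernelConv hη hmom hdet j k))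

theorem satisfiesMSDDE_convProcess [SFinite P] (hη : ConcentratedOnNonneg η)
    (hmom : HasMoment η 2) (hdet : ∀ y : ℝ, (charFn η (Complex.I * (y : ℂ))).det ≠ 0)
    (hZ : ∀ k, HasLinearGrowth (fun t ω => Z t ω k) P) :
    SatisfiesMSDDE η Z (convProcess η (kernel η) Z) P := by
  intro s t hst
  have hA := hasFirstMoment_kernelConv hη hmom hdet
  have hX := hasLinearGrowth_convProcess hη hmom hdet hZ
  have e1 : ∀ᵐ ω ∂P, ∀ j k, Integrable (fun p : ℝ × ℝ => convProcess η (kernel η) Z (p.1 - p.2) ω k)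
      ((volume.restrict (Set.Ioc s t)).prod (η j k).totalVariation) := by
    simp only [ae_all_iff]
    exact fun j k => (hX k).ae_integrable_delay (hmom.integrable_abs j k) s t
  have e2 : ∀ᵐ ω ∂P, ∀ j k, Integrable (fun p : ℝ × ℝ => Z (p.1 - p.2) ω k)
      ((volume.restrict (Set.Ioc s t)).prod (η j k).totalVariation) := by
    simp only [ae_all_iff]
    exact fun j k => (hZ k).ae_integrable_delay (hmom.integrable_abs j k) s t
  have e3 : ∀ᵐ ω ∂P, ∀ j k i, Integrable (fun p : ℝ × ℝ =>
      ∫ x, kernelConv η x k i * Z (p.1 - p.2 - x) ω i)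
      ((volume.restrict (Set.Ioc s t)).prod (η j k).totalVariation) := by
    simp only [ae_all_iff]
    exact fun j k i => ((hZ i).convolution (hA k i)).ae_integrable_delay
      (hmom.integrable_abs j k) s t
  have e4 : ∀ᵐ ω ∂P, ∀ j k l, Integrable (fun q : (ℝ × ℝ) × ℝ =>
      kernelConv η q.1.2 l k * Z (q.1.1 - q.2 - q.1.2) ω k)
      (((volume.restrict (Set.Ioc s t)).prod volume).prod (η j l).totalVariation) := by
    simp only [ae_all_iff]
    exact fun j k l => (hZ k).ae_integrable_triple (hA l k) (hmom.integrable_abs j l) s t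
  have e5 : ∀ᵐ ω ∂P, ∀ j k l, Integrable (fun p : ℝ × ℝ =>
      sconv (η j l) (fun x => kernelConv η x l k) p.2 * Z (p.1 - p.2) ω k)
      ((volume.restrict (Set.Ioc s t)).prod volume) := by
    simp only [ae_all_iff]
    exact fun j k l => (hZ k).ae_integrable_conv ((hA l k).sconv (hmom.integrable_abs j l)) s t
  have e6 : ∀ r : ℝ, ∀ᵐ ω ∂P, ∀ j k, Integrable fun x => kernelConv η x j k * Z (r - x) ω k := by
    simp only [ae_all_iff]
    exact fun r j k => (hZ k).ae_integrable (T := fun x => r - x) (hA j k).measurable (by fun_prop)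
      ((hA j k).integrable_comp_sub r)
  filter_upwards [e1, e2, e3, e4, e5, e6 s, e6 t] with ω h1 h2 h3 h4 h5 h6 h7 j
  refine ⟨h1 j, ?_⟩
  have hinc := fun k => kernelConv_path_increment hη hmom hdet hst.le j k (z := fun r => Z r ω k)
    (h6 j k) (h7 j k) (h2 j k) (h4 j k) (h5 j k)
  have hsplit : ∀ k, ∫ u in Set.Ioc s t,
      sintegral (η j k) (fun v => convProcess η (kernel η) Z (u - v) ω k) =
      (∫ u in Set.Ioc s t, sintegral (η j k) fun v => Z (u - v) ω k) +
        ∑ i, ∫ u in Set.Ioc s t,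
          sintegral (η j k) fun v => ∫ x, kernelConv η x k i * Z (u - v - x) ω i := by
    intro k
    simp only [convProcess_kernel_apply]
    rw [← integral_sintegral_finset_sum
      (F := fun i u v => ∫ x, kernelConv η x k i * Z (u - v - x) ω i) (h3 j k)]
    exact integral_sintegral_add (F := fun u v => Z (u - v) ω k)
      (G := fun u v => ∑ i, ∫ x, kernelConv η x k i * Z (u - v - x) ω i)
      (h2 j k) (integrable_finsetSum _ fun i _ => h3 j k i)
  simp only [hsplit]
  -- In the increment of A ∗ Z the outer index is the component of Z, in the delay of X it is the
  -- component of X; exchanging the double sum aligns the two.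
  rw [convProcess_kernel_apply, convProcess_kernel_apply, Finset.sum_add_distrib,
    Finset.sum_comm (f := fun k i => ∫ u in Set.Ioc s t,
          sintegral (η j k) fun v => ∫ x, kernelConv η x k i * Z (u - v - x) ω i),
    ← Finset.sum_add_distrib, ← Finset.sum_congr rfl fun k _ => hinc k, Finset.sum_sub_distrib]
  ring

end Existence

end MSDDE
open scoped ENNReal

namespace MSDDE

/-! ### Uniqueness of the solution -/

section Uniqueness

variable {n : ℕ} {η : MatrixMeasure n}

theorem integral_negIndicator_mul (s t : ℝ) (z : ℝ → ℝ) :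
    ∫ r, negIndicator s t (-r) * z r = ∫ u in Set.Ioc s t, z u := by
  rw [← integral_indicator measurableSet_Ioc]
  congr 1
  ext r
  by_cases hr : r ∈ Set.Ioc s t
  · rw [negIndicator, neg_neg, Set.indicator_of_mem hr, Set.indicator_of_mem hr, one_mul]
  · rw [negIndicator, neg_neg, Set.indicator_of_notMem hr, Set.indicator_of_notMem hr, zero_mul]

/-- Pairs the equation dg = A dt + δ₀ I with a path: the unit jump of g at zero reproduces the
integral of the path. -/
theorem kernel_path_increment (hη : ConcentratedOnNonneg η) (hmom : HasMoment η 2)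
    (hdet : ∀ y : ℝ, (charFn η (Complex.I * (y : ℂ))).det ≠ 0) {s t : ℝ} (hst : s ≤ t)
    (j k : Fin n) {z : ℝ → ℝ}
    (hs : Integrable fun x => kernel η x j k * z (s - x))
    (ht : Integrable fun x => kernel η x j k * z (t - x))
    (hB : Integrable (fun p : ℝ × ℝ => kernelConv η p.2 j k * z (p.1 - p.2))
      ((volume.restrict (Set.Ioc s t)).prod volume)) :
    ∫ x, kernel η x j k * (z (t - x) - z (s - x)) =
      (1 : Matrix (Fin n) (Fin n) ℝ) j k * (∫ u in Set.Ioc s t, z u) +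
        ∫ p, kernelConv η p.2 j k * z (p.1 - p.2)
          ∂((volume.restrict (Set.Ioc s t)).prod volume) := by
  let F : ℝ → ℝ := fun r => (kernel η (t - r) j k - kernel η (s - r) j k) * z r
  have hG := integrable_setIntegral_mul (a := fun x => kernelConv η x j k) (y := z) hB
  have hshift : ∀ t, (Integrable fun x => kernel η x j k * z (t - x)) →
      Integrable fun r => kernel η (t - r) j k * z r := fun t h =>
    (h.comp_sub_left t).congr (ae_of_all _ fun r => by simp)
  have hF : Integrable F := by
    simpa only [F, sub_mul] using! (hshift t ht).sub (hshift s hs)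
  have hae : F =ᵐ[volume] fun r =>
      (1 : Matrix (Fin n) (Fin n) ℝ) j k * (negIndicator s t (-r) * z r) +
        (∫ u in Set.Ioc s t, kernelConv η (u - r) j k) * z r := by
    have h1 := (Measure.measurePreserving_neg (volume : Measure ℝ)).quasiMeasurePreserving.ae
      (kernel_sub_ae_eq hη hmom hdet hst j k)
    filter_upwards [h1] with r hr
    simp only [← sub_eq_add_neg] at hr
    simp only [F]
    rw [hr]
    ring
  have hE : Integrable fun r =>
      (1 : Matrix (Fin n) (Fin n) ℝ) j k * (negIndicator s t (-r) * z r) := by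
    refine (hF.sub hG).congr ?_
    filter_upwards [hae] with r hr
    simp only [Pi.sub_apply]
    rw [hr]
    ring
  calc ∫ x, kernel η x j k * (z (t - x) - z (s - x)) = ∫ r, F r := by
        simp only [F, sub_mul, mul_sub]
        rw [integral_sub ht hs, integral_sub (hshift t ht) (hshift s hs),
          ← integral_sub_left_eq_self (fun x => kernel η x j k * z (t - x)) volume t,
          ← integral_sub_left_eq_self (fun x => kernel η x j k * z (s - x)) volume s]
        simp only [sub_sub_cancel]
    _ = _ := by
        rw [integral_congr_ae hae, integral_add hE hG, integral_const_mul,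
          integral_negIndicator_mul,
          integral_prod_convolution (a := fun x => kernelConv η x j k) (y := z) hB]

/-- The increment of g ∗ z is computed twice. The equation of z gives ∫_s^t A ∗ z, since g ∗ (η ∗ z)
= A ∗ z; the equation of g gives the same term plus ∫_s^t z, which must therefore vanish. -/
theorem setIntegral_eq_zero_of_homogeneous_path (hη : ConcentratedOnNonneg η)
    (hmom : HasMoment η 2) (hdet : ∀ y : ℝ, (charFn η (Complex.I * (y : ℂ))).det ≠ 0) {s t : ℝ}
    (hst : s ≤ t) (i : Fin n) {z : Fin n → ℝ → ℝ}
    (heq : ∀ᵐ x, ∀ j, z j (t - x) - z j (s - x) =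
      ∑ k, ∫ u in Set.Ioc s t, sintegral (η j k) fun v => z k (u - v - x))
    (hs : ∀ j, Integrable fun x => kernel η x i j * z j (s - x))
    (ht : ∀ j, Integrable fun x => kernel η x i j * z j (t - x))
    (hB : ∀ k, Integrable (fun p : ℝ × ℝ => kernelConv η p.2 i k * z k (p.1 - p.2))
      ((volume.restrict (Set.Ioc s t)).prod volume))
    (hS : ∀ j k, Integrable (fun p : ℝ × ℝ =>
      sconv (η j k) (fun x => kernel η x i j) p.2 * z k (p.1 - p.2))
      ((volume.restrict (Set.Ioc s t)).prod volume))
    (hT : ∀ j k, Integrable (fun q : (ℝ × ℝ) × ℝ =>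
      kernel η q.1.2 i j * z k (q.1.1 - q.2 - q.1.2))
      (((volume.restrict (Set.Ioc s t)).prod volume).prod (η j k).totalVariation)) :
    ∫ u in Set.Ioc s t, z i u = 0 := by
  have h1 : ∀ j, ∫ x, kernel η x i j * (z j (t - x) - z j (s - x)) =
      ∑ k, ∫ p, sconv (η j k) (fun x => kernel η x i j) p.2 * z k (p.1 - p.2)
        ∂((volume.restrict (Set.Ioc s t)).prod volume) := by
    intro j
    have hint : ∀ k, Integrable fun x => kernel η x i j *
        ∫ u in Set.Ioc s t, sintegral (η j k) fun v => z k (u - v - x) := by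
      intro k
      have := (integrable_mul_sintegral_of_triple
        (a := fun x => kernel η x i j) (y := z k) (hT j k)).integral_prod_right
      simpa only [Function.uncurry_apply_pair, integral_const_mul] using this
    rw [Finset.sum_congr rfl fun k _ => integral_prod_sconv_eq_integral_mul (hT j k) (hS j k),
      ← integral_finsetSum _ fun k _ => hint k]
    refine integral_congr_ae ?_
    filter_upwards [heq] with x hx
    rw [hx j, Finset.mul_sum]
  have h2 : ∑ j, ∫ x, kernel η x i j * (z j (t - x) - z j (s - x)) =
      ∑ k, ∫ p, kernelConv η p.2 i k * z k (p.1 - p.2)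
        ∂((volume.restrict (Set.Ioc s t)).prod volume) := by
    rw [Finset.sum_congr rfl fun j _ => h1 j, Finset.sum_comm]
    refine Finset.sum_congr rfl fun k _ => ?_
    rw [← integral_finsetSum _ fun j _ => hS j k]
    refine integral_congr_ae (ae_of_all _ fun p => ?_)
    simp only [kernelConv, conv_eq_sum_sconv, Finset.sum_mul]
  rw [Finset.sum_congr rfl fun j _ =>
    kernel_path_increment hη hmom hdet hst i j (hs j) (ht j) (hB j), Finset.sum_add_distrib,
    add_eq_right] at h2
  simpa [Matrix.one_apply] using h2

variable {Ω : Type*} [MeasurableSpace Ω] {P : Measure Ω} {D : Fin n → ℝ → Ω → ℝ}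

/-- The homogeneous equation `dD_t = η ∗ D(t) dt` for the components of a process. -/
def SatisfiesHomogeneous (η : MatrixMeasure n) (D : Fin n → ℝ → Ω → ℝ) (P : Measure Ω) : Prop :=
  ∀ s t : ℝ, s < t → ∀ᵐ ω ∂P, ∀ j, D j t ω - D j s ω =
    ∑ k, ∫ u in Set.Ioc s t, sintegral (η j k) fun v => D k (u - v) ω

/-- The equation holds almost surely for each fixed pair of times, with an exceptional event
depending on the pair. Convolution needs almost all shifts on a single event, which Fubini provides.
-/
theorem SatisfiesHomogeneous.ae_shift [SFinite P] (hD : ∀ k, HasLinearGrowth (D k) P)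
    (heq : SatisfiesHomogeneous η D P) {s t : ℝ} (hst : s < t) :
    ∀ᵐ ω ∂P, ∀ᵐ x, ∀ j, D j (t - x) ω - D j (s - x) ω =
      ∑ k, ∫ u in Set.Ioc s t, sintegral (η j k) fun v => D k (u - v - x) ω := by
  have hm : ∀ {α : Type} [MeasurableSpace α] {T : α × Ω → ℝ} (_ : Measurable T) (k : Fin n),
      Measurable fun p : α × Ω => D k (T p) p.2 := fun hT k =>
    (hD k).measurable.comp (hT.prodMk measurable_snd)
  have hmeas : ∀ j k, Measurable fun p : ℝ × Ω =>
      ∫ u in Set.Ioc s t, sintegral (η j k) fun v => D k (u - v - p.1) p.2 := by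
    intro j k
    have h0 : Measurable fun q : ((ℝ × Ω) × ℝ) × ℝ => D k (q.1.2 - q.2 - q.1.1.1) q.1.1.2 :=
      (hD k).measurable.comp (by fun_prop : Measurable fun q : ((ℝ × Ω) × ℝ) × ℝ =>
        (q.1.2 - q.2 - q.1.1.1, q.1.1.2))
    have h1 := stronglyMeasurable_sintegral (μ := η j k)
      (F := fun (q : (ℝ × Ω) × ℝ) v => D k (q.2 - v - q.1.1) q.1.2) h0.stronglyMeasurable
    exact (h1.integral_prod_right (f := fun (p : ℝ × Ω) u =>
      sintegral (η j k) fun v => D k (u - v - p.1) p.2)).measurable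
  refine (Measure.ae_ae_comm (μ := volume) (ν := P) (p := fun x ω => ∀ j,
    D j (t - x) ω - D j (s - x) ω =
      ∑ k, ∫ u in Set.Ioc s t, sintegral (η j k) fun v => D k (u - v - x) ω) ?_).1
      (ae_of_all _ fun x => ?_)
  · rw [Set.ofPred_forall]
    refine MeasurableSet.iInter fun j => measurableSet_eq_fun ?_ ?_
    · exact (hm (T := fun p : ℝ × Ω => t - p.1) (by fun_prop) j).sub
        (hm (T := fun p : ℝ × Ω => s - p.1) (by fun_prop) j)
    · exact Finset.measurable_sum _ fun k _ => hmeas j k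
  · filter_upwards [heq (s - x) (t - x) (by linarith)] with ω hω j
    rw [hω j]
    refine Finset.sum_congr rfl fun k _ => ?_
    have := (measurePreserving_sub_right (volume : Measure ℝ) x).setIntegral_preimage_emb
      (MeasurableEquiv.subRight x).measurableEmbedding
      (fun u => sintegral (η j k) fun v => D k (u - v) ω) (Set.Ioc (s - x) (t - x))
    rw [← this, Set.preimage_sub_const_Ioc, sub_add_cancel, sub_add_cancel]
    simp only [sub_right_comm]

theorem SatisfiesHomogeneous.setIntegral_eq_zero [SFinite P] (hη : ConcentratedOnNonneg η)
    (hmom : HasMoment η 2) (hdet : ∀ y : ℝ, (charFn η (Complex.I * (y : ℂ))).det ≠ 0)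
    (hD : ∀ k, HasLinearGrowth (D k) P) (heq : SatisfiesHomogeneous η D P) {s t : ℝ}
    (hst : s < t) : ∀ᵐ ω ∂P, ∀ i, ∫ u in Set.Ioc s t, D i u ω = 0 := by
  have hg := hasFirstMoment_kernel hη hmom hdet
  have e1 : ∀ r, ∀ᵐ ω ∂P, ∀ i j, Integrable fun x => kernel η x i j * D j (r - x) ω := by
    simp only [ae_all_iff]
    exact fun r i j => (hD j).ae_integrable (T := fun x => r - x) (hg i j).measurable
      (by fun_prop) ((hg i j).integrable_comp_sub r)
  have e2 : ∀ᵐ ω ∂P, ∀ i k, Integrable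
      (fun p : ℝ × ℝ => kernelConv η p.2 i k * D k (p.1 - p.2) ω)
      ((volume.restrict (Set.Ioc s t)).prod volume) := by
    simp only [ae_all_iff]
    exact fun i k => (hD k).ae_integrable_conv (hasFirstMoment_kernelConv hη hmom hdet i k) s t
  have e3 : ∀ᵐ ω ∂P, ∀ i j k, Integrable (fun p : ℝ × ℝ =>
      sconv (η j k) (fun x => kernel η x i j) p.2 * D k (p.1 - p.2) ω)
      ((volume.restrict (Set.Ioc s t)).prod volume) := by
    simp only [ae_all_iff]
    exact fun i j k => (hD k).ae_integrable_conv ((hg i j).sconv (hmom.integrable_abs j k)) s t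
  have e4 : ∀ᵐ ω ∂P, ∀ i j k, Integrable (fun q : (ℝ × ℝ) × ℝ =>
      kernel η q.1.2 i j * D k (q.1.1 - q.2 - q.1.2) ω)
      (((volume.restrict (Set.Ioc s t)).prod volume).prod (η j k).totalVariation) := by
    simp only [ae_all_iff]
    exact fun i j k => (hD k).ae_integrable_triple (hg i j) (hmom.integrable_abs j k) s t
  filter_upwards [e1 s, e1 t, e2, e3, e4, heq.ae_shift hD hst] with ω h1 h2 h3 h4 h5 h6 i
  exact setIntegral_eq_zero_of_homogeneous_path hη hmom hdet hst.le i
    (z := fun j r => D j r ω) h6 (h1 i) (h2 i) (h3 i) (h4 i) (h5 i)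

/-- Interchanging the integrals, the right side of the equation is an η(dv)-integral of ∫_s^t D(u -
v) du, and these inner integrals vanish. -/
theorem SatisfiesHomogeneous.ae_eq_of_lt [SFinite P] (hη : ConcentratedOnNonneg η)
    (hmom : HasMoment η 2) (hdet : ∀ y : ℝ, (charFn η (Complex.I * (y : ℂ))).det ≠ 0)
    (hD : ∀ k, HasLinearGrowth (D k) P) (heq : SatisfiesHomogeneous η D P) {s t : ℝ}
    (hst : s < t) : ∀ᵐ ω ∂P, ∀ j, D j t ω = D j s ω := by
  have e1 : ∀ᵐ ω ∂P, ∀ j k, Integrable (fun p : ℝ × ℝ => D k (p.1 - p.2) ω)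
      ((volume.restrict (Set.Ioc s t)).prod (η j k).totalVariation) := by
    simp only [ae_all_iff]
    exact fun j k => (hD k).ae_integrable_delay (hmom.integrable_abs j k) s t
  have e2 : ∀ᵐ ω ∂P, ∀ j k, ∀ᵐ v ∂(η j k).totalVariation,
      ∫ u in Set.Ioc s t, D k (u - v) ω = 0 := by
    simp only [ae_all_iff]
    intro j k
    have hm : Measurable fun p : ℝ × Ω => ∫ u in Set.Ioc s t, D k (u - p.1) p.2 := by
      have h0 : Measurable fun q : (ℝ × Ω) × ℝ => D k (q.2 - q.1.1) q.1.2 :=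
        (hD k).measurable.comp (by fun_prop : Measurable fun q : (ℝ × Ω) × ℝ =>
          (q.2 - q.1.1, q.1.2))
      exact (h0.stronglyMeasurable.integral_prod_right
        (f := fun (p : ℝ × Ω) u => D k (u - p.1) p.2)).measurable
    -- The exchange is made for the variation of η, not for Lebesgue measure, because η may be
    -- singular; the inner statement holds for every v.
    refine (Measure.ae_ae_comm (μ := (η j k).totalVariation) (ν := P)
      (p := fun v ω => ∫ u in Set.Ioc s t, D k (u - v) ω = 0)
      (measurableSet_eq_fun hm measurable_const)).1 (ae_of_all _ fun v => ?_)
    filter_upwards [heq.setIntegral_eq_zero hη hmom hdet hD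
      (sub_lt_sub_right hst v)] with ω hω
    have := (measurePreserving_sub_right (volume : Measure ℝ) v).setIntegral_preimage_emb
      (MeasurableEquiv.subRight v).measurableEmbedding
      (fun u => D k u ω) (Set.Ioc (s - v) (t - v))
    rw [hω k, Set.preimage_sub_const_Ioc, sub_add_cancel, sub_add_cancel] at this
    exact this
  filter_upwards [e1, e2, heq s t hst] with ω h1 h2 h3 j
  rw [← sub_eq_zero, h3 j]
  refine Finset.sum_eq_zero fun k _ => ?_
  rw [integral_sintegral_swap (F := fun u v => D k (u - v) ω) (h1 j k),
    sintegral_congr_ae (h2 j k), sintegral_zero]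

/-- On an interval of length one starting at s, D agrees with D_s almost everywhere, so D_s equals
its integral over that interval, which is zero. -/
theorem SatisfiesHomogeneous.ae_eq_zero [SFinite P] (hη : ConcentratedOnNonneg η)
    (hmom : HasMoment η 2) (hdet : ∀ y : ℝ, (charFn η (Complex.I * (y : ℂ))).det ≠ 0)
    (hD : ∀ k, HasLinearGrowth (D k) P) (heq : SatisfiesHomogeneous η D P) (s : ℝ) :
    ∀ᵐ ω ∂P, ∀ j, D j s ω = 0 := by
  have hs : s < s + 1 := lt_add_one s
  have e1 : ∀ᵐ ω ∂P, ∀ᵐ u ∂volume.restrict (Set.Ioc s (s + 1)), ∀ j, D j u ω = D j s ω := by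
    refine (Measure.ae_ae_comm (μ := volume.restrict (Set.Ioc s (s + 1))) (ν := P)
      (p := fun u ω => ∀ j, D j u ω = D j s ω) ?_).1 ?_
    · rw [Set.ofPred_forall]
      exact MeasurableSet.iInter fun j => measurableSet_eq_fun (hD j).measurable
        ((hD j).measurable.comp (by fun_prop : Measurable fun p : ℝ × Ω => (s, p.2)))
    · filter_upwards [ae_restrict_mem measurableSet_Ioc] with u hu
      exact heq.ae_eq_of_lt hη hmom hdet hD hu.1
  filter_upwards [e1, heq.setIntegral_eq_zero hη hmom hdet hD hs] with ω h1 h2 j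
  rw [← h2 j, integral_congr_ae (g := fun _ => D j s ω) (h1.mono fun u hu => hu j)]
  simp

theorem SatisfiesMSDDE.sub {Z X X' : ℝ → Ω → Fin n → ℝ} (h : SatisfiesMSDDE η Z X P)
    (h' : SatisfiesMSDDE η Z X' P) :
    SatisfiesHomogeneous η (fun j t ω => X t ω j - X' t ω j) P := by
  intro s t hst
  filter_upwards [h s t hst, h' s t hst] with ω h1 h2 j
  have e : ∀ k, ∫ u in Set.Ioc s t,
      sintegral (η j k) (fun v => X (u - v) ω k - X' (u - v) ω k) = _ := fun k =>
    integral_sintegral_sub (F := fun u v => X (u - v) ω k) (G := fun u v => X' (u - v) ω k)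
      ((h1 j).1 k) ((h2 j).1 k)
  rw [Finset.sum_congr rfl fun k _ => e k, Finset.sum_sub_distrib]
  linarith [(h1 j).2, (h2 j).2]

theorem IsStationary.integral_norm_eq {X : ℝ → Ω → Fin n → ℝ} (h : IsStationary X P) (t : ℝ) :
    ∫ ω, ‖X t ω‖ ∂P = ∫ ω, ‖X 0 ω‖ ∂P := by
  have h1 := (h t 1 fun _ => 0).comp (u := fun y : Fin 1 → Fin n → ℝ => ‖y 0‖) (by fun_prop)
  simpa [Function.comp_def] using h1.integral_eq

theorem IsStationarySolution.hasLinearGrowth {Z X : ℝ → Ω → Fin n → ℝ}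
    (h : IsStationarySolution η Z X P) (k : Fin n) : HasLinearGrowth (fun t ω => X t ω k) P := by
  refine hasLinearGrowth_component h.measurable h.integrable ⟨∫ ω, ‖X 0 ω‖ ∂P, fun t => ?_⟩ k
  rw [h.stationary.integral_norm_eq t]
  exact le_mul_of_one_le_right (integral_nonneg fun _ => norm_nonneg _)
    (le_add_of_nonneg_right (abs_nonneg t))

/-- Uniqueness holds in the class of processes of linear growth; stationarity of a solution only
serves to place it in this class. -/
theorem SatisfiesMSDDE.ae_eq [SFinite P] (hη : ConcentratedOnNonneg η)
    (hmom : HasMoment η 2) (hdet : ∀ y : ℝ, (charFn η (Complex.I * (y : ℂ))).det ≠ 0)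
    {Z X X' : ℝ → Ω → Fin n → ℝ} (h : SatisfiesMSDDE η Z X P) (h' : SatisfiesMSDDE η Z X' P)
    (hX : ∀ k, HasLinearGrowth (fun t ω => X t ω k) P)
    (hX' : ∀ k, HasLinearGrowth (fun t ω => X' t ω k) P) (t : ℝ) : X t =ᵐ[P] X' t := by
  have hD : ∀ k, HasLinearGrowth (fun t ω => X t ω k - X' t ω k) P := fun k => by
    simpa only [sub_eq_add_neg] using (hX k).add (hX' k).neg
  filter_upwards [(h.sub h').ae_eq_zero hη hmom hdet hD t] with ω hω
  exact funext fun j => sub_eq_zero.1 (hω j)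

end Uniqueness

end MSDDE
open scoped ENNReal

namespace MSDDE

/-! ### Monte Carlo approximation by finite sums of increments -/

section MonteCarlo

open Filter Topology

/-- Almost sure convergence passes to expectations of bounded continuous functions, and these
determine the law. -/
theorem identDistrib_of_tendsto {Ω E : Type*} [MeasurableSpace Ω] {P : Measure Ω}
    [IsProbabilityMeasure P] [PseudoEMetricSpace E] [MeasurableSpace E] [BorelSpace E]
    {f g : Ω → E} {F G : ℕ → Ω → E} (hf : AEMeasurable f P) (hg : AEMeasurable g P)
    (h : ∀ N, IdentDistrib (F N) (G N) P P)
    (hF : ∀ᵐ ω ∂P, Tendsto (fun N => F N ω) atTop (𝓝 (f ω)))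
    (hG : ∀ᵐ ω ∂P, Tendsto (fun N => G N ω) atTop (𝓝 (g ω))) : IdentDistrib f g P P := by
  have key : ∀ {f : Ω → E} {F : ℕ → Ω → E}, AEMeasurable f P → (∀ N, AEMeasurable (F N) P) →
      (∀ᵐ ω ∂P, Tendsto (fun N => F N ω) atTop (𝓝 (f ω))) →
      ∀ φ : BoundedContinuousFunction E ℝ,
        Tendsto (fun N => ∫ x, φ x ∂P.map (F N)) atTop (𝓝 (∫ x, φ x ∂P.map f)) := by
    intro f F hf hF hlim φ
    have hφ : ∀ {ν : Measure E}, AEStronglyMeasurable φ ν :=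
      φ.continuous.measurable.aestronglyMeasurable
    simp only [integral_map hf hφ, integral_map (hF _) hφ]
    refine tendsto_integral_of_dominated_convergence (fun _ => ‖φ‖)
      (fun N => (φ.continuous.measurable.comp_aemeasurable (hF N)).aestronglyMeasurable)
      (integrable_const _) (fun N => ae_of_all _ fun ω => φ.norm_coe_le_norm _) ?_
    filter_upwards [hlim] with ω hω
    exact (φ.continuous.tendsto _).comp hω
  refine ⟨hf, hg, ?_⟩
  have := Measure.isProbabilityMeasure_map hf
  have := Measure.isProbabilityMeasure_map hg
  refine ext_of_forall_integral_eq_of_IsFiniteMeasure fun φ => ?_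
  refine tendsto_nhds_unique (key hf (fun N => (h N).aemeasurable_fst) hF φ) ?_
  simp only [(h _).map_eq]
  exact key hg (fun N => (h N).aemeasurable_snd) hG φ

/-- For fixed ω this is the strong law for independent nodes with law ν. Fubini exchanges the roles,
so that almost every deterministic sequence of nodes works for almost every ω. -/
theorem ae_tendsto_average {Ω α : Type*} [MeasurableSpace Ω] [MeasurableSpace α]
    {P : Measure Ω} [SFinite P] {ν : Measure α} [IsProbabilityMeasure ν] {F : α → Ω → ℝ}
    (hm : Measurable (Function.uncurry F)) (hF : Integrable (Function.uncurry F) (ν.prod P)) :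
    ∀ᵐ u ∂(Measure.infinitePi fun _ : ℕ => ν), ∀ᵐ ω ∂P,
      Tendsto (fun N : ℕ => (∑ i ∈ Finset.range N, F (u i) ω) / N) atTop
        (𝓝 (∫ x, F x ω ∂ν)) := by
  have hlim : Measurable fun p : (ℕ → α) × Ω => ∫ x, F x p.2 ∂ν :=
    (StronglyMeasurable.integral_prod_left (f := F) hm.stronglyMeasurable).measurable.comp
      measurable_snd
  refine (Measure.ae_ae_comm (measurableSet_tendsto_fun (fun N => ?_) hlim)).2 ?_
  · refine (Finset.measurable_sum _ fun i _ => ?_).div_const _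
    exact hm.comp (f := fun p : (ℕ → α) × Ω => (p.1 i, p.2)) (((measurable_pi_apply i).comp measurable_fst).prodMk measurable_snd)
  · filter_upwards [hF.prod_left_ae] with ω hω
    have hmω : Measurable fun x => F x ω := hm.comp (measurable_id.prodMk measurable_const)
    have hev := fun i : ℕ => measurePreserving_eval_infinitePi (fun _ : ℕ => ν) i
    have hid : ∀ i : ℕ, IdentDistrib (fun u : ℕ → α => F (u i) ω) (fun x => F x ω)
        (Measure.infinitePi fun _ : ℕ => ν) ν := fun i => by
      refine ⟨(hmω.comp (measurable_pi_apply i)).aemeasurable, hmω.aemeasurable, ?_⟩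
      conv_rhs => rw [← (hev i).map_eq]
      exact (Measure.map_map hmω (hev i).measurable).symm
    have := strong_law_ae_real (μ := Measure.infinitePi fun _ : ℕ => ν)
      (fun i u => F (u i) ω) ((hid 0).integrable_iff.2 hω)
      (fun i j hij => (iIndepFun_infinitePi (P := fun _ : ℕ => ν)
        (X := fun _ x => F x ω) fun _ => hmω).indepFun hij)
      (fun i => (hid i).trans (hid 0).symm)
    simpa only [(hid 0).integral_eq] using this

theorem integrable_gaussianReal_iff {f : ℝ → ℝ} : Integrable f (gaussianReal 0 1) ↔
    Integrable fun x => gaussianPDFReal 0 1 x * f x := by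
  rw [gaussianReal_of_var_ne_zero _ one_ne_zero,
    integrable_withDensity_iff_integrable_smul' (measurable_gaussianPDF _ _)
      (ae_of_all _ fun x => ENNReal.ofReal_lt_top)]
  simp only [toReal_gaussianPDF, smul_eq_mul]

variable {n : ℕ} {η : MatrixMeasure n}

/-- The density of `kernelConv η` with respect to the standard Gaussian distribution. -/
noncomputable def samplingWeight (η : MatrixMeasure n) (x : ℝ) (j k : Fin n) : ℝ :=
  kernelConv η x j k / gaussianPDFReal 0 1 x

/-- The Gaussian law enters only through having a density that vanishes nowhere. -/
theorem gaussianPDFReal_mul_samplingWeight (x : ℝ) (j k : Fin n) :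
    gaussianPDFReal 0 1 x * samplingWeight η x j k = kernelConv η x j k :=
  mul_div_cancel₀ _ (gaussianPDFReal_pos 0 1 x one_ne_zero).ne'

variable {Ω : Type*}

/-- The average of weighted increments of `Z` at the sampling points `u`. -/
noncomputable def incrementAverage (η : MatrixMeasure n) (Z : ℝ → Ω → Fin n → ℝ) (u : ℕ → ℝ)
    (N : ℕ) (t : ℝ) (ω : Ω) (j : Fin n) : ℝ :=
  (∑ i ∈ Finset.range N, ∑ k, samplingWeight η (u i) j k * (Z (t - u i) ω k - Z t ω k)) / N

theorem measurable_incrementAverage (hη : ConcentratedOnNonneg η)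
    (hdet : ∀ z : ℂ, z.re ≤ 0 → (charFn η z).det ≠ 0) (Z : ℝ → Ω → Fin n → ℝ) (u : ℕ → ℝ)
    (N : ℕ) (t : ℝ) (j : Fin n) :
    Measurable[incrementSigma Z t] fun ω => incrementAverage η Z u N t ω j := by
  let _ : MeasurableSpace Ω := incrementSigma Z t
  refine (Finset.measurable_sum _ fun i _ => Finset.measurable_sum _ fun k _ => ?_).div_const _
  -- Negative nodes have weight zero since A vanishes there, a node at zero gives a zero increment,
  -- and positive nodes look only into the past.
  rcases lt_trichotomy (u i) 0 with hi | hi | hi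
  · simp only [samplingWeight, kernelConv_eq_zero_of_neg hη hdet hi, zero_div, zero_mul]
    exact measurable_const
  · simp only [hi, sub_zero, sub_self, mul_zero]
    exact measurable_const
  · refine measurable_const.mul ?_
    have h1 : Measurable[incrementSigma Z t] fun ω => Z t ω - Z (t - u i) ω :=
      (comap_measurable _).mono
        (le_iSup (fun s : Set.Iio t => MeasurableSpace.comap (fun ω => Z t ω - Z s ω) inferInstance)
          ⟨t - u i, Set.mem_Iio.2 (sub_lt_self t hi)⟩) le_rfl
    simpa [Function.comp_def, Pi.neg_def] using ((measurable_pi_apply k).comp h1).neg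

variable [MeasurableSpace Ω] {P : Measure Ω} {Z : ℝ → Ω → Fin n → ℝ}

/-- The mean of one summand under the Gaussian is ∫ A(x)(Z_{t-x} - Z_t) dx, and ∫ A = -I turns this
into Z_t + A ∗ Z(t). -/
theorem ae_tendsto_incrementAverage [SFinite P] (hη : ConcentratedOnNonneg η)
    (hmom : HasMoment η 2) (hdet : ∀ y : ℝ, (charFn η (Complex.I * (y : ℂ))).det ≠ 0)
    (hZ : ∀ k, HasLinearGrowth (fun t ω => Z t ω k) P) (t : ℝ) :
    ∀ᵐ u ∂(Measure.infinitePi fun _ : ℕ => gaussianReal 0 1), ∀ᵐ ω ∂P,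
      Tendsto (fun N => incrementAverage η Z u N t ω) atTop
        (𝓝 (convProcess η (kernel η) Z t ω)) := by
  have hA := hasFirstMoment_kernelConv hη hmom hdet
  have hw : ∀ j k, Measurable fun x => samplingWeight η x j k := fun j k =>
    (hA j k).measurable.div (measurable_gaussianPDFReal 0 1)
  have hweight : ∀ (φ : ℝ → ℝ) (x : ℝ) (j k : Fin n), gaussianPDFReal 0 1 x *
      (φ x * samplingWeight η x j k) = φ x * kernelConv η x j k := fun φ x j k => by
    rw [← gaussianPDFReal_mul_samplingWeight, mul_left_comm]
  have h1 : ∀ j k, Integrable (fun p : ℝ × Ω => samplingWeight η p.1 j k * Z (t - p.1) p.2 k)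
      ((gaussianReal 0 1).prod P) := fun j k => by
    refine (hZ k).integrable_prod (T := fun x => t - x) (hw j k) (by fun_prop) ?_
    rw [integrable_gaussianReal_iff]
    refine ((hA j k).integrable_comp_sub t).congr (ae_of_all _ fun x => ?_)
    exact (hweight (fun x => 1 + |t - x|) x j k).symm
  have h2 : ∀ j k, Integrable (fun p : ℝ × Ω => samplingWeight η p.1 j k * Z t p.2 k)
      ((gaussianReal 0 1).prod P) := fun j k => by
    refine (hZ k).integrable_prod (T := fun _ => t) (hw j k) (by fun_prop) ?_
    simp only [integrable_gaussianReal_iff]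
    refine ((hA j k).integrable.const_mul (1 + |t|)).congr (ae_of_all _ fun x => ?_)
    exact (hweight (fun _ => 1 + |t|) x j k).symm
  have h3 : ∀ j, Integrable (Function.uncurry fun x ω =>
      ∑ k, samplingWeight η x j k * (Z (t - x) ω k - Z t ω k)) ((gaussianReal 0 1).prod P) := by
    intro j
    simp only [mul_sub]
    exact integrable_finsetSum _ fun k _ => (h1 j k).sub (h2 j k)
  have h4 : ∀ j, Measurable (Function.uncurry fun x ω =>
      ∑ k, samplingWeight η x j k * (Z (t - x) ω k - Z t ω k)) := by
    intro j
    refine Finset.measurable_sum _ fun k _ => ((hw j k).comp measurable_fst).mul ?_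
    exact ((hZ k).measurable.comp (by fun_prop : Measurable fun p : ℝ × Ω => (t - p.1, p.2))).sub
      ((hZ k).measurable.comp (by fun_prop : Measurable fun p : ℝ × Ω => (t, p.2)))
  have h5 : ∀ᵐ ω ∂P, ∀ j k, Integrable fun x => kernelConv η x j k * Z (t - x) ω k := by
    simp only [ae_all_iff]
    exact fun j k => (hZ k).ae_integrable (T := fun x => t - x) (hA j k).measurable (by fun_prop)
      ((hA j k).integrable_comp_sub t)
  filter_upwards [ae_all_iff.2 fun j => ae_tendsto_average (h4 j) (h3 j)] with u hu
  filter_upwards [ae_all_iff.2 hu, h5] with ω hω h5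
  rw [tendsto_pi_nhds]
  intro j
  have h7 : convProcess η (kernel η) Z t ω j = ∫ x, ∑ k, samplingWeight η x j k *
      (Z (t - x) ω k - Z t ω k) ∂gaussianReal 0 1 := by
    rw [integral_gaussianReal_eq_integral_smul one_ne_zero, convProcess_kernel_apply]
    simp only [smul_eq_mul, Finset.mul_sum, ← mul_assoc, gaussianPDFReal_mul_samplingWeight, mul_sub]
    have h6 : ∀ k, Integrable fun x => kernelConv η x j k * Z t ω k := fun k =>
      (hA j k).integrable.mul_const _
    have h8 : ∀ k, ∫ x, (kernelConv η x j k * Z (t - x) ω k - kernelConv η x j k * Z t ω k) =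
        (∫ x, kernelConv η x j k * Z (t - x) ω k) +
          (1 : Matrix (Fin n) (Fin n) ℝ) j k * Z t ω k := fun k => by
      rw [integral_sub (h5 j k) (h6 k), integral_mul_const, integral_kernelConv hη hmom hdet]
      ring
    rw [integral_finsetSum (f := fun k x =>
      kernelConv η x j k * Z (t - x) ω k - kernelConv η x j k * Z t ω k) _
      fun k _ => (h5 j k).sub (h6 k), Finset.sum_congr rfl fun k _ => h8 k,
      Finset.sum_add_distrib]
    simp [Matrix.one_apply, add_comm]
  rw [h7]
  exact hω j

theorem HasStationaryIncrements.identDistrib {ι : Type*} [Fintype ι]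
    (h : HasStationaryIncrements Z P) (r : ℝ) (τ : ι → ℝ) :
    IdentDistrib (fun ω (i : ι) => Z (τ i + r) ω - Z r ω) (fun ω i => Z (τ i) ω - Z 0 ω) P P := by
  let e := Fintype.equivFin ι
  have := (h r (Fintype.card ι) (τ ∘ e.symm)).comp
    (u := fun (y : Fin (Fintype.card ι) → Fin n → ℝ) i => y (e i)) (by fun_prop)
  simpa [Function.comp_def] using this

theorem HasStationaryIncrements.identDistrib_incrementAverage (h : HasStationaryIncrements Z P)
    (η : MatrixMeasure n) (u : ℕ → ℝ) (N : ℕ) (r : ℝ) {m : ℕ} (τ : Fin m → ℝ) :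
    IdentDistrib (fun ω (i : Fin m) => incrementAverage η Z u N (τ i + r) ω)
      (fun ω i => incrementAverage η Z u N (τ i) ω) P P := by
  -- The index `none` stands for the time τ_i itself and `some l` for the shifted time τ_i - u_l.
  let Φ : (Fin m × Option (Fin N) → Fin n → ℝ) → Fin m → Fin n → ℝ := fun y i j =>
    (∑ l : Fin N, ∑ k, samplingWeight η (u l) j k * (y (i, some l) k - y (i, none) k)) / N
  have hΦ : Measurable Φ := by fun_prop
  let σ : Fin m × Option (Fin N) → ℝ := fun p => τ p.1 - p.2.elim 0 fun l => u l
  -- Since Φ sees only differences, an arbitrary common value c may be subtracted; taking c = Z r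
  -- and c = Z 0 produces the two sides of the stationarity of increments.
  have e : ∀ (ρ : ℝ) (c : Ω → Fin n → ℝ),
      (fun ω (i : Fin m) => incrementAverage η Z u N (τ i + ρ) ω) =
        Φ ∘ fun ω p => Z (σ p + ρ) ω - c ω := by
    intro ρ c
    ext ω i j
    simp only [Φ, σ, incrementAverage, Function.comp_apply, Option.elim_some, Option.elim_none,
      Pi.sub_apply, sub_sub_sub_cancel_right, sub_zero, sub_add_eq_add_sub]
    rw [Finset.sum_range]
  have e0 := e 0 (Z 0)
  simp only [add_zero] at e0
  rw [e r (Z r), e0]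
  exact (h.identDistrib r σ).comp hΦ

theorem isStationary_convProcess [IsProbabilityMeasure P] (hη : ConcentratedOnNonneg η)
    (hmom : HasMoment η 2) (hdet : ∀ y : ℝ, (charFn η (Complex.I * (y : ℂ))).det ≠ 0)
    (hZ : ∀ k, HasLinearGrowth (fun t ω => Z t ω k) P) (h : HasStationaryIncrements Z P) :
    IsStationary (convProcess η (kernel η) Z) P := by
  intro r m τ
  have hX := hasLinearGrowth_convProcess hη hmom hdet hZ
  have hm : ∀ σ : Fin m → ℝ,
      AEMeasurable (fun ω (i : Fin m) => convProcess η (kernel η) Z (σ i) ω) P := fun σ =>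
    aemeasurable_pi_lambda _ fun i => aemeasurable_pi_lambda _ fun j =>
      ((hX j).integrable (σ i)).aemeasurable
  have hlim := ae_tendsto_incrementAverage hη hmom hdet hZ
  -- Finitely many times are involved, so a single sequence of nodes serves all of them, before and
  -- after the shift.
  obtain ⟨u, hu, hu'⟩ := ((ae_all_iff.2 fun i => hlim (τ i + r)).and
    (ae_all_iff.2 fun i => hlim (τ i))).exists
  refine identDistrib_of_tendsto (hm _) (hm _)
    (fun N => h.identDistrib_incrementAverage η u N r τ) ?_ ?_
  · filter_upwards [ae_all_iff.2 hu] with ω hω using tendsto_pi_nhds.2 hω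
  · filter_upwards [ae_all_iff.2 hu'] with ω hω using tendsto_pi_nhds.2 hω

theorem isCausal_convProcess [SFinite P] (hη : ConcentratedOnNonneg η)
    (hmom : HasMoment η 2) (hdet : ∀ z : ℂ, z.re ≤ 0 → (charFn η z).det ≠ 0)
    (hZ : ∀ k, HasLinearGrowth (fun t ω => Z t ω k) P) :
    IsCausal Z (convProcess η (kernel η) Z) P := by
  intro t
  obtain ⟨u, hu⟩ := (ae_tendsto_incrementAverage hη hmom
    (fun y => hdet _ (by simp)) hZ t).exists
  -- The upper limit is measurable for the increment σ-algebra even on the null set where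
  -- convergence fails, and it equals X_t off that set.
  refine ⟨fun ω j => limsup (fun N => incrementAverage η Z u N t ω j) atTop, ?_, ?_⟩
  · exact @measurable_pi_lambda _ _ _ (incrementSigma Z t) _ _ fun j =>
      @Measurable.limsup _ _ _ _ _ (incrementSigma Z t) _ _ _ _
        fun N => measurable_incrementAverage hη hdet Z u N t j
  · filter_upwards [hu] with ω hω
    exact funext fun j => ((tendsto_pi_nhds.1 hω j).limsup_eq).symm

end MonteCarlo

end MSDDE

/-! ### Transfer to arbitrary kernels and conclusion -/

namespace MSDDE

variable {n : ℕ} {η : MatrixMeasure n} {Ω : Type*} {Z : ℝ → Ω → Fin n → ℝ}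

/-- The convolution enters only under a Lebesgue integral, so a change of g on a null set leaves the
process unchanged at every t and ω, default values of divergent integrals included. -/
theorem convProcess_congr_ae {g g' : ℝ → Matrix (Fin n) (Fin n) ℝ} (h : g =ᵐ[volume] g')
    (η : MatrixMeasure n) (Z : ℝ → Ω → Fin n → ℝ) : convProcess η g Z = convProcess η g' Z := by
  funext t ω j
  have h1 := (Measure.measurePreserving_sub_left (volume : Measure ℝ) t).quasiMeasurePreserving.ae
    (conv_congr_ae h η)
  rw [convProcess, convProcess]
  congr 1
  refine Finset.sum_congr rfl fun k _ => integral_congr_ae ?_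
  filter_upwards [h1] with u hu
  rw [hu]

variable [MeasurableSpace Ω] {P : Measure Ω}

theorem ae_integrable_kernelConv_mul [SFinite P] (hη : ConcentratedOnNonneg η)
    (hmom : HasMoment η 2) (hdet : ∀ y : ℝ, (charFn η (Complex.I * (y : ℂ))).det ≠ 0)
    (hZ : ∀ k, HasLinearGrowth (fun t ω => Z t ω k) P) (t : ℝ) :
    ∀ᵐ ω ∂P, ∀ j k, Integrable fun u => kernelConv η (t - u) j k * Z u ω k := by
  have hA := hasFirstMoment_kernelConv hη hmom hdet
  simp only [ae_all_iff]
  intro j k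
  have hm := (hA j k).measurable
  filter_upwards [(hZ k).ae_integrable (T := fun x => t - x) hm (by fun_prop)
    ((hA j k).integrable_comp_sub t)] with ω hω
  exact (hω.comp_sub_left t).congr (ae_of_all _ fun r => by simp)

theorem isStationarySolution_convProcess [IsProbabilityMeasure P] (hη : ConcentratedOnNonneg η)
    (hmom : HasMoment η 2) (hdet : ∀ y : ℝ, (charFn η (Complex.I * (y : ℂ))).det ≠ 0)
    (hZ : ∀ k, HasLinearGrowth (fun t ω => Z t ω k) P) (h : HasStationaryIncrements Z P) :
    IsStationarySolution η Z (convProcess η (kernel η) Z) P where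
  measurable := measurable_pi_iff.2 fun j =>
    (hasLinearGrowth_convProcess hη hmom hdet hZ j).measurable
  integrable t := Integrable.of_eval fun j =>
    (hasLinearGrowth_convProcess hη hmom hdet hZ j).integrable t
  stationary := isStationary_convProcess hη hmom hdet hZ h
  equation := satisfiesMSDDE_convProcess hη hmom hdet hZ

end MSDDE
theorem mainTheorem1 {n : ℕ} (η : MSDDE.MatrixMeasure n)
    (hη : MSDDE.ConcentratedOnNonneg η)
    (hmom : MSDDE.HasMoment η 2)
    (hdet : ∀ y : ℝ, (MSDDE.charFn η (Complex.I * (y : ℂ))).det ≠ 0)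
    {Ω : Type*} [MeasurableSpace Ω] (P : Measure Ω) [IsProbabilityMeasure P]
    (Z : ℝ → Ω → Fin n → ℝ)
    (hZmeas : MSDDE.IsMeasurableProcess Z)
    (hZint : MSDDE.IsIntegrableProcess Z P)
    (hZinc : MSDDE.HasStationaryIncrements Z P) :
    -- the kernel exists and is determined up to null sets by its Fourier transform
    (∃ g, MSDDE.IsKernel η g) ∧
    (∀ g g', MSDDE.IsKernel η g → MSDDE.IsKernel η g' → g =ᵐ[volume] g') ∧
    ∀ g, MSDDE.IsKernel η g →
      -- the convolution is well defined
      (∀ᵐ t : ℝ, MSDDE.ConvDefinedAt g η t) ∧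
      (∀ t : ℝ, ∀ᵐ ω ∂P, ∀ j k,
        Integrable (fun u : ℝ => MSDDE.conv g η (t - u) j k * Z u ω k)) ∧
      -- it is the unique stationary and integrable solution, up to modification
      MSDDE.IsStationarySolution η Z (MSDDE.convProcess η g Z) P ∧
      (∀ X : ℝ → Ω → Fin n → ℝ, MSDDE.IsStationarySolution η Z X P →
        ∀ t, X t =ᵐ[P] MSDDE.convProcess η g Z t) ∧
      -- causality
      ((∀ z : ℂ, z.re ≤ 0 → (MSDDE.charFn η z).det ≠ 0) →
        MSDDE.IsCausal Z (MSDDE.convProcess η g Z) P) := by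
  have hZ : ∀ k, MSDDE.HasLinearGrowth (fun t ω => Z t ω k) P :=
    MSDDE.hasLinearGrowth_component hZmeas hZint
      (MSDDE.exists_linear_bound_of_stationaryIncrements hZmeas hZint hZinc)
  refine ⟨⟨_, MSDDE.isKernel_kernel hη hmom hdet⟩, fun g g' hg hg' => hg.ae_eq hg', fun g hg => ?_⟩
  have hgk := hg.ae_eq (MSDDE.isKernel_kernel hη hmom hdet)
  have hconv := MSDDE.conv_congr_ae hgk η
  -- From here on the process is the one built from the constructed kernel.
  rw [MSDDE.convProcess_congr_ae hgk η Z]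
  have hX := MSDDE.isStationarySolution_convProcess hη hmom hdet hZ hZinc
  refine ⟨MSDDE.convDefinedAt_ae (fun j k => ?_) η, fun t => ?_, hX, fun X h t => ?_, fun hdet' =>
    MSDDE.isCausal_convProcess hη hmom hdet' hZ⟩
  · refine (MSDDE.hasFirstMoment_kernel hη hmom hdet j k).integrable.congr ?_
    filter_upwards [hgk] with t ht
    rw [ht]
  · filter_upwards [MSDDE.ae_integrable_kernelConv_mul hη hmom hdet hZ t] with ω hω j k
    refine (hω j k).congr ?_
    filter_upwards [(Measure.measurePreserving_sub_left (volume : Measure ℝ)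
      t).quasiMeasurePreserving.ae hconv] with u hu
    rw [hu, MSDDE.kernelConv]
  · exact h.equation.ae_eq hη hmom hdet hX.equation h.hasLinearGrowth hX.hasLinearGrowth t
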